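/- **Setting.** Let $D\subset\mathbb R^d$ be a domain (non-empty, open, connected), $\delta_D(x)=\mathrm{dist}(x,\partial D)$, and let $$Au(x)=\tfrac12\mathrm{Tr}(\mathbf Q(x)\nabla^2u(x))+b(x)\cdot\nabla u(x)+\int_{\mathbb R^d}\Big(u(x+y)-u(x)-\frac{y\cdot\nabla u(x)}{1+|y|^2}\Big)N(x,dy),$$ where $\mathbf Q,b$ are Borel measurable, bounded on $D$, $\mathbf Q(x)$ is non-negative definite for $x\in D$, and $N$ is a kernel of measures on $\mathbb R^d\setminus\{0\}$ with $\sup_{x\in\mathbb R^d}\int\min\{1,|y|^2\}N(x,dy)<\infty$. Let $(P_x)_{x\in\mathbb R^d}$ be a strong Markovian solution of the martingale problem for $A$ on the space of càdlàg paths in $\mathbb R^d$: $x\mapsto P_x$ is measurable, under $P_x$ the canonical process $(X_t)$ starts at $x$ and $f(X_t)-f(X_0)-\int_0^tAf(X_r)\,dr$ is a martingale in the natural filtration for every $f\in C_b^2(\mathbb R^d)$, the same holds for the mixtures $P_\mu=\int P_x\,\mu(dx)$ with initial law $\mu$, and $(X_t)$ is strongly Markovian. Let $\tau_D=\inf\{t>0:X_t\notin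 D\}$ and assume $P_x[\tau_D<\infty]=1$ for $x\in D$. Put $P^D_tf(x)=\mathbb E_x[f(X_t),t<\tau_D]$ and $R^D_\alpha f=\int_0^\infty e^{-\alpha t}P^D_tf\,dt$. Let $c:D\to[0,\infty)$ be bounded and Borel, $\bar c_D=\sup_Dc$, $e_c(t)=\exp\{-\int_0^tc(X_r)\,dr\}$, and let $g:D\to(-\infty,0]$ be Borel, $g^-=-g$. A bounded Borel function $u:\mathbb R^d\to\mathbb R$ is a *weak subsolution* of $(-A+c)v=g$ in $D$ if $$u(x)\le\mathbb E_x\big[e_c(\tau_D\wedge t)u(X_{\tau_D\wedge t})\big]+\mathbb E_x\Big[\int_0^{\tau_D\wedge t}e_c(r)g(X_r)\,dr\Big],\qquad x\in D,\ t\ge0.$$ Let $D_S=D\cup\partial D\cup\bigcup_{x\in D}(x+\mathrm{supp}\,N(x,\cdot))$ and $\bar u_{D_S}=\sup_{D_S}u$. Let $m$ be a $\sigma$-finite Borel measure such that every $m$-null Borel subset of $D$ is Lebesgue null (for instance Lebesgue measure). Let $\varphi_D:D\to[0,\infty)$ satisfy (a) or (b): (a) $(P^D_t)$ is intrinsically ultracontractive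 with eigenfunction $\varphi_D$, that is: $m(D)<\infty$; for each $t>0$, $P^D_tf(x)=\int_Dp_D(t,x,y)f(y)\,m(dy)$ with $p_D(t,\cdot,\cdot)$ bounded, continuous and strictly positive on $D\times D$; there are $\lambda_D>0$ and $\hat\varphi_D$ such that $\varphi_D,\hat\varphi_D$ are bounded, continuous, strictly positive and, for $t>0$, $x\in D$, $e^{-\lambda_Dt}\varphi_D(x)=\int_Dp_D(t,x,y)\varphi_D(y)\,m(dy)$ and $e^{-\lambda_Dt}\hat\varphi_D(x)=\int_Dp_D(t,y,x)\hat\varphi_D(y)\,m(dy)$; and for each $t>0$ there is $c_t>0$ with $p_D(t,x,y)\le c_t\varphi_D(x)\hat\varphi_D(y)$ on $D\times D$; (b) $\varphi_D$ is a non-negative Borel eigenfunction, i.e. $P^D_t\varphi_D=e^{-\lambda_Dt}\varphi_D$ on $D$ for all $t\ge0$ and some $\lambda_D\ge0$, with $\int_D\varphi_D\,dm>0$; and there is a Borel measure $\nu$ on $D$, all of whose null subsets of $D$ are $m$-null, such that $R^D_{\bar c_D}f(x)\ge\varphi_D(x)\int_Df\,d\nu$ for all $x\in D$ and all bounded Borel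 $f\ge0$. Suppose that $\varphi_D\sim\phi(\delta_D)$ on $D$ for some function $\phi:(0,\infty)\to(0,\infty)$, i.e. each of the two functions is bounded on $D$ by a positive constant times the other. **Corollary 5.3.** 1) Let $u$ be a weak subsolution of $(-A+c)v=g$ in $D$ that is not constant Lebesgue-a.e. in $D$. Then there exists $a>0$ such that for every $\hat x\in\partial D$ with $u(\hat x)=\bar u_{D_S}\ge0$, $$\liminf_{x\to\hat x,\ x\in D}\frac{u(\hat x)-u(x)}{\phi(\delta_D(x))}\ge a.$$ 2) Suppose in addition that $\int_Dc\,dm>0$ and $\int_Dg^-(y)\,dy<\infty$. Then there exists $a>0$ (which may depend on $A,D,c,g$, but not on $u$ or $\hat x$) such that for every weak subsolution $u$ of $(-A+c)v=g$ in $D$ that is not constant Lebesgue-a.e. in $D$ and every $\hat x\in\partial D$ with $u(\hat x)=\bar u_{D_S}\ge0$, $$\liminf_{x\to\hat x,\ x\in D}\frac{u(\hat x)-u(x)}{\phi(\delta_D(x))}\ge a\Big(u(\hat x)+\int_Dg^-(y)\,dy\Big).$$ -/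

import Mathlib

open MeasureTheory ProbabilityTheory Filter Topology Set
open scoped NNReal ENNReal

noncomputable section

/-- `ℝ^d` with its Euclidean norm. -/
abbrev Rd (d : ℕ) := EuclideanSpace ℝ (Fin d)

/-! ### The integro-differential operator -/

/-- The coefficients `(Q, b, N)` of a second order integro-differential operator. -/
structure LevyCoeff (d : ℕ) where
  /-- the diffusion matrix `Q(x)` -/
  q : Rd d → Matrix (Fin d) (Fin d) ℝ
  /-- the drift `b(x)` -/
  b : Rd d → Rd d
  /-- the Levy kernel `N(x, dy)` -/
  N : Kernel (Rd d) (Rd d)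

/-- `A u (x) = ½ Tr(Q(x) ∇²u(x)) + b(x)·∇u(x)
  + ∫ (u(x+y) - u(x) - y·∇u(x)/(1+|y|²)) N(x,dy)`. -/
def LevyCoeff.op {d : ℕ} (A : LevyCoeff d) (u : Rd d → ℝ) (x : Rd d) : ℝ :=
  (1 / 2 : ℝ) * (∑ i, ∑ j, A.q x i j *
      iteratedFDeriv ℝ 2 u x ![EuclideanSpace.single i 1, EuclideanSpace.single j 1])
    + fderiv ℝ u x (A.b x)
    + ∫ y, (u (x + y) - u x - fderiv ℝ u x y / (1 + ‖y‖ ^ 2)) ∂(A.N x)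

/-- The assumptions on the coefficients: `Q` and `b` are Borel, bounded on `D`, `Q` is
non-negative definite on `D`; `N(x, ·)` lives on `ℝ^d ∖ {0}` and
`sup_x ∫ min(1, |y|²) N(x, dy) < ∞` (which forces `N(x, ·)` to be σ-finite). -/
structure LevyCoeff.Admissible {d : ℕ} (A : LevyCoeff d) (D : Set (Rd d)) : Prop where
  measurable_q : ∀ i j, Measurable fun x => A.q x i j
  measurable_b : Measurable A.b
  bounded : ∃ C : ℝ, ∀ x ∈ D, (∀ i j, |A.q x i j| ≤ C) ∧ ‖A.b x‖ ≤ C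
  nonneg : ∀ x ∈ D, ∀ ξ : Fin d → ℝ, 0 ≤ ∑ i, ∑ j, A.q x i j * ξ i * ξ j
  kernel_zero : ∀ x, A.N x {0} = 0
  kernel_bound : ∃ C : ℝ≥0, ∀ x, ∫⁻ y, ENNReal.ofReal (min 1 (‖y‖ ^ 2)) ∂(A.N x) ≤ C

/-- The range of non-locality `S(D) = ⋃_{x ∈ D} (x + supp N(x, ·))`. -/
def LevyCoeff.nonlocalRange {d : ℕ} (A : LevyCoeff d) (D : Set (Rd d)) : Set (Rd d) :=
  ⋃ x ∈ D, (fun y => x + y) '' (A.N x).support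

/-- `D_S = D ∪ ∂_S D`, where `∂_S D = ∂D ∪ (S(D) ∖ D)` is the extended boundary. -/
def LevyCoeff.extendedClosure {d : ℕ} (A : LevyCoeff d) (D : Set (Rd d)) : Set (Rd d) :=
  (frontier D ∪ (A.nonlocalRange D \ D)) ∪ D

/-! ### The canonical process and the martingale problem -/

/-- The path space `D([0,∞); ℝ^d)` of right continuous paths with left limits.  Its σ-algebra
(found through `Subtype`) is generated by the coordinates; it is the Borel σ-algebra of the
Skorokhod topology. -/
abbrev CadlagPath (d : ℕ) :=
  {ω : ℝ≥0 → Rd d // ∀ t, ContinuousWithinAt ω (Ici t) t ∧ ∃ l, Tendsto ω (𝓝[<] t) (𝓝 l)}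

/-- The canonical process `X_t(ω) = ω(t)`. -/
def canonical (d : ℕ) (t : ℝ≥0) (ω : CadlagPath d) : Rd d := ω.1 t

theorem measurable_canonical (d : ℕ) (t : ℝ≥0) : Measurable (canonical d t) :=
  (measurable_pi_apply t).comp measurable_subtype_coe

/-- The natural filtration `F_t = σ(X_s, s ≤ t)` of the canonical process. -/
def canonicalFiltration (d : ℕ) : Filtration ℝ≥0 (inferInstance : MeasurableSpace (CadlagPath d)) :=
  Filtration.natural (canonical d) fun t => (measurable_canonical d t).stronglyMeasurable

/-- The shift `(θ_t ω)(s) = ω(t + s)`. -/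
def pathShift {d : ℕ} (t : ℝ≥0) (ω : CadlagPath d) : CadlagPath d :=
  ⟨fun s => ω.1 (t + s), fun s => by
    obtain ⟨hr, l, hl⟩ := ω.2 (t + s)
    refine ⟨hr.comp (continuous_const.add continuous_id).continuousWithinAt
      fun r hr' => add_le_add_right hr' t, l, hl.comp ?_⟩
    refine tendsto_nhdsWithin_of_tendsto_nhds_of_eventually_within _
      ((continuous_const.add continuous_id).continuousAt.mono_left nhdsWithin_le_nhds) ?_
    filter_upwards [self_mem_nhdsWithin] with r hr'
    exact add_lt_add_right hr' t⟩

/-- `f ∈ C_b²(ℝ^d)`: `f` is `C²` and bounded together with its first two derivatives. -/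
def IsCb2 {d : ℕ} (f : Rd d → ℝ) : Prop :=
  ContDiff ℝ 2 f ∧ ∃ C : ℝ, ∀ x, |f x| ≤ C ∧ ‖fderiv ℝ f x‖ ≤ C ∧ ‖iteratedFDeriv ℝ 2 f x‖ ≤ C

/-- `Q` is a solution of the martingale problem for `A` with initial distribution `μ`: for
`f ∈ C_b²`, the process `f(X_t) - f(X_0) - ∫_0^t A f(X_r) dr` is well defined almost surely and is
a martingale for the natural filtration. -/
structure IsMartingaleSolution {d : ℕ} (A : LevyCoeff d) (μ : Measure (Rd d))
    (Q : Measure (CadlagPath d)) : Prop where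
  prob : IsProbabilityMeasure Q
  initial : Q.map (canonical d 0) = μ
  integrable : ∀ f, IsCb2 f → ∀ᵐ ω ∂Q, ∀ t : ℝ≥0,
    IntervalIntegrable (fun r : ℝ => A.op f (canonical d r.toNNReal ω)) volume 0 t
  martingale : ∀ f, IsCb2 f → Martingale
    (fun (t : ℝ≥0) (ω : CadlagPath d) => f (canonical d t ω) - f (canonical d 0 ω)
      - ∫ r in (0 : ℝ)..t, A.op f (canonical d r.toNNReal ω))
    (canonicalFiltration d) Q

/-- `(P_x)` is a strong Markovian solution of the martingale problem for `A`.  Measurability of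
`x ↦ P_x[C]` is part of `Kernel`. -/
structure IsStrongMarkovSolution {d : ℕ} (A : LevyCoeff d) (P : Kernel (Rd d) (CadlagPath d)) :
    Prop where
  solution : ∀ x, IsMartingaleSolution A (Measure.dirac x) (P x)
  strongMarkov : ∀ (x : Rd d) (T : CadlagPath d → WithTop ℝ≥0)
    (hT : IsStoppingTime (canonicalFiltration d) T) (B C : Set (CadlagPath d)),
    MeasurableSet[hT.measurableSpace] B → MeasurableSet C →
    P x (B ∩ {ω | T ω ≠ ⊤ ∧ pathShift ((T ω).untopD 0) ω ∈ C}) =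
      ∫⁻ ω in B ∩ {ω | T ω ≠ ⊤}, P (canonical d ((T ω).untopD 0) ω) C ∂(P x)
  mixture : ∀ μ : Measure (Rd d), IsProbabilityMeasure μ → IsMartingaleSolution A μ (μ.bind P)

/-! ### Exit time, killed semigroup and resolvent -/

/-- The exit time `τ_D = inf {t > 0 : X_t ∉ D}`, with `inf ∅ = ∞`. -/
def exitTime {d : ℕ} (D : Set (Rd d)) (ω : CadlagPath d) : ℝ≥0∞ :=
  sInf {s : ℝ≥0∞ | ∃ t : ℝ≥0, 0 < t ∧ canonical d t ω ∉ D ∧ s = t}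

/-- `τ_D ∧ t`. -/
def exitMin {d : ℕ} (D : Set (Rd d)) (t : ℝ≥0) (ω : CadlagPath d) : ℝ≥0 :=
  (min (exitTime D ω) t).toNNReal

/-- The exit time from `D` is almost surely finite, from every starting point in `D`. -/
def ExitFinite {d : ℕ} (P : Kernel (Rd d) (CadlagPath d)) (D : Set (Rd d)) : Prop :=
  ∀ x ∈ D, ∀ᵐ ω ∂(P x), exitTime D ω < ∞

/-- `P^D_t f(x) = E_x[f(X_t), t < τ_D]` for `f ≥ 0`. -/
def killedSemigroup {d : ℕ} (P : Kernel (Rd d) (CadlagPath d)) (D : Set (Rd d)) (t : ℝ≥0)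
    (f : Rd d → ℝ≥0∞) (x : Rd d) : ℝ≥0∞ :=
  ∫⁻ ω, {ω | (t : ℝ≥0∞) < exitTime D ω}.indicator (fun ω => f (canonical d t ω)) ω ∂(P x)

/-- `R^D_α f(x) = ∫_0^∞ e^{-α t} P^D_t f(x) dt` for `f ≥ 0`. -/
def killedResolvent {d : ℕ} (P : Kernel (Rd d) (CadlagPath d)) (D : Set (Rd d)) (α : ℝ)
    (f : Rd d → ℝ≥0∞) (x : Rd d) : ℝ≥0∞ :=
  ∫⁻ t in Ioi (0 : ℝ), ENNReal.ofReal (Real.exp (-α * t)) * killedSemigroup P D t.toNNReal f x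

/-- `φD ≥ 0` is an eigenfunction with eigenvalue `lam ≥ 0`:
`e^{-lam t} φD(x) = P^D_t φD(x)` for `t ≥ 0`, `x ∈ D`, and `∫_D φD dm > 0`. -/
structure IsEigenpair {d : ℕ} (P : Kernel (Rd d) (CadlagPath d)) (D : Set (Rd d))
    (m : Measure (Rd d)) (φD : Rd d → ℝ) (lam : ℝ) : Prop where
  measurable : Measurable fun x : D => φD x
  nonneg : ∀ x ∈ D, 0 ≤ φD x
  eigenvalue_nonneg : 0 ≤ lam
  eigen : ∀ (t : ℝ≥0), ∀ x ∈ D, ENNReal.ofReal (Real.exp (-lam * t) * φD x) =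
    killedSemigroup P D t (fun y => ENNReal.ofReal (φD y)) x
  pos : 0 < ∫⁻ x in D, ENNReal.ofReal (φD x) ∂m

/-- The minorization condition by the eigenfunction `φD`: for some eigenvalue `φD` is a
non-negative eigenfunction, and `R^D_α f ≥ φD ∫_D f dν` on `D` for `f ≥ 0` bounded Borel. -/
def EigenMinorization {d : ℕ} (P : Kernel (Rd d) (CadlagPath d)) (D : Set (Rd d))
    (m : Measure (Rd d)) (φD : Rd d → ℝ) (α : ℝ) (ν : Measure (Rd d)) : Prop :=
  (∃ lam : ℝ, IsEigenpair P D m φD lam) ∧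
  ∀ f : Rd d → ℝ≥0∞, Measurable f → (∃ C : ℝ≥0, ∀ y, f y ≤ C) → ∀ x ∈ D,
    ENNReal.ofReal (φD x) * ∫⁻ y in D, f y ∂ν ≤ killedResolvent P D α f x

/-- `(P^D_t)` is intrinsically ultracontractive: `m` is finite on `D`, `P^D_t` has, with respect to
`m`, a density `p_D(t, ·, ·)` that is bounded, continuous and strictly positive on `D × D` for each
`t > 0`; `φD` and `φdual` are strictly positive bounded continuous eigenfunctions, for the
same eigenvalue, of `P^D_t` and of the semigroup with the transposed density; and
`p_D(t, x, y) ≤ c_t φD(x) φdual(y)`. -/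
def IntrinsicallyUltracontractive {d : ℕ} (P : Kernel (Rd d) (CadlagPath d)) (D : Set (Rd d))
    (m : Measure (Rd d)) (φD : Rd d → ℝ) : Prop :=
  m D < ∞ ∧ ∃ (p : ℝ≥0 → Rd d → Rd d → ℝ) (φdual : Rd d → ℝ) (lam : ℝ),
    (∀ t, 0 < t →
      ContinuousOn (Function.uncurry (p t)) (D ×ˢ D) ∧
      (∃ C : ℝ, ∀ x ∈ D, ∀ y ∈ D, p t x y ≤ C) ∧
      (∀ x ∈ D, ∀ y ∈ D, 0 < p t x y) ∧
      (∀ f : Rd d → ℝ≥0∞, Measurable f → (∃ C : ℝ≥0, ∀ y, f y ≤ C) → ∀ x ∈ D,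
        killedSemigroup P D t f x = ∫⁻ y in D, ENNReal.ofReal (p t x y) * f y ∂m)) ∧
    0 < lam ∧
    (ContinuousOn φD D ∧ (∀ x ∈ D, 0 < φD x) ∧ ∃ C : ℝ, ∀ x ∈ D, φD x ≤ C) ∧
    (ContinuousOn φdual D ∧ (∀ x ∈ D, 0 < φdual x) ∧ ∃ C : ℝ, ∀ x ∈ D, φdual x ≤ C) ∧
    (∀ t : ℝ≥0, 0 < t → ∀ x ∈ D,
      Real.exp (-lam * t) * φD x = ∫ y in D, p t x y * φD y ∂m ∧
      Real.exp (-lam * t) * φdual x = ∫ y in D, p t y x * φdual y ∂m) ∧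
    (∀ t : ℝ≥0, 0 < t → ∃ c : ℝ, 0 < c ∧ ∀ x ∈ D, ∀ y ∈ D, p t x y ≤ c * φD x * φdual y)

/-! ### Weak subsolutions -/

/-- `e_c(t) = exp(-∫_0^t c(X_r) dr)`. -/
def discount {d : ℕ} (c : Rd d → ℝ) (t : ℝ) (ω : CadlagPath d) : ℝ :=
  Real.exp (-∫ r in (0 : ℝ)..t, c (canonical d r.toNNReal ω))

/-- `u ∈ B_b(ℝ^d)` is a weak subsolution of `(-A + c) v = g` in `D`, where `g ≤ 0` on `D`:
`u(x) ≤ E_x[e_c(τ_D ∧ t) u(X_{τ_D ∧ t})] + E_x[∫_0^{τ_D ∧ t} e_c(r) g(X_r) dr]` for all `x ∈ D`,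
`t ≥ 0`.  The last term is `≤ 0`, possibly `-∞`; it is written on the left, as an integral of
`-g ≥ 0` with values in `[0, ∞]`. -/
structure IsWeakSubsolution {d : ℕ} (P : Kernel (Rd d) (CadlagPath d)) (D : Set (Rd d))
    (c g u : Rd d → ℝ) : Prop where
  measurable : Measurable u
  bounded : ∃ C : ℝ, ∀ x, |u x| ≤ C
  subsol : ∀ x ∈ D, ∀ t : ℝ≥0,
    ((u x : ℝ) : EReal)
      + ((∫⁻ ω, (∫⁻ r in Ioc (0 : ℝ) (exitMin D t ω),
          ENNReal.ofReal (discount c r ω * -g (canonical d r.toNNReal ω))) ∂(P x) : ℝ≥0∞) : EReal)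
    ≤ ((∫ ω, discount c (exitMin D t ω) ω * u (canonical d (exitMin D t ω) ω) ∂(P x) : ℝ) : EReal)

/-- `u` is not constant Lebesgue almost everywhere in `D`. -/
def NonconstantAE {d : ℕ} (D : Set (Rd d)) (u : Rd d → ℝ) : Prop :=
  ¬ ∃ k : ℝ, ∀ᵐ x ∂(volume.restrict D), u x = k

/-- `f ∼ h` on `B`: each is bounded by a positive constant times the other. -/
def ComparableOn {X : Type*} (B : Set X) (f h : X → ℝ) : Prop :=
  (∃ C : ℝ, 0 < C ∧ ∀ x ∈ B, f x ≤ C * h x) ∧ (∃ C : ℝ, 0 < C ∧ ∀ x ∈ B, h x ≤ C * f x)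

/-- `δ_D(x) = dist(x, ∂D)`. -/
def distBoundary {d : ℕ} (D : Set (Rd d)) (x : Rd d) : ℝ := Metric.infDist x (frontier D)

/-- `x̂ ∈ ∂D` and `u(x̂) = sup_{D_S} u ≥ 0`. -/
def IsBoundaryMax {d : ℕ} (A : LevyCoeff d) (D : Set (Rd d)) (u : Rd d → ℝ) (xh : Rd d) : Prop :=
  xh ∈ frontier D ∧ IsLUB (u '' A.extendedClosure D) (u xh) ∧ 0 ≤ u xh

/-- `liminf_{x → x̂, x ∈ D} (u(x̂) - u(x)) / φ(δ_D(x))`, as an extended real number. -/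
def boundaryLiminf {d : ℕ} (D : Set (Rd d)) (φ : ℝ → ℝ) (u : Rd d → ℝ) (xh : Rd d) : EReal :=
  liminf (fun x => (((u xh - u x) / φ (distBoundary D x) : ℝ) : EReal)) (𝓝[D] xh)

end

/-!
Write `M = u(x̂)` for the maximum and `w = M - u` for the gap, which is non-negative on `D_S`.  Every
case reduces to a bound `κ φ_D ≤ w` on all of `D`: since `φ(δ_D) ≤ C φ_D`, it gives
`w / φ(δ_D) ≥ κ / C` near every boundary point, and this passes to the lower limit.

**Exit through the extended closure.**  The inequality that defines a weak subsolution only uses `u`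
at the exit position, where it is at most `M` as soon as the process leaves `D` into `D_S`.  The
martingale problem provides this.  Let `S` be the first time at which the path or its left limit
meets the complement of `D` (`approachTime`); unlike the exit time it is handled by elementary
measurability arguments on path space.  For a bump function `f` and a weight `h` that vanishes where
`f` does not, optional sampling over the cells of a fine time grid bounds the mean of
`h(X_{S-}) f(X_S)` by that of `∫_0^S h(X_r) N(X_r, supp f - supp h) dr`
(`IsMartingaleSolution.lintegral_jump_le`).  A countable family of balls then shows that the jump at
`S`, if there is one, starts in `D` and has its size in the support of the Lévy kernel
(`IsMartingaleSolution.ae_jump`).  Hence the exit time equals `S` and the exit position is in `D_S`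
(`IsStrongMarkovSolution.ae_exitTime_eq`).

**Three lower bounds for the gap.**  Inserting this into the subsolution inequality
(`IsWeakSubsolution.lintegral_add_le`), with `K` a bound for `c`, one finds that `w` is excessive,
`e^{-Kt} P^D_t w ≤ w`, and that on `D` it dominates both `M e^{-Kt} ∫_0^t P^D_r c dr` and
`e^{-Kt} ∫_0^t P^D_r g⁻ dr`.  Each is a multiple of some `∫_0^T P^D_r f dr`, with `f = w`, `f = c`,
or `f = min(g⁻, 1)`.

**Comparison with the eigenfunction.**  If `f ≥ 0` is bounded and not `m`-null, then `w` dominates a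
multiple of `φ_D` as soon as it dominates `∫_0^T P^D_r f dr`, with a constant that does not depend
on `w` (`exists_mul_le_gap`).

* With a minorized resolvent, replace `f` by `min(f, φ_D)`.  The eigenvalue equation bounds the part
  of the resolvent after time `T` by a small multiple of `φ_D`, so that the minorization survives the
  restriction to `[0, T]` (`EigenMinorization.exists_le_lintegral`).  This needs `K + λ > 0`; for
  `K = λ = 0` the eigenfunction would be bounded and would be annihilated by the killing
  (`EigenMinorization.eigenvalue_ne_zero`).
* Under intrinsic ultracontractivity, `p_D(1, x, y) ≤ c φ_D(x) φ̂_D(y)` makes a single compact set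
  carry half of the mass in `e^{-λ} φ_D(x) = ∫ p_D(1, x, y) φ_D(y) m(dy)` for all `x` at once.  On
  compact sets `p_D(1, ·, ·)` is bounded below, so that one step of the semigroup bounds `w` below on
  this compact set, and a second one spreads the bound to `D` with the factor `φ_D`
  (`IntrinsicallyUltracontractive.exists_mul_le`).
-/

/-! ### Optional sampling in continuous time -/

/-- Optional sampling between a fixed time and a bounded optional time `T`, for a martingale that is
almost surely right continuous at `T`.  The discretizations of `T` from above take countably many
values, and the values of the martingale at them are uniformly integrable. -/
theorem setIntegral_optionalSampling {Ω : Type*} {mΩ : MeasurableSpace Ω} {μ : Measure Ω}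
    [IsProbabilityMeasure μ] {ℱ : Filtration ℝ≥0 mΩ} {M : ℝ≥0 → Ω → ℝ} (hM : Martingale M ℱ μ)
    {T : Ω → ℝ≥0} (hT : ∀ s, MeasurableSet[ℱ s] {ω | T ω < s}) {a b : ℝ≥0}
    (ha : ∀ ω, a ≤ T ω) (hb : ∀ ω, T ω ≤ b)
    (hcont : ∀ᵐ ω ∂μ, ContinuousWithinAt (fun t => M t ω) (Ici (T ω)) (T ω)) :
    Integrable (fun ω => M (T ω) ω) μ ∧
      ∀ A, MeasurableSet[ℱ a] A → ∫ ω in A, M (T ω) ω ∂μ = ∫ ω in A, M a ω ∂μ := by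
  have hab : a ≤ b := by
    obtain ⟨ω⟩ := μ.nonempty_of_neZero
    exact (ha ω).trans (hb ω)
  -- discretizations of `T` from above
  set N : ℕ → ℝ≥0 := fun k => (k : ℝ≥0) + 1 with hN
  have hN0 : ∀ k, 0 < N k := fun k => by positivity
  set σ : ℕ → Ω → ℝ≥0 := fun k ω => min b ((⌊N k * T ω⌋₊ + 1 : ℝ≥0) / N k) with hσ
  have hTσ : ∀ k ω, T ω ≤ σ k ω := fun k ω => by
    refine le_min (hb ω) ?_
    rw [le_div_iff₀ (hN0 k), mul_comm]
    exact (Nat.lt_floor_add_one _).le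
  have hσT : ∀ k ω, σ k ω ≤ T ω + 1 / N k := fun k ω => by
    refine (min_le_right _ _).trans ?_
    rw [add_div]
    gcongr
    rw [div_le_iff₀ (hN0 k), mul_comm]
    exact Nat.floor_le zero_le
  have hst : ∀ k, IsStoppingTime ℱ (fun ω => (σ k ω : WithTop ℝ≥0)) := by
    intro k s
    by_cases hs : b ≤ s
    · have : {ω | ((σ k ω : ℝ≥0) : WithTop ℝ≥0) ≤ s} = univ := by
        ext ω
        simp only [mem_ofPred_eq, WithTop.coe_le_coe, mem_univ, iff_true]
        exact (min_le_left _ _).trans hs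
      rw [this]
      exact MeasurableSet.univ
    · have : {ω | ((σ k ω : ℝ≥0) : WithTop ℝ≥0) ≤ s} = {ω | T ω < ⌊N k * s⌋₊ / N k} := by
        ext ω
        simp only [mem_ofPred_eq, WithTop.coe_le_coe, hσ, min_le_iff, hs, false_or]
        rw [div_le_iff₀ (hN0 k), lt_div_iff₀ (hN0 k), mul_comm s, mul_comm (T ω)]
        have : ((⌊N k * T ω⌋₊ + 1 : ℝ≥0)) = ((⌊N k * T ω⌋₊ + 1 : ℕ) : ℝ≥0) := by push_cast; rfl
        rw [this, ← Nat.le_floor_iff zero_le, Nat.add_one_le_iff, Nat.floor_lt zero_le]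
      rw [this]
      refine ℱ.mono ?_ _ (hT _)
      rw [div_le_iff₀ (hN0 k), mul_comm s]
      exact Nat.floor_le zero_le
  have hle : ∀ k ω, ((σ k ω : ℝ≥0) : WithTop ℝ≥0) ≤ b := fun k ω =>
    WithTop.coe_le_coe.2 (min_le_left _ _)
  have hcount : ∀ k, (range fun ω => ((σ k ω : ℝ≥0) : WithTop ℝ≥0)).Countable := fun k => by
    refine (countable_range fun n : ℕ => ((min b ((n + 1 : ℝ≥0) / N k) : ℝ≥0) : WithTop ℝ≥0)).mono ?_
    rintro _ ⟨ω, rfl⟩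
    exact ⟨⌊N k * T ω⌋₊, rfl⟩
  have hce : ∀ k, (fun ω => M (σ k ω) ω) =ᵐ[μ] μ[M b | (hst k).measurableSpace] := fun k =>
    hM.stoppedValue_ae_eq_condExp_of_le_const_of_countable_range (hst k) (hle k) (hcount k)
  have hsub : ∀ k, (hst k).measurableSpace ≤ mΩ := fun k => (hst k).measurableSpace_le_of_le (hle k)
  have hui : UniformIntegrable (fun k ω => M (σ k ω) ω) 1 μ :=
    ((hM.integrable b).uniformIntegrable_condExp hsub).ae_eq fun k => (hce k).symm
  have hlim : ∀ᵐ ω ∂μ, Tendsto (fun k => M (σ k ω) ω) atTop (𝓝 (M (T ω) ω)) := by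
    filter_upwards [hcont] with ω hω
    refine hω.tendsto.comp (tendsto_nhdsWithin_iff.2 ⟨?_, Eventually.of_forall fun k => hTσ k ω⟩)
    refine tendsto_of_tendsto_of_tendsto_of_le_of_le tendsto_const_nhds ?_
      (fun k => hTσ k ω) (fun k => hσT k ω)
    have : Tendsto (fun k : ℕ => T ω + 1 / ((k : ℝ≥0) + 1)) atTop (𝓝 (T ω + 0)) :=
      tendsto_const_nhds.add tendsto_one_div_add_atTop_nhds_zero_nat
    simpa using this
  have hmem : MemLp (fun ω => M (T ω) ω) 1 μ := by
    obtain ⟨C, hC⟩ := hui.2.2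
    have hae : ∀ k, AEStronglyMeasurable (fun ω => M (σ k ω) ω) μ := hui.1
    refine ⟨aestronglyMeasurable_of_tendsto_ae atTop hae hlim, ?_⟩
    refine (Lp.eLpNorm_lim_le_liminf_eLpNorm hae _ hlim).trans_lt ?_
    refine (liminf_le_of_frequently_le' (Frequently.of_forall hC)).trans_lt ENNReal.coe_lt_top
  have hint := memLp_one_iff_integrable.1 hmem
  refine ⟨hint, fun A hA => ?_⟩
  have hL1 := tendsto_Lp_finite_of_tendsto_ae le_rfl ENNReal.one_ne_top hui.1 hmem hui.2.1 hlim
  have hlimA : Tendsto (fun k => ∫ ω in A, M (σ k ω) ω ∂μ) atTop (𝓝 (∫ ω in A, M (T ω) ω ∂μ)) :=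
    tendsto_setIntegral_of_L1' _ hint.1
      (Eventually.of_forall fun k => (integrable_condExp.congr (hce k).symm)) hL1 A
  refine tendsto_nhds_unique hlimA (tendsto_const_nhds.congr fun k => ?_)
  have hFa : ℱ a ≤ (hst k).measurableSpace := by
    have := IsStoppingTime.measurableSpace_mono (isStoppingTime_const ℱ a) (hst k)
      fun ω => WithTop.coe_le_coe.2 ((ha ω).trans (hTσ k ω))
    rwa [IsStoppingTime.measurableSpace_const] at this
  rw [setIntegral_congr_ae (g := μ[M b | (hst k).measurableSpace]) (ℱ.le a _ hA)
    ((hce k).mono fun ω h _ => h), setIntegral_condExp (hsub k) (hM.integrable b) (hFa _ hA)]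
  exact hM.setIntegral_eq hab hA

/-- The increment of a martingale between a fixed time and a bounded optional time is orthogonal to
what is known at the fixed time. -/
theorem integral_mul_optionalSampling {Ω : Type*} {mΩ : MeasurableSpace Ω} {μ : Measure Ω}
    [IsProbabilityMeasure μ] {ℱ : Filtration ℝ≥0 mΩ} {M : ℝ≥0 → Ω → ℝ} (hM : Martingale M ℱ μ)
    {T : Ω → ℝ≥0} (hT : ∀ s, MeasurableSet[ℱ s] {ω | T ω < s}) {a b : ℝ≥0}
    (ha : ∀ ω, a ≤ T ω) (hb : ∀ ω, T ω ≤ b)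
    (hcont : ∀ᵐ ω ∂μ, ContinuousWithinAt (fun t => M t ω) (Ici (T ω)) (T ω))
    {Y : Ω → ℝ} (hY : StronglyMeasurable[ℱ a] Y) {K : ℝ} (hK : ∀ ω, |Y ω| ≤ K) :
    Integrable (fun ω => Y ω * (M (T ω) ω - M a ω)) μ ∧
      ∫ ω, Y ω * (M (T ω) ω - M a ω) ∂μ = 0 := by
  obtain ⟨h1, h2⟩ := setIntegral_optionalSampling hM hT ha hb hcont
  have hint : Integrable (fun ω => M (T ω) ω - M a ω) μ := h1.sub (hM.integrable a)
  have hintY : Integrable (Y * fun ω => M (T ω) ω - M a ω) μ :=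
    hint.bdd_mul (hY.mono (ℱ.le a)).aestronglyMeasurable (c := K)
      (Eventually.of_forall fun ω => hK ω)
  refine ⟨hintY, ?_⟩
  have h0 : (0 : Ω → ℝ) =ᵐ[μ] μ[fun ω => M (T ω) ω - M a ω | ℱ a] := by
    refine ae_eq_condExp_of_forall_setIntegral_eq (ℱ.le a) hint (fun _ _ _ => integrableOn_zero)
      (fun A hA _ => ?_) aestronglyMeasurable_zero
    rw [integral_sub h1.integrableOn (hM.integrable a).integrableOn, h2 A hA]
    simp
  calc ∫ ω, Y ω * (M (T ω) ω - M a ω) ∂μ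
      = ∫ ω, (μ[Y * fun ω => M (T ω) ω - M a ω | ℱ a]) ω ∂μ := (integral_condExp (ℱ.le a)).symm
    _ = ∫ ω, (0 : ℝ) ∂μ := by
        refine integral_congr_ae ?_
        filter_upwards [condExp_mul_of_stronglyMeasurable_left hY hintY hint, h0] with ω h h'
        rw [h, Pi.mul_apply, ← h', Pi.zero_apply, mul_zero]
    _ = 0 := by simp

/-! ### Càdlàg paths -/

theorem CadlagPath.continuousWithinAt {d : ℕ} (ω : CadlagPath d) (t : ℝ≥0) :
    ContinuousWithinAt (fun s => canonical d s ω) (Ici t) t := (ω.2 t).1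

theorem CadlagPath.tendsto_leftLim {d : ℕ} (ω : CadlagPath d) (t : ℝ≥0) :
    Tendsto (fun s => canonical d s ω) (𝓝[<] t) (𝓝 (Function.leftLim ω.1 t)) :=
  tendsto_leftLim_of_tendsto (ω.2 t).2

theorem measurable_uncurry_canonical (d : ℕ) :
    Measurable fun p : ℝ≥0 × CadlagPath d => canonical d p.1 p.2 := by
  -- right continuity: evaluate the path along grid points decreasing to `p.1`
  refine measurable_of_tendsto_metrizable
    (f := fun (k : ℕ) (p : ℝ≥0 × CadlagPath d) =>
      canonical d ((⌊((k : ℝ≥0) + 1) * p.1⌋₊ + 1) / ((k : ℝ≥0) + 1)) p.2) (fun k => ?_) ?_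
  · have h : Measurable fun p : ℕ × CadlagPath d =>
        canonical d ((p.1 + 1 : ℝ≥0) / ((k : ℝ≥0) + 1)) p.2 :=
      measurable_from_prod_countable_right fun n =>
        measurable_canonical d ((n + 1 : ℝ≥0) / ((k : ℝ≥0) + 1))
    exact h.comp ((Nat.measurable_floor.comp (measurable_fst.const_mul _)).prodMk measurable_snd)
  · refine tendsto_pi_nhds.2 fun p => ?_
    have hN : ∀ k : ℕ, (0 : ℝ≥0) < k + 1 := fun k => by positivity
    have hle : ∀ k : ℕ, p.1 ≤ (⌊((k : ℝ≥0) + 1) * p.1⌋₊ + 1) / ((k : ℝ≥0) + 1) := fun k => by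
      rw [le_div_iff₀ (hN k), mul_comm]
      exact (Nat.lt_floor_add_one _).le
    refine (p.2.continuousWithinAt p.1).tendsto.comp
      (tendsto_nhdsWithin_iff.2 ⟨?_, Eventually.of_forall hle⟩)
    refine tendsto_of_tendsto_of_tendsto_of_le_of_le (h := fun k : ℕ => p.1 + 1 / ((k : ℝ≥0) + 1))
      tendsto_const_nhds ?_ hle fun k => ?_
    · simpa using (tendsto_const_nhds (x := p.1)).add
        (tendsto_one_div_add_atTop_nhds_zero_nat (𝕜 := ℝ≥0))
    · simp only []
      rw [add_div]
      gcongr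
      rw [div_le_iff₀ (hN k), mul_comm]
      exact Nat.floor_le zero_le

/-- A càdlàg path has at most countably many jumps. -/
theorem CadlagPath.countable_jumps {d : ℕ} (ω : CadlagPath d) :
    {t : ℝ≥0 | Function.leftLim ω.1 t ≠ canonical d t ω}.Countable := by
  have key : ∀ n : ℕ, {t : ℝ≥0 | 1 / ((n : ℝ) + 1) <
      dist (Function.leftLim ω.1 t) (canonical d t ω)}.Countable := by
    intro n
    set s := {t : ℝ≥0 | 1 / ((n : ℝ) + 1) < dist (Function.leftLim ω.1 t) (canonical d t ω)}
      with hs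
    have hε : (0 : ℝ) < 1 / ((n : ℝ) + 1) / 2 := by positivity
    -- jumps of size bounded below do not accumulate from the left
    refine (countable_setOfPred_isolated_left_within (s := s)).mono fun t ht => ?_
    refine mem_ofPred.2 ⟨ht, ?_⟩
    rw [← empty_mem_iff_bot]
    rcases eq_or_ne t 0 with rfl | ht0
    · rw [show s ∩ Iio (0 : ℝ≥0) = ∅ by ext; simp]
      simp
    have h1 := (Metric.tendsto_nhds.1 (ω.tendsto_leftLim t)) _ hε
    obtain ⟨u, hut, hu⟩ := (mem_nhdsLT_iff_exists_Ioo_subset' (pos_iff_ne_zero.2 ht0)).1 h1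
    rw [mem_nhdsWithin]
    refine ⟨Ioi u, isOpen_Ioi, hut, ?_⟩
    rintro r ⟨hur, hrs, hrt⟩
    have hur : u < r := hur
    have hrt : r < t := hrt
    have : dist (Function.leftLim ω.1 r) (Function.leftLim ω.1 t) ≤ 1 / ((n : ℝ) + 1) / 2 := by
      have hne : (𝓝[<] r).NeBot := nhdsLT_neBot_of_exists_lt (Exists.intro u hur)
      refine le_of_tendsto ((ω.tendsto_leftLim r).dist tendsto_const_nhds) ?_
      filter_upwards [Ioo_mem_nhdsLT hur] with q hq
      exact (hu ⟨hq.1, hq.2.trans hrt⟩).le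
    have h2 : dist (canonical d r ω) (Function.leftLim ω.1 t) < 1 / ((n : ℝ) + 1) / 2 :=
      hu ⟨hur, hrt⟩
    have h3 := dist_triangle_right (Function.leftLim ω.1 r) (canonical d r ω)
      (Function.leftLim ω.1 t)
    have h4 : 1 / ((n : ℝ) + 1) < dist (Function.leftLim ω.1 r) (canonical d r ω) := hrs
    exact absurd h4 (by linarith)
  refine (countable_iUnion key).mono fun t ht => ?_
  obtain ⟨n, hn⟩ := exists_nat_one_div_lt (dist_pos.2 ht)
  exact mem_iUnion.2 ⟨n, hn⟩

/-! ### The time of approach to a closed set -/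

/-- The paths that come arbitrarily close to `F` at times of a countable dense set, up to time
`q`. -/
def approachSet {d : ℕ} (F : Set (Rd d)) (q : ℝ≥0) : Set (CadlagPath d) :=
  {ω | ∀ n : ℕ, ∃ k : ℕ, TopologicalSpace.denseSeq ℝ≥0 k ≤ q ∧
    Metric.infDist (canonical d (TopologicalSpace.denseSeq ℝ≥0 k) ω) F < 1 / ((n : ℝ) + 1)}

/-- The first time at which the path or its left limit meets the closed nonempty set `F`, or `∞`.  It
is defined through countably many times, so that it is a Borel function of the path, which the exit
time from `Fᶜ` need not be.  For empty `F` it is zero, as `Metric.infDist` is. -/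
noncomputable def approachTime {d : ℕ} (F : Set (Rd d)) (ω : CadlagPath d) : ℝ≥0∞ :=
  ⨅ (k : ℕ) (_ : ω ∈ approachSet F (TopologicalSpace.denseSeq ℝ≥0 k)),
    (TopologicalSpace.denseSeq ℝ≥0 k : ℝ≥0∞)

theorem measurableSet_approachSet {d : ℕ} (F : Set (Rd d)) (q : ℝ≥0) :
    MeasurableSet[canonicalFiltration d q] (approachSet F q) := by
  have : approachSet F q = ⋂ n : ℕ, ⋃ k : ℕ, ⋃ (_ : TopologicalSpace.denseSeq ℝ≥0 k ≤ q),
      {ω | Metric.infDist (canonical d (TopologicalSpace.denseSeq ℝ≥0 k) ω) F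
        < 1 / ((n : ℝ) + 1)} := by
    ext ω
    simp [approachSet]
  rw [this]
  refine MeasurableSet.iInter fun n => MeasurableSet.iUnion fun k => MeasurableSet.iUnion fun hk => ?_
  have hm : Measurable[canonicalFiltration d q]
      (canonical d (TopologicalSpace.denseSeq ℝ≥0 k)) :=
    ((Filtration.stronglyAdapted_natural
      fun t => (measurable_canonical d t).stronglyMeasurable) _).measurable.mono
        ((canonicalFiltration d).mono hk) le_rfl
  exact (measurableSet_lt (Metric.continuous_infDist_pt F).measurable measurable_const).preimage hm

theorem approachTime_lt_iff {d : ℕ} {F : Set (Rd d)} {ω : CadlagPath d} {s : ℝ≥0∞} :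
    approachTime F ω < s ↔ ∃ k : ℕ, (TopologicalSpace.denseSeq ℝ≥0 k : ℝ≥0∞) < s ∧
      ω ∈ approachSet F (TopologicalSpace.denseSeq ℝ≥0 k) := by
  simp only [approachTime, iInf_lt_iff]
  exact exists_congr fun k => ⟨fun ⟨h, h'⟩ => ⟨h', h⟩, fun ⟨h, h'⟩ => ⟨h', h⟩⟩

theorem measurableSet_approachTime_lt {d : ℕ} (F : Set (Rd d)) (s : ℝ≥0) :
    MeasurableSet[canonicalFiltration d s] {ω | approachTime F ω < s} := by
  have : {ω | approachTime F ω < s} = ⋃ k : ℕ,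
      ⋃ (_ : TopologicalSpace.denseSeq ℝ≥0 k < s),
        approachSet F (TopologicalSpace.denseSeq ℝ≥0 k) := by
    ext ω
    simp [approachTime_lt_iff]
  rw [this]
  exact MeasurableSet.iUnion fun k => MeasurableSet.iUnion fun hk =>
    (canonicalFiltration d).mono hk.le _ (measurableSet_approachSet F _)

theorem measurable_approachTime {d : ℕ} (F : Set (Rd d)) : Measurable (approachTime F) := by
  refine measurable_of_Iio fun s => ?_
  have : approachTime F ⁻¹' Iio s = ⋃ k : ℕ,
      ⋃ (_ : (TopologicalSpace.denseSeq ℝ≥0 k : ℝ≥0∞) < s),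
        approachSet F (TopologicalSpace.denseSeq ℝ≥0 k) := by
    ext ω
    simp [approachTime_lt_iff]
  rw [this]
  exact MeasurableSet.iUnion fun k => MeasurableSet.iUnion fun _ =>
    (canonicalFiltration d).le _ _ (measurableSet_approachSet F _)

/-- Up to any time before the approach time, the path keeps a positive distance from `F`. -/
theorem exists_le_infDist_of_lt_approachTime {d : ℕ} {F : Set (Rd d)} {ω : CadlagPath d}
    {t : ℝ≥0} (ht : (t : ℝ≥0∞) < approachTime F ω) :
    ∃ ε : ℝ, 0 < ε ∧ ∀ r ≤ t, ε ≤ Metric.infDist (canonical d r ω) F := by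
  obtain ⟨q', htq', hq'⟩ := ENNReal.lt_iff_exists_nnreal_btwn.1 ht
  obtain ⟨_, ⟨k, rfl⟩, hk1, hk2⟩ :=
    (TopologicalSpace.denseRange_denseSeq ℝ≥0).exists_between (ENNReal.coe_lt_coe.1 htq')
  set q := TopologicalSpace.denseSeq ℝ≥0 k
  have hq : ω ∉ approachSet F q := fun h =>
    absurd (approachTime_lt_iff.2 ⟨k, (ENNReal.coe_lt_coe.2 hk2).trans hq', h⟩) (lt_irrefl _)
  simp only [approachSet, mem_ofPred_eq, not_forall, not_exists, not_and, not_lt] at hq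
  obtain ⟨n, hn⟩ := hq
  refine ⟨1 / ((n : ℝ) + 1), by positivity, fun r hr => ?_⟩
  by_contra! hlt
  -- right continuity moves the approach to a time of the dense sequence
  have hc : ContinuousWithinAt (fun s => Metric.infDist (canonical d s ω) F) (Ici r) r :=
    (Metric.continuous_infDist_pt F).continuousAt.comp_continuousWithinAt
      (ω.continuousWithinAt r)
  have hev := hc.eventually (gt_mem_nhds hlt)
  obtain ⟨u, hru, hu⟩ := (mem_nhdsGE_iff_exists_Ico_subset).1 hev
  obtain ⟨_, ⟨j, rfl⟩, hj1, hj2⟩ := (TopologicalSpace.denseRange_denseSeq ℝ≥0).exists_between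
    (lt_min hru (hr.trans_lt hk1) : r < min u q)
  exact absurd (hu ⟨hj1.le, hj2.trans_le (min_le_left _ _)⟩)
    (not_lt.2 (hn j (hj2.le.trans (min_le_right _ _))))

theorem le_approachTime_of_le_infDist {d : ℕ} {F : Set (Rd d)} {ω : CadlagPath d}
    {t : ℝ≥0} {ε : ℝ} (hε : 0 < ε) (h : ∀ r < t, ε ≤ Metric.infDist (canonical d r ω) F) :
    (t : ℝ≥0∞) ≤ approachTime F ω := by
  by_contra! hlt
  obtain ⟨k, hk, hk'⟩ := approachTime_lt_iff.1 hlt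
  obtain ⟨n, hn⟩ := exists_nat_one_div_lt hε
  obtain ⟨j, hj, hj'⟩ := hk' n
  have := h _ (hj.trans_lt (ENNReal.coe_lt_coe.1 hk))
  linarith

theorem notMem_of_lt_approachTime {d : ℕ} {F : Set (Rd d)} {ω : CadlagPath d} {t : ℝ≥0}
    (ht : (t : ℝ≥0∞) < approachTime F ω) : canonical d t ω ∉ F := fun h => by
  obtain ⟨ε, hε, h'⟩ := exists_le_infDist_of_lt_approachTime ht
  have := h' t le_rfl
  rw [Metric.infDist_zero_of_mem h] at this
  linarith

/-- At the approach time, the path or its left limit is in `F`. -/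
theorem mem_or_leftLim_mem_of_approachTime_eq {d : ℕ} {F : Set (Rd d)} (hF : IsClosed F)
    (hne : F.Nonempty) {ω : CadlagPath d} (h0 : canonical d 0 ω ∉ F) {s : ℝ≥0}
    (hs : approachTime F ω = s) :
    0 < s ∧ (canonical d s ω ∈ F ∨ Function.leftLim ω.1 s ∈ F) := by
  have hright : ∀ t : ℝ≥0, canonical d t ω ∉ F → ∃ u > t, ∃ ε > (0 : ℝ),
      ∀ r ∈ Ico t u, ε ≤ Metric.infDist (canonical d r ω) F := by
    intro t ht
    have hpos := (hF.notMem_iff_infDist_pos hne).1 ht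
    have hc : ContinuousWithinAt (fun s => Metric.infDist (canonical d s ω) F) (Ici t) t :=
      (Metric.continuous_infDist_pt F).continuousAt.comp_continuousWithinAt
        (ω.continuousWithinAt t)
    obtain ⟨u, hu, hu'⟩ :=
      mem_nhdsGE_iff_exists_Ico_subset.1 (hc.eventually (lt_mem_nhds (half_lt_self hpos)))
    exact ⟨u, hu, _, half_pos hpos, fun r hr => (hu' hr).le⟩
  have hs0 : 0 < s := by
    obtain ⟨u, hu, ε, hε, h⟩ := hright 0 h0
    have := le_approachTime_of_le_infDist hε fun r hr => h r ⟨zero_le, hr⟩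
    rw [hs, ENNReal.coe_le_coe] at this
    exact lt_of_lt_of_le hu this
  refine ⟨hs0, ?_⟩
  by_contra! hcon
  obtain ⟨u, hu, ε, hε, h⟩ := hright s hcon.1
  have hpos := (hF.notMem_iff_infDist_pos hne).1 hcon.2
  have hev := ((Metric.continuous_infDist_pt F).continuousAt.tendsto.comp
    (ω.tendsto_leftLim s)).eventually (lt_mem_nhds (half_lt_self hpos))
  obtain ⟨v, hv, hv'⟩ := (mem_nhdsLT_iff_exists_Ioo_subset' hs0).1 hev
  obtain ⟨v', hvv', hv's⟩ := exists_between (mem_Iio.1 hv)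
  obtain ⟨ε', hε', h'⟩ := exists_le_infDist_of_lt_approachTime
    (F := F) (ω := ω) (t := v') (by rw [hs]; exact_mod_cast hv's)
  have := le_approachTime_of_le_infDist (F := F) (ω := ω) (t := u)
    (lt_min (lt_min hε hε') (half_pos hpos)) fun r hr => by
      rcases le_or_gt r v' with h1 | h1
      · exact ((min_le_left _ _).trans (min_le_right _ _)).trans (h' r h1)
      rcases lt_or_ge r s with h2 | h2
      · exact (min_le_right _ _).trans (le_of_lt (hv' ⟨hvv'.trans h1, h2⟩))
      · exact ((min_le_left _ _).trans (min_le_left _ _)).trans (h r ⟨h2, hr⟩)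
  rw [hs, ENNReal.coe_le_coe] at this
  exact absurd hu (not_lt.2 this)

/-! ### Grids approaching a time from the left -/

/-- The last point of the grid `ℕ / (k + 1)` strictly before `r`, for `r > 0`. -/
noncomputable def gridBefore (k : ℕ) (r : ℝ≥0) : ℝ≥0 :=
  ((⌈((k : ℝ≥0) + 1) * r⌉₊ - 1 : ℕ) : ℝ≥0) / ((k : ℝ≥0) + 1)

theorem measurable_gridBefore (k : ℕ) : Measurable (gridBefore k) := by
  have h : Measurable fun n : ℕ => ((n - 1 : ℕ) : ℝ≥0) / ((k : ℝ≥0) + 1) := measurable_from_top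
  exact h.comp (Nat.measurable_ceil.comp (measurable_id.const_mul _))

theorem gridBefore_eq {k i : ℕ} {r : ℝ≥0} (h1 : (i : ℝ≥0) / ((k : ℝ≥0) + 1) < r)
    (h2 : r ≤ ((i : ℝ≥0) + 1) / ((k : ℝ≥0) + 1)) :
    gridBefore k r = (i : ℝ≥0) / ((k : ℝ≥0) + 1) := by
  have hN : (0 : ℝ≥0) < k + 1 := by positivity
  rw [div_lt_iff₀ hN, mul_comm] at h1
  rw [le_div_iff₀ hN, mul_comm] at h2
  have : ⌈((k : ℝ≥0) + 1) * r⌉₊ = i + 1 := by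
    rw [Nat.ceil_eq_iff (by simp)]
    simpa using ⟨h1, h2⟩
  rw [gridBefore, this, Nat.add_sub_cancel]

theorem exists_gridBefore_eq (k : ℕ) {r : ℝ≥0} (hr : 0 < r) :
    ∃ i : ℕ, gridBefore k r = (i : ℝ≥0) / ((k : ℝ≥0) + 1) ∧ (i : ℝ≥0) / ((k : ℝ≥0) + 1) < r ∧
      r ≤ ((i : ℝ≥0) + 1) / ((k : ℝ≥0) + 1) := by
  have hN : (0 : ℝ≥0) < k + 1 := by positivity
  have hc : 0 < ⌈((k : ℝ≥0) + 1) * r⌉₊ := Nat.ceil_pos.2 (by positivity)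
  obtain ⟨i, hi⟩ := Nat.exists_eq_succ_of_ne_zero hc.ne'
  have h := (Nat.ceil_eq_iff (by simp)).1 hi
  have h1 : (i : ℝ≥0) / ((k : ℝ≥0) + 1) < r := by
    rw [div_lt_iff₀ hN, mul_comm]; simpa using h.1
  have h2 : r ≤ ((i : ℝ≥0) + 1) / ((k : ℝ≥0) + 1) := by
    rw [le_div_iff₀ hN, mul_comm]; simpa using h.2
  exact ⟨i, gridBefore_eq h1 h2, h1, h2⟩

theorem tendsto_gridBefore {r : ℝ≥0} (hr : 0 < r) :
    Tendsto (fun k => gridBefore k r) atTop (𝓝[<] r) := by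
  have hlt : ∀ k, gridBefore k r < r := fun k => by
    obtain ⟨i, hi, h1, -⟩ := exists_gridBefore_eq k hr
    rwa [hi]
  refine tendsto_nhdsWithin_iff.2 ⟨?_, Eventually.of_forall hlt⟩
  refine tendsto_of_tendsto_of_tendsto_of_le_of_le
    (g := fun k : ℕ => r - 1 / ((k : ℝ≥0) + 1)) ?_ tendsto_const_nhds (fun k => ?_)
    fun k => (hlt k).le
  · simpa using (tendsto_const_nhds (x := r)).sub
      (tendsto_one_div_add_atTop_nhds_zero_nat (𝕜 := ℝ≥0))
  · obtain ⟨i, hi, -, h2⟩ := exists_gridBefore_eq k hr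
    rw [hi, tsub_le_iff_right, ← add_div]
    exact h2

theorem tendsto_canonical_gridBefore {d : ℕ} (ω : CadlagPath d) {r : ℝ≥0} (hr : 0 < r) :
    Tendsto (fun k => canonical d (gridBefore k r) ω) atTop (𝓝 (Function.leftLim ω.1 r)) :=
  (ω.tendsto_leftLim r).comp (tendsto_gridBefore hr)

/-! ### Bounds for the operator -/

theorem abs_taylor_le {d : ℕ} {f : Rd d → ℝ} (hf : ContDiff ℝ 2 f) {C : ℝ}
    (hC : ∀ x, ‖iteratedFDeriv ℝ 2 f x‖ ≤ C) (x y : Rd d) :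
    |f (x + y) - f x - fderiv ℝ f x y| ≤ C * ‖y‖ ^ 2 := by
  have hd1 : Differentiable ℝ f := hf.differentiable (by norm_num)
  have hd2 : Differentiable ℝ (fderiv ℝ f) :=
    (hf.fderiv_right (m := 1) (by norm_num)).differentiable (by norm_num)
  have hC' : ∀ z, ‖fderiv ℝ (fderiv ℝ f) z‖ ≤ C := fun z => by
    rw [← norm_iteratedFDeriv_one, norm_iteratedFDeriv_fderiv]
    exact hC z
  have h1 : ∀ z, ‖fderiv ℝ f z - fderiv ℝ f x‖ ≤ C * ‖z - x‖ := fun z =>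
    convex_univ.norm_image_sub_le_of_norm_fderiv_le (fun z _ => hd2 z) (fun z _ => hC' z)
      (mem_univ x) (mem_univ z)
  have h2 : ‖f (x + y) - f x - fderiv ℝ f x (x + y - x)‖ ≤ C * ‖y‖ * ‖x + y - x‖ := by
    refine (convex_closedBall x ‖y‖).norm_image_sub_le_of_norm_fderiv_le' (fun z _ => hd1 z)
      (fun z hz => (h1 z).trans ?_) (by simp) (by simp)
    have : 0 ≤ C := (norm_nonneg _).trans (hC x)
    gcongr
    simpa [dist_eq_norm] using hz
  rw [add_sub_cancel_left, Real.norm_eq_abs] at h2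
  linarith [h2, sq ‖y‖, mul_assoc C ‖y‖ ‖y‖]

theorem abs_levyIntegrand_le {d : ℕ} {f : Rd d → ℝ} (hf : ContDiff ℝ 2 f) {C : ℝ}
    (hC : ∀ x, |f x| ≤ C ∧ ‖fderiv ℝ f x‖ ≤ C ∧ ‖iteratedFDeriv ℝ 2 f x‖ ≤ C) (x y : Rd d) :
    |f (x + y) - f x - fderiv ℝ f x y / (1 + ‖y‖ ^ 2)| ≤ 3 * C * min 1 (‖y‖ ^ 2) := by
  have hC0 : 0 ≤ C := (abs_nonneg _).trans (hC x).1
  have hy := norm_nonneg y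
  have hlin : |fderiv ℝ f x y| ≤ C * ‖y‖ := by
    rw [← Real.norm_eq_abs]
    exact ((fderiv ℝ f x).le_opNorm y).trans (by gcongr; exact (hC x).2.1)
  have hpos : 0 < 1 + ‖y‖ ^ 2 := by positivity
  rcases le_total 1 (‖y‖ ^ 2) with h | h
  · rw [min_eq_left h]
    have h1 : |fderiv ℝ f x y / (1 + ‖y‖ ^ 2)| ≤ C := by
      rw [abs_div, abs_of_pos hpos, div_le_iff₀ hpos]
      refine hlin.trans ?_
      gcongr
      nlinarith [sq_nonneg (‖y‖ - 1)]
    have h2 := (hC (x + y)).1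
    have h3 := (hC x).1
    rw [abs_le] at *
    constructor <;> linarith [h1.1, h1.2, h2.1, h2.2, h3.1, h3.2]
  · rw [min_eq_right h]
    have hy1 : ‖y‖ ≤ 1 := by nlinarith
    have h1 := abs_taylor_le hf (fun z => (hC z).2.2) x y
    have h2 : |fderiv ℝ f x y - fderiv ℝ f x y / (1 + ‖y‖ ^ 2)| ≤ C * ‖y‖ ^ 2 := by
      have : fderiv ℝ f x y - fderiv ℝ f x y / (1 + ‖y‖ ^ 2)
          = fderiv ℝ f x y * (‖y‖ ^ 2 / (1 + ‖y‖ ^ 2)) := by field_simp; ring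
      rw [this, abs_mul, abs_of_nonneg (a := ‖y‖ ^ 2 / (1 + ‖y‖ ^ 2)) (by positivity)]
      have h3 : ‖y‖ ^ 2 / (1 + ‖y‖ ^ 2) ≤ ‖y‖ ^ 2 := div_le_self (by positivity) (by nlinarith)
      have h4 : |fderiv ℝ f x y| ≤ C := hlin.trans (by nlinarith)
      gcongr
    have hC2 : 0 ≤ C * ‖y‖ ^ 2 := by positivity
    rw [abs_le] at *
    constructor <;> linarith [h1.1, h1.2, h2.1, h2.2]

/-- On `D`, where the coefficients are bounded, `A f` is bounded for `f ∈ C_b²`. -/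
theorem LevyCoeff.Admissible.exists_abs_op_le {d : ℕ} {A : LevyCoeff d} {D : Set (Rd d)}
    (hA : A.Admissible D) {f : Rd d → ℝ} (hf : IsCb2 f) : ∃ C : ℝ≥0, ∀ x ∈ D, |A.op f x| ≤ C := by
  obtain ⟨hf2, C, hC⟩ := hf
  obtain ⟨K, hK⟩ := hA.bounded
  obtain ⟨L, hL⟩ := hA.kernel_bound
  have hC0 : 0 ≤ C := (abs_nonneg _).trans (hC 0).1
  refine ⟨Real.toNNReal (1 / 2 * (d * (d * (K * C))) + C * K + 3 * C * L), fun x hx => ?_⟩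
  refine le_trans ?_ (Real.le_coe_toNNReal _)
  have h1 : |(1 / 2 : ℝ) * (∑ i, ∑ j, A.q x i j *
      iteratedFDeriv ℝ 2 f x ![EuclideanSpace.single i 1, EuclideanSpace.single j 1])|
      ≤ 1 / 2 * (d * (d * (K * C))) := by
    rw [abs_mul, abs_of_pos (by norm_num : (0 : ℝ) < 1 / 2)]
    gcongr
    refine (Finset.abs_sum_le_sum_abs _ _).trans ?_
    refine (Finset.sum_le_card_nsmul _ _ (d * (K * C)) fun i _ => ?_).trans (by simp)
    refine (Finset.abs_sum_le_sum_abs _ _).trans ?_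
    refine (Finset.sum_le_card_nsmul _ _ (K * C) fun j _ => ?_).trans (by simp)
    have hK' := (hK x hx).1 i j
    rw [abs_mul]
    refine mul_le_mul hK' ?_ (abs_nonneg _) ((abs_nonneg _).trans hK')
    have := (iteratedFDeriv ℝ 2 f x).le_opNorm
      ![EuclideanSpace.single i (1 : ℝ), EuclideanSpace.single j 1]
    refine this.trans ?_
    simpa [Fin.prod_univ_two] using (hC x).2.2
  have h2 : |fderiv ℝ f x (A.b x)| ≤ C * K := by
    rw [← Real.norm_eq_abs]
    exact ((fderiv ℝ f x).le_opNorm _).trans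
      (mul_le_mul (hC x).2.1 (hK x hx).2 (norm_nonneg _) hC0)
  have h3 : |∫ y, (f (x + y) - f x - fderiv ℝ f x y / (1 + ‖y‖ ^ 2)) ∂(A.N x)| ≤ 3 * C * L := by
    rw [← Real.norm_eq_abs]
    refine (norm_integral_le_lintegral_norm _).trans (ENNReal.toReal_le_of_le_ofReal
      (by positivity) ?_)
    calc ∫⁻ y, ENNReal.ofReal ‖f (x + y) - f x - fderiv ℝ f x y / (1 + ‖y‖ ^ 2)‖ ∂(A.N x)
        ≤ ∫⁻ y, ENNReal.ofReal (3 * C) * ENNReal.ofReal (min 1 (‖y‖ ^ 2)) ∂(A.N x) := by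
          refine lintegral_mono fun y => ?_
          rw [← ENNReal.ofReal_mul (by positivity)]
          exact ENNReal.ofReal_le_ofReal (abs_levyIntegrand_le hf2 hC x y)
      _ ≤ ENNReal.ofReal (3 * C) * L := by
          rw [lintegral_const_mul' _ _ ENNReal.ofReal_ne_top]
          gcongr
          exact hL x
      _ = ENNReal.ofReal (3 * C * L) := by
          rw [ENNReal.ofReal_mul (p := 3 * C) (by positivity), ENNReal.ofReal_coe_nnreal]
  rw [LevyCoeff.op]
  exact (abs_add_three _ _ _).trans (add_le_add_three h1 h2 h3)

/-- The Lévy kernel has bounded mass away from the origin. -/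
theorem LevyCoeff.Admissible.exists_kernel_le {d : ℕ} {A : LevyCoeff d} {D : Set (Rd d)}
    (hA : A.Admissible D) {W : Set (Rd d)} {ρ : ℝ} (hρ : 0 < ρ) (hW : ∀ z ∈ W, ρ ≤ ‖z‖) :
    ∃ C : ℝ≥0, ∀ x, A.N x W ≤ C := by
  obtain ⟨L, hL⟩ := hA.kernel_bound
  have hε : (0 : ℝ) < min 1 (ρ ^ 2) := by positivity
  refine ⟨L / Real.toNNReal (min 1 (ρ ^ 2)), fun x => ?_⟩
  rw [ENNReal.coe_div (by simpa using hρ.ne'), ENNReal.le_div_iff_mul_le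
    (Or.inl (by simpa using hρ.ne')) (Or.inl ENNReal.coe_ne_top), mul_comm]
  refine le_trans ?_ (hL x)
  refine le_trans ?_ (mul_meas_ge_le_lintegral₀ (μ := A.N x)
    (f := fun y => ENNReal.ofReal (min 1 (‖y‖ ^ 2))) (by fun_prop)
    (ENNReal.ofReal (min 1 (ρ ^ 2))))
  refine mul_le_mul_right (measure_mono fun z hz => ENNReal.ofReal_le_ofReal ?_) _
  gcongr
  exact hW z hz

/-- Where `f` vanishes identically, `A f` only sees the jumps to the places where `f` does not
vanish. -/
theorem LevyCoeff.op_le_of_eqOn_zero {d : ℕ} (A : LevyCoeff d) {f : Rd d → ℝ}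
    (hf0 : ∀ z, 0 ≤ f z) (hf1 : ∀ z, f z ≤ 1) {U W : Set (Rd d)}
    (hU : IsOpen U) (hfU : ∀ z ∈ U, f z = 0) (hW : MeasurableSet W) {x : Rd d} (hx : x ∈ U)
    (hUW : ∀ z, f (x + z) ≠ 0 → z ∈ W) (hfin : A.N x W ≠ ∞) :
    ENNReal.ofReal (A.op f x) ≤ A.N x W := by
  have hev : f =ᶠ[𝓝 x] fun _ => 0 := by
    filter_upwards [hU.mem_nhds hx] with z hz using hfU z hz
  have h1 : fderiv ℝ f x = 0 := by rw [hev.fderiv_eq]; simp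
  have h2 : iteratedFDeriv ℝ 2 f x = 0 := by
    rw [(hev.iteratedFDeriv ℝ 2).self_of_nhds]
    exact congrFun (iteratedFDeriv_fun_zero (𝕜 := ℝ) (n := 2)) x
  have h3 : A.op f x = ∫ y, f (x + y) ∂(A.N x) := by
    simp [LevyCoeff.op, h1, h2, hfU x hx]
  rw [h3]
  have h4 : ∫ y, f (x + y) ∂(A.N x) ≤ ∫ y, W.indicator 1 y ∂(A.N x) := by
    refine integral_mono_of_nonneg (Eventually.of_forall fun y => hf0 _)
      ((integrable_indicator_iff hW).2 (integrableOn_const hfin)) (Eventually.of_forall fun y => ?_)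
    by_cases hy : y ∈ W
    · simpa [hy] using hf1 _
    · simp only [hy, not_false_eq_true, indicator_of_notMem]
      exact le_of_eq (by_contra fun h => hy (hUW y h))
  rw [integral_indicator_one hW] at h4
  exact (ENNReal.ofReal_le_ofReal h4).trans (ENNReal.ofReal_toReal_le)

theorem isCb2_contDiffBump {d : ℕ} {c : Rd d} (φ : ContDiffBump c) : IsCb2 φ := by
  have h1 := φ.contDiff (n := 2)
  have hs := φ.hasCompactSupport
  have hc0 : Continuous (φ : Rd d → ℝ) := φ.continuous
  obtain ⟨C0, h0⟩ := hc0.bounded_above_of_compact_support hs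
  obtain ⟨C1, h1'⟩ := (h1.continuous_fderiv (by norm_num)).bounded_above_of_compact_support
    (hs.fderiv ℝ)
  obtain ⟨C2, h2⟩ := (h1.continuous_iteratedFDeriv (m := 2) le_rfl).bounded_above_of_compact_support
    (hs.iteratedFDeriv 2)
  exact ⟨h1, max C0 (max C1 C2), fun x => ⟨(h0 x).trans (le_max_left _ _),
    (h1' x).trans ((le_max_left _ _).trans (le_max_right _ _)),
    (h2 x).trans ((le_max_right _ _).trans (le_max_right _ _))⟩⟩

/-! ### The jump at the time of approach -/

theorem ofReal_integral_le_lintegral_ofReal {α : Type*} {mα : MeasurableSpace α} (μ : Measure α)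
    (f : α → ℝ) : ENNReal.ofReal (∫ x, f x ∂μ) ≤ ∫⁻ x, ENNReal.ofReal (f x) ∂μ := by
  by_cases hf : Integrable f μ
  · rw [integral_eq_lintegral_pos_part_sub_lintegral_neg_part hf]
    exact (ENNReal.ofReal_le_ofReal (sub_le_self _ ENNReal.toReal_nonneg)).trans
      ENNReal.ofReal_toReal_le
  · simp [integral_undef hf]

theorem measurable_uncurry_canonical_toNNReal (d : ℕ) :
    Measurable fun p : ℝ × CadlagPath d => canonical d p.1.toNNReal p.2 :=
  (measurable_uncurry_canonical d).comp
    ((measurable_real_toNNReal.comp measurable_fst).prodMk measurable_snd)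

theorem Measurable.canonical_comp {d : ℕ} {T : CadlagPath d → ℝ≥0} (hT : Measurable T) :
    Measurable fun ω => canonical d (T ω) ω :=
  (measurable_uncurry_canonical d).comp (hT.prodMk measurable_id)

theorem measurable_leftLim_comp {d : ℕ} {T : CadlagPath d → ℝ≥0} (hT : Measurable T) :
    Measurable fun ω : CadlagPath d => Function.leftLim ω.1 (T ω) := by
  refine measurable_of_tendsto_metrizable
    (fun k => ((measurable_gridBefore k).comp hT).canonical_comp) (tendsto_pi_nhds.2 fun ω => ?_)
  rcases eq_or_ne (T ω) 0 with h | h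
  · have h0 : Function.leftLim ω.1 0 = canonical d 0 ω :=
      leftLim_eq_of_isBot isBot_bot
    simp [h, h0, gridBefore]
  · exact tendsto_canonical_gridBefore ω (pos_iff_ne_zero.2 h)

theorem measurable_canonicalFiltration {d : ℕ} (t : ℝ≥0) :
    Measurable[canonicalFiltration d t] (canonical d t) :=
  ((Filtration.stronglyAdapted_natural
    fun t => (measurable_canonical d t).stronglyMeasurable) t).measurable

/-- On one cell `(a, b]` of the time grid: the chance of a jump, weighted by `h` before and by `f`
after, is at most the integral of a bound `B` for the jump intensity.  This is optional sampling at
the approach time confined to the cell, multiplied by the weight at time `a`; as `h f = 0`, the value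
of `f` at time `a` does not contribute. -/
theorem IsMartingaleSolution.lintegral_cell_le {d : ℕ} {A : LevyCoeff d} {D : Set (Rd d)}
    {μ : Measure (Rd d)} {Q : Measure (CadlagPath d)} (hQ : IsMartingaleSolution A μ Q)
    {f h : Rd d → ℝ} (hf : IsCb2 f) (hf0 : ∀ y, 0 ≤ f y) (hh : Measurable h)
    (hh0 : ∀ y, 0 ≤ h y) (hh1 : ∀ y, h y ≤ 1) (hfh : ∀ y, h y * f y = 0)
    {B : Rd d → ℝ≥0∞} (hB : ∀ y ∈ D, ENNReal.ofReal (A.op f y) ≤ B y) {a b : ℝ≥0} (hab : a ≤ b) :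
    ∫⁻ ω, {ω | (a : ℝ≥0∞) ≤ approachTime Dᶜ ω}.indicator (fun ω =>
        ENNReal.ofReal (h (canonical d a ω)) *
          ENNReal.ofReal (f (canonical d (max a (min (approachTime Dᶜ ω) b).toNNReal) ω))) ω ∂Q ≤
      ∫⁻ ω, (∫⁻ r in Ioc (a : ℝ) b, {r : ℝ | (r.toNNReal : ℝ≥0∞) < approachTime Dᶜ ω}.indicator
        (fun r => ENNReal.ofReal (h (canonical d a ω)) * B (canonical d r.toNNReal ω)) r) ∂Q := by
  have := hQ.prob
  set S : CadlagPath d → ℝ≥0∞ := approachTime Dᶜ with hS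
  have hSm : Measurable S := measurable_approachTime _
  set T : CadlagPath d → ℝ≥0 := fun ω => max a (min (S ω) b).toNNReal with hT
  have hTm : Measurable T := measurable_const.max (hSm.min measurable_const).ennreal_toNNReal
  have hmin : ∀ ω, ((min (S ω) b).toNNReal : ℝ≥0∞) = min (S ω) b := fun ω =>
    ENNReal.coe_toNNReal (min_lt_of_right_lt ENNReal.coe_lt_top).ne
  have hTa : ∀ ω, a ≤ T ω := fun ω => le_max_left _ _
  have hTb : ∀ ω, T ω ≤ b := fun ω => max_le hab (by
    rw [← ENNReal.coe_le_coe, hmin]; exact min_le_right _ _)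
  have hTs : ∀ s, MeasurableSet[canonicalFiltration d s] {ω | T ω < s} := by
    intro s
    have : {ω | T ω < s} = {ω | a < s} ∩ ({ω | S ω < s} ∪ {ω | b < s}) := by
      ext ω
      simp only [hT, mem_ofPred_eq, max_lt_iff, mem_inter_iff, mem_union]
      rw [← ENNReal.coe_lt_coe (r := (min (S ω) b).toNNReal), hmin, min_lt_iff, ENNReal.coe_lt_coe]
    rw [this]
    exact (MeasurableSet.const _).inter
      ((measurableSet_approachTime_lt _ s).union (MeasurableSet.const _))
  set Y : CadlagPath d → ℝ := {ω | (a : ℝ≥0∞) ≤ S ω}.indicator fun ω => h (canonical d a ω) with hY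
  have hSa : MeasurableSet[canonicalFiltration d a] {ω | (a : ℝ≥0∞) ≤ S ω} := by
    have := (measurableSet_approachTime_lt (d := d) Dᶜ a).compl
    convert this using 1
    ext ω
    simp [hS]
  have hYm : StronglyMeasurable[canonicalFiltration d a] Y :=
    (hh.comp (measurable_canonicalFiltration a)).stronglyMeasurable.indicator hSa
  have hY0 : ∀ ω, 0 ≤ Y ω := fun ω => indicator_nonneg (fun ω _ => hh0 _) ω
  have hY1 : ∀ ω, Y ω ≤ 1 := fun ω => indicator_le' (fun ω _ => hh1 _) (fun _ _ => zero_le_one) ω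
  have hcont : ∀ᵐ ω ∂Q, ContinuousWithinAt (fun t : ℝ≥0 => f (canonical d t ω)
      - f (canonical d 0 ω) - ∫ r in (0 : ℝ)..t, A.op f (canonical d r.toNNReal ω))
      (Ici (T ω)) (T ω) := by
    filter_upwards [hQ.integrable f hf] with ω hω
    have h1 : ContinuousWithinAt (fun t : ℝ≥0 => f (canonical d t ω)) (Ici (T ω)) (T ω) :=
      hf.1.continuous.continuousAt.comp_continuousWithinAt (ω.continuousWithinAt _)
    refine (h1.sub continuousWithinAt_const).sub (ContinuousAt.continuousWithinAt ?_)
    have h2 := intervalIntegral.continuousOn_primitive_interval' (hω (T ω + 1)) left_mem_uIcc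
    rw [uIcc_of_le (NNReal.coe_nonneg _)] at h2
    have h3 : ContinuousWithinAt
        (fun t : ℝ => ∫ r in (0 : ℝ)..t, A.op f (canonical d r.toNNReal ω))
        (Icc 0 ((T ω + 1 : ℝ≥0) : ℝ)) (T ω) :=
      h2 _ ⟨NNReal.coe_nonneg _, by push_cast; linarith⟩
    have h4 : ContinuousWithinAt
        (fun t : ℝ≥0 => ∫ r in (0 : ℝ)..t, A.op f (canonical d r.toNNReal ω))
        (Iio (T ω + 1)) (T ω) :=
      ContinuousWithinAt.comp (f := fun t : ℝ≥0 => (t : ℝ)) h3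
        NNReal.continuous_coe.continuousWithinAt
        fun t ht => ⟨NNReal.coe_nonneg _, NNReal.coe_le_coe.2 (le_of_lt (mem_Iio.1 ht))⟩
    exact h4.continuousAt (Iio_mem_nhds (lt_add_one _))
  obtain ⟨hint, hzero⟩ := integral_mul_optionalSampling (hQ.martingale f hf) hTs hTa hTb hcont hYm
    (K := 1) (fun ω => by rw [abs_of_nonneg (hY0 ω)]; exact hY1 ω)
  obtain ⟨C, hC⟩ := hf.2
  have hYf : Integrable (fun ω => Y ω * f (canonical d (T ω) ω)) Q := by
    refine Integrable.of_bound ((hYm.mono ((canonicalFiltration d).le a)).aestronglyMeasurable.mul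
      (hf.1.continuous.measurable.comp hTm.canonical_comp).aestronglyMeasurable) (1 * C)
      (Eventually.of_forall fun ω => ?_)
    rw [Real.norm_eq_abs, abs_mul, abs_of_nonneg (hY0 ω)]
    exact mul_le_mul (hY1 ω) (hC _).1 (abs_nonneg _) zero_le_one
  have hae : (fun ω => Y ω * f (canonical d (T ω) ω) -
      Y ω * ((f (canonical d (T ω) ω) - f (canonical d 0 ω)
        - ∫ r in (0 : ℝ)..(T ω), A.op f (canonical d r.toNNReal ω)) -
      (f (canonical d a ω) - f (canonical d 0 ω)
        - ∫ r in (0 : ℝ)..a, A.op f (canonical d r.toNNReal ω)))) =ᵐ[Q]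
      fun ω => Y ω * ∫ r in Ioc (a : ℝ) (T ω), A.op f (canonical d r.toNNReal ω) := by
    filter_upwards [hQ.integrable f hf] with ω hω
    have h1 : Y ω * f (canonical d a ω) = 0 := by
      simp only [hY, indicator]
      split_ifs
      · exact hfh _
      · simp
    have h2 := intervalIntegral.integral_interval_sub_left (hω (T ω)) (hω a)
    rw [intervalIntegral.integral_of_le (NNReal.coe_le_coe.2 (hTa ω))] at h2
    rw [← h2]
    linear_combination h1
  have heq : ∫ ω, Y ω * f (canonical d (T ω) ω) ∂Q =
      ∫ ω, Y ω * (∫ r in Ioc (a : ℝ) (T ω), A.op f (canonical d r.toNNReal ω)) ∂Q := by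
    rw [← integral_congr_ae hae, integral_sub hYf hint, hzero, sub_zero]
  calc _ = ∫⁻ ω, ENNReal.ofReal (Y ω * f (canonical d (T ω) ω)) ∂Q := by
        refine lintegral_congr fun ω => ?_
        simp only [hY, indicator]
        split_ifs
        · rw [ENNReal.ofReal_mul (hh0 _)]
        · simp
    _ = ENNReal.ofReal (∫ ω, Y ω * f (canonical d (T ω) ω) ∂Q) :=
        (ofReal_integral_eq_lintegral_ofReal hYf
          (Eventually.of_forall fun ω => mul_nonneg (hY0 ω) (hf0 _))).symm
    _ ≤ _ := by
        rw [heq]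
        refine (ofReal_integral_le_lintegral_ofReal _ _).trans (lintegral_mono fun ω => ?_)
        by_cases ha : (a : ℝ≥0∞) ≤ S ω
        swap
        · simp [hY, ha]
        have hYω : Y ω = h (canonical d a ω) := by simp [hY, ha]
        rw [hYω, ENNReal.ofReal_mul (hh0 _)]
        calc _ ≤ ENNReal.ofReal (h (canonical d a ω)) * ∫⁻ r in Ioc (a : ℝ) (T ω),
              ENNReal.ofReal (A.op f (canonical d r.toNNReal ω)) := by
              gcongr
              exact ofReal_integral_le_lintegral_ofReal _ _
          _ = ∫⁻ r in Ioo (a : ℝ) (T ω), ENNReal.ofReal (h (canonical d a ω)) *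
              ENNReal.ofReal (A.op f (canonical d r.toNNReal ω)) := by
              rw [lintegral_const_mul' _ _ ENNReal.ofReal_ne_top, restrict_Ioo_eq_restrict_Ioc]
          _ ≤ ∫⁻ r in Ioo (a : ℝ) (T ω), {r : ℝ | (r.toNNReal : ℝ≥0∞) < S ω}.indicator
              (fun r => ENNReal.ofReal (h (canonical d a ω)) * B (canonical d r.toNNReal ω)) r := by
              refine setLIntegral_mono' measurableSet_Ioo fun r hr => ?_
              have hr0 : r.toNNReal < T ω := by
                rw [← NNReal.coe_lt_coe, Real.coe_toNNReal _ (a.2.trans hr.1.le)]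
                exact hr.2
              have hTS : (T ω : ℝ≥0∞) ≤ S ω := by
                rw [hT, ENNReal.coe_max, hmin]
                exact max_le ha (min_le_left _ _)
              have hrS : (r.toNNReal : ℝ≥0∞) < S ω := (ENNReal.coe_lt_coe.2 hr0).trans_le hTS
              rw [indicator_of_mem (by exact hrS)]
              gcongr
              exact hB _ (not_not.1 (notMem_of_lt_approachTime hrS))
          _ ≤ _ := lintegral_mono_set
              (Ioo_subset_Ioc_self.trans (Ioc_subset_Ioc_right (NNReal.coe_le_coe.2 (hTb ω))))

/-- The density `h(X_{τ(r)}) B(X_r)` of the accumulated jump intensity, up to the approach time of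
the complement of `D`; `τ(r)` is the time at which the weight `h` is evaluated. -/
noncomputable def jumpIntensity {d : ℕ} (D : Set (Rd d)) (h : Rd d → ℝ) (B : Rd d → ℝ≥0∞)
    (τ : ℝ≥0 → ℝ≥0) (ω : CadlagPath d) : ℝ → ℝ≥0∞ :=
  {r : ℝ | (r.toNNReal : ℝ≥0∞) < approachTime Dᶜ ω}.indicator
    fun r => ENNReal.ofReal (h (canonical d (τ r.toNNReal) ω)) * B (canonical d r.toNNReal ω)

theorem measurable_jumpIntensity {d : ℕ} (D : Set (Rd d)) {h : Rd d → ℝ} (hh : Measurable h)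
    {B : Rd d → ℝ≥0∞} (hB : Measurable B) {τ : ℝ≥0 → ℝ≥0} (hτ : Measurable τ) :
    Measurable (Function.uncurry (jumpIntensity D h B τ)) := by
  have h1 : Measurable fun p : CadlagPath d × ℝ => p.2.toNNReal :=
    measurable_real_toNNReal.comp measurable_snd
  refine Measurable.indicator (s := {p : CadlagPath d × ℝ |
    (p.2.toNNReal : ℝ≥0∞) < approachTime Dᶜ p.1}) (f := fun p : CadlagPath d × ℝ =>
      ENNReal.ofReal (h (canonical d (τ p.2.toNNReal) p.1)) * B (canonical d p.2.toNNReal p.1)) ?_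
        (measurableSet_lt h1.coe_nnreal_ennreal ((measurable_approachTime _).comp measurable_fst))
  exact ((hh.comp ((measurable_uncurry_canonical d).comp
    ((hτ.comp h1).prodMk measurable_fst))).ennreal_ofReal).mul
      (hB.comp ((measurable_uncurry_canonical d).comp (h1.prodMk measurable_fst)))

theorem jumpIntensity_le {d : ℕ} (D : Set (Rd d)) {h : Rd d → ℝ} (hh1 : ∀ y, h y ≤ 1)
    {B : Rd d → ℝ≥0∞} {C : ℝ≥0} (hBC : ∀ y, B y ≤ C) (τ : ℝ≥0 → ℝ≥0) (ω : CadlagPath d) (r : ℝ) :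
    jumpIntensity D h B τ ω r ≤ C :=
  indicator_le' (fun _ _ => (mul_le_of_le_one_left zero_le
    (ENNReal.ofReal_le_one.2 (hh1 _))).trans (hBC _)) (fun _ _ => zero_le) r

theorem CadlagPath.ae_leftLim_eq {d : ℕ} (ω : CadlagPath d) :
    ∀ᵐ r : ℝ, 0 ≤ r → Function.leftLim ω.1 r.toNNReal = canonical d r.toNNReal ω := by
  have h := (ω.countable_jumps.image ((↑) : ℝ≥0 → ℝ)).ae_notMem volume
  filter_upwards [h] with r hr hr0
  by_contra hne
  exact hr ⟨r.toNNReal, hne, Real.coe_toNNReal r hr0⟩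

theorem tendsto_lintegral_jumpIntensity {d : ℕ} {D : Set (Rd d)} {Q : Measure (CadlagPath d)}
    [IsProbabilityMeasure Q] {h : Rd d → ℝ} (hh : Continuous h) (hh1 : ∀ y, h y ≤ 1)
    {B : Rd d → ℝ≥0∞} (hBm : Measurable B) {C : ℝ≥0} (hBC : ∀ y, B y ≤ C) (t : ℕ) :
    Tendsto (fun k => ∫⁻ ω, (∫⁻ r in Ioc (0 : ℝ) t, jumpIntensity D h B (gridBefore k) ω r) ∂Q)
      atTop (𝓝 (∫⁻ ω, (∫⁻ r in Ioc (0 : ℝ) t, jumpIntensity D h B id ω r) ∂Q)) := by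
  have hm : ∀ k, Measurable (Function.uncurry (jumpIntensity D h B (gridBefore k))) := fun k =>
    measurable_jumpIntensity D hh.measurable hBm (measurable_gridBefore k)
  refine tendsto_lintegral_of_dominated_convergence (fun _ => C * ENNReal.ofReal t)
    (fun k => (hm k).lintegral_prod_right') (fun k => Eventually.of_forall fun ω => ?_) ?_
    (Eventually.of_forall fun ω => ?_)
  · refine (setLIntegral_mono' measurableSet_Ioc fun r _ => jumpIntensity_le D hh1 hBC _ ω r).trans ?_
    simp
  · simp [ENNReal.mul_eq_top]
  · refine tendsto_lintegral_of_dominated_convergence (fun _ => C)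
      (fun k => (hm k).of_uncurry_left)
      (fun k => Eventually.of_forall fun r => jumpIntensity_le D hh1 hBC _ ω r) ?_ ?_
    · simp [ENNReal.mul_eq_top]
    · rw [ae_restrict_iff' measurableSet_Ioc]
      filter_upwards [ω.ae_leftLim_eq] with r hr hr0
      by_cases hrS : (r.toNNReal : ℝ≥0∞) < approachTime Dᶜ ω
      swap
      · simp [jumpIntensity, hrS]
      simp only [jumpIntensity, indicator, mem_ofPred_eq, hrS, if_true]
      refine ENNReal.Tendsto.mul_const ?_ (Or.inr ((hBC _).trans_lt ENNReal.coe_lt_top).ne)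
      have := tendsto_canonical_gridBefore ω (Real.toNNReal_pos.2 hr0.1)
      rw [hr hr0.1.le] at this
      exact ((ENNReal.continuous_ofReal.comp hh).tendsto _).comp this

/-- Summation of the cell estimates over the grid `ℕ / (k + 1)`: only the cell that contains the
approach time is kept on the left. -/
theorem IsMartingaleSolution.lintegral_grid_le {d : ℕ} {A : LevyCoeff d} {D : Set (Rd d)}
    {μ : Measure (Rd d)} {Q : Measure (CadlagPath d)} (hQ : IsMartingaleSolution A μ Q)
    {f h : Rd d → ℝ} (hf : IsCb2 f) (hf0 : ∀ y, 0 ≤ f y) (hh : Measurable h)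
    (hh0 : ∀ y, 0 ≤ h y) (hh1 : ∀ y, h y ≤ 1) (hfh : ∀ y, h y * f y = 0)
    {B : Rd d → ℝ≥0∞} (hBm : Measurable B) (hB : ∀ y ∈ D, ENNReal.ofReal (A.op f y) ≤ B y)
    (t k : ℕ) :
    ∫⁻ ω, {ω | 0 < approachTime Dᶜ ω ∧ approachTime Dᶜ ω ≤ t}.indicator (fun ω =>
        ENNReal.ofReal (h (canonical d (gridBefore k (approachTime Dᶜ ω).toNNReal) ω)) *
          ENNReal.ofReal (f (canonical d (approachTime Dᶜ ω).toNNReal ω))) ω ∂Q ≤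
      ∫⁻ ω, (∫⁻ r in Ioc (0 : ℝ) t, jumpIntensity D h B (gridBefore k) ω r) ∂Q := by
  have hSm : Measurable (approachTime (d := d) Dᶜ) := measurable_approachTime _
  set a : ℕ → ℝ≥0 := fun i => (i : ℝ≥0) / ((k : ℝ≥0) + 1) with ha
  set b : ℕ → ℝ≥0 := fun i => ((i : ℝ≥0) + 1) / ((k : ℝ≥0) + 1) with hb
  have hN : (0 : ℝ≥0) < k + 1 := by positivity
  have hab : ∀ i, a i ≤ b i := fun i => by
    simp only [ha, hb]
    gcongr
    exact le_self_add
  set L : ℕ → CadlagPath d → ℝ≥0∞ := fun i =>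
    {ω | (a i : ℝ≥0∞) ≤ approachTime Dᶜ ω}.indicator (fun ω =>
        ENNReal.ofReal (h (canonical d (a i) ω)) * ENNReal.ofReal
          (f (canonical d (max (a i) (min (approachTime Dᶜ ω) (b i)).toNNReal) ω))) with hL
  have hLm : ∀ i, Measurable (L i) := fun i => by
    refine Measurable.indicator ?_ (measurableSet_le measurable_const hSm)
    refine ((hh.comp (measurable_canonical d _)).ennreal_ofReal).mul ?_
    exact (hf.1.continuous.measurable.comp (measurable_const.max
      (hSm.min measurable_const).ennreal_toNNReal).canonical_comp).ennreal_ofReal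
  set G : CadlagPath d → ℝ → ℝ≥0∞ := jumpIntensity D h B (gridBefore k) with hG
  have hGm : Measurable (Function.uncurry G) :=
    measurable_jumpIntensity D hh hBm (measurable_gridBefore k)
  have hcell : ∀ i, ∫⁻ ω, L i ω ∂Q ≤ ∫⁻ ω, (∫⁻ r in Ioc (a i : ℝ) (b i), G ω r) ∂Q := fun i => by
    refine (hQ.lintegral_cell_le hf hf0 hh hh0 hh1 hfh hB (hab i)).trans
      (lintegral_mono fun ω => setLIntegral_mono' measurableSet_Ioc fun r hr => le_of_eq ?_)
    have hr0 : 0 ≤ r := (a i).2.trans hr.1.le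
    have hgrid : gridBefore k r.toNNReal = a i := gridBefore_eq
      (by rw [← NNReal.coe_lt_coe, Real.coe_toNNReal _ hr0]; exact hr.1)
      (by rw [← NNReal.coe_le_coe, Real.coe_toNNReal _ hr0]; exact hr.2)
    simp only [hG, jumpIntensity, indicator, hgrid]
  calc _ ≤ ∫⁻ ω, ∑ i ∈ Finset.range (t * (k + 1)), L i ω ∂Q := by
        refine lintegral_mono fun ω => ?_
        by_cases hω : 0 < approachTime Dᶜ ω ∧ approachTime Dᶜ ω ≤ t
        swap
        · simp [hω]
        obtain ⟨s, hs⟩ : ∃ s : ℝ≥0, (s : ℝ≥0∞) = approachTime Dᶜ ω :=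
          ⟨_, ENNReal.coe_toNNReal (hω.2.trans_lt (ENNReal.natCast_lt_top t)).ne⟩
        rw [indicator_of_mem (by exact hω), ← hs, ENNReal.toNNReal_coe]
        rw [← hs] at hω
        obtain ⟨i, hi, h1, h2⟩ := exists_gridBefore_eq k (ENNReal.coe_pos.1 hω.1)
        have hst : s ≤ (t : ℝ≥0) := by exact_mod_cast hω.2
        have hit : i ∈ Finset.range (t * (k + 1)) := by
          rw [Finset.mem_range]
          have := h1.trans_le hst
          rw [div_lt_iff₀ hN] at this
          exact_mod_cast this
        refine le_trans (le_of_eq ?_)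
          (Finset.single_le_sum (f := fun i => L i ω) (fun _ _ => zero_le) hit)
        have hm : (a i : ℝ≥0∞) ≤ approachTime Dᶜ ω := by
          rw [← hs]; exact ENNReal.coe_le_coe.2 h1.le
        simp only [hL]
        rw [indicator_of_mem (by exact hm), hi, ← hs, min_eq_left (ENNReal.coe_le_coe.2 h2),
          ENNReal.toNNReal_coe, max_eq_right h1.le]
    _ = ∑ i ∈ Finset.range (t * (k + 1)), ∫⁻ ω, L i ω ∂Q :=
        lintegral_finsetSum _ fun i _ => hLm i
    _ ≤ ∑ i ∈ Finset.range (t * (k + 1)), ∫⁻ ω, (∫⁻ r in Ioc (a i : ℝ) (b i), G ω r) ∂Q :=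
        Finset.sum_le_sum fun i _ => hcell i
    _ = ∫⁻ ω, ∑ i ∈ Finset.range (t * (k + 1)), (∫⁻ r in Ioc (a i : ℝ) (b i), G ω r) ∂Q :=
        (lintegral_finsetSum _ fun i _ => hGm.lintegral_prod_right').symm
    _ ≤ _ := by
        refine lintegral_mono fun ω => ?_
        rw [← lintegral_biUnion_finset]
        · refine lintegral_mono_set (iUnion₂_subset fun i hi => Ioc_subset_Ioc (a i).2 ?_)
          rw [Finset.mem_range, ← Nat.add_one_le_iff] at hi
          have : b i ≤ (t : ℝ≥0) := by
            rw [div_le_iff₀ hN]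
            exact_mod_cast hi
          exact_mod_cast this
        · intro i _ j _ hij
          refine Set.disjoint_left.2 fun r h1 h2 => hij ?_
          wlog hlt : i < j generalizing i j
          · rcases lt_or_eq_of_le (not_lt.1 hlt) with h | h
            · exact (this ‹_› ‹_› hij.symm h2 h1 h).symm
            · exact h.symm
          have : b i ≤ a j := by
            simp only [ha, hb]
            gcongr
            exact_mod_cast hlt
          have h3 : r ≤ b i := h1.2
          have h4 : (a j : ℝ) < r := h2.1
          have h5 : (b i : ℝ) ≤ a j := by exact_mod_cast this
          linarith
        · exact fun i _ => measurableSet_Ioc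

/-- The expected value of `h(X_{S-}) f(X_S)` at the approach time `S` is at most the expected value
of `∫_0^S h(X_r) B(X_r) dr`. -/
theorem IsMartingaleSolution.lintegral_jump_le {d : ℕ} {A : LevyCoeff d} {D : Set (Rd d)}
    {μ : Measure (Rd d)} {Q : Measure (CadlagPath d)} (hQ : IsMartingaleSolution A μ Q)
    {f h : Rd d → ℝ} (hf : IsCb2 f) (hf0 : ∀ y, 0 ≤ f y) (hf1 : ∀ y, f y ≤ 1) (hh : Continuous h)
    (hh0 : ∀ y, 0 ≤ h y) (hh1 : ∀ y, h y ≤ 1) (hfh : ∀ y, h y * f y = 0)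
    {B : Rd d → ℝ≥0∞} (hBm : Measurable B) (hB : ∀ y ∈ D, ENNReal.ofReal (A.op f y) ≤ B y)
    {C : ℝ≥0} (hBC : ∀ y, B y ≤ C) (t : ℕ) :
    ∫⁻ ω, {ω | 0 < approachTime Dᶜ ω ∧ approachTime Dᶜ ω ≤ t}.indicator (fun ω =>
        ENNReal.ofReal (h (Function.leftLim ω.1 (approachTime Dᶜ ω).toNNReal)) *
          ENNReal.ofReal (f (canonical d (approachTime Dᶜ ω).toNNReal ω))) ω ∂Q ≤
      ∫⁻ ω, (∫⁻ r in Ioc (0 : ℝ) t, jumpIntensity D h B id ω r) ∂Q := by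
  have := hQ.prob
  have hSm : Measurable (approachTime (d := d) Dᶜ) := measurable_approachTime _
  have hSn : Measurable fun ω : CadlagPath d => (approachTime Dᶜ ω).toNNReal := hSm.ennreal_toNNReal
  have hset : MeasurableSet {ω : CadlagPath d | 0 < approachTime Dᶜ ω ∧ approachTime Dᶜ ω ≤ t} :=
    (measurableSet_lt measurable_const hSm).inter (measurableSet_le hSm measurable_const)
  have hh1' : ∀ y, ENNReal.ofReal (h y) ≤ 1 := fun y => ENNReal.ofReal_le_one.2 (hh1 y)
  have hhc : Continuous fun y => ENNReal.ofReal (h y) := ENNReal.continuous_ofReal.comp hh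
  refine le_of_tendsto_of_tendsto'
    (tendsto_lintegral_of_dominated_convergence (fun _ => 1) (fun k => ?_)
      (fun k => Eventually.of_forall fun ω => ?_) (by simp)
      (Eventually.of_forall fun ω => ?_))
    (tendsto_lintegral_jumpIntensity hh hh1 hBm hBC t)
    fun k => hQ.lintegral_grid_le hf hf0 hh.measurable hh0 hh1 hfh hBm hB t k
  · refine Measurable.indicator ?_ hset
    exact (hh.measurable.comp ((measurable_gridBefore k).comp hSn).canonical_comp).ennreal_ofReal.mul
      (hf.1.continuous.measurable.comp hSn.canonical_comp).ennreal_ofReal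
  · exact indicator_le' (fun ω _ => mul_le_one' (hh1' _) (ENNReal.ofReal_le_one.2 (hf1 _)))
      (fun _ _ => zero_le) ω
  · by_cases hω : 0 < approachTime Dᶜ ω ∧ approachTime Dᶜ ω ≤ t
    swap
    · simp [hω]
    simp only [indicator, mem_ofPred_eq, hω, and_self, if_true]
    have hpos : 0 < (approachTime Dᶜ ω).toNNReal :=
      ENNReal.toNNReal_pos hω.1.ne' (hω.2.trans_lt (ENNReal.natCast_lt_top t)).ne
    exact ENNReal.Tendsto.mul_const
      ((hhc.tendsto _).comp (tendsto_canonical_gridBefore ω hpos)) (Or.inr ENNReal.ofReal_ne_top)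

open scoped Pointwise

/-- If one finite measure is at most another one on all continuous functions supported in an open
set `U`, then the null sets in `U` of the second are null sets of the first. -/
theorem measure_eq_zero_of_lintegral_le {X : Type*} [PseudoMetricSpace X] [MeasurableSpace X]
    [BorelSpace X] {ν₁ ν₂ : Measure X} [IsFiniteMeasure ν₁] [IsFiniteMeasure ν₂] {U : Set X}
    (hU : IsOpen U) (hUne : Uᶜ.Nonempty)
    (hle : ∀ h : X → ℝ, Continuous h → (∀ y, 0 ≤ h y) → (∀ y, h y ≤ 1) → (∀ y ∉ U, h y = 0) →
      ∫⁻ y, ENNReal.ofReal (h y) ∂ν₁ ≤ ∫⁻ y, ENNReal.ofReal (h y) ∂ν₂)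
    {E : Set X} (hEU : E ⊆ U) (hE : ν₂ E = 0) : ν₁ E = 0 := by
  have hopen : ∀ G, IsOpen G → G ⊆ U → ν₁ G ≤ ν₂ G := by
    intro G hG hGU
    have hne : Gᶜ.Nonempty := hUne.mono (compl_subset_compl.2 hGU)
    set h : ℕ → X → ℝ := fun n y => min 1 (n * Metric.infDist y Gᶜ) with hh
    have hc : ∀ n, Continuous (h n) := fun n =>
      continuous_const.min (continuous_const.mul (Metric.continuous_infDist_pt _))
    have h0 : ∀ n y, 0 ≤ h n y := fun n y =>
      le_min zero_le_one (mul_nonneg n.cast_nonneg Metric.infDist_nonneg)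
    have hG0 : ∀ n, ∀ y ∉ G, h n y = 0 := fun n y hy => by
      simp [hh, Metric.infDist_zero_of_mem (show y ∈ Gᶜ from hy)]
    have hlim : Tendsto (fun n => ∫⁻ y, ENNReal.ofReal (h n y) ∂ν₁) atTop
        (𝓝 (∫⁻ y, G.indicator 1 y ∂ν₁)) := by
      refine tendsto_lintegral_of_dominated_convergence (fun _ => 1)
        (fun n => (hc n).measurable.ennreal_ofReal)
        (fun n => Eventually.of_forall fun y => ENNReal.ofReal_le_one.2 (min_le_left _ _))
        (by simp) (Eventually.of_forall fun y => ?_)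
      by_cases hy : y ∈ G
      · have hpos : 0 < Metric.infDist y Gᶜ :=
          (hG.isClosed_compl.notMem_iff_infDist_pos hne).1 (not_not.2 hy)
        refine tendsto_const_nhds.congr' ?_
        obtain ⟨N, hN⟩ := exists_nat_ge (1 / Metric.infDist y Gᶜ)
        filter_upwards [eventually_ge_atTop N] with n hn
        have : 1 ≤ n * Metric.infDist y Gᶜ := by
          rw [← div_le_iff₀ hpos]
          exact hN.trans (by exact_mod_cast hn)
        simp [hh, hy, this]
      · simp [hG0 _ y hy, hy]
    rw [lintegral_indicator_one hG.measurableSet] at hlim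
    refine le_of_tendsto' hlim fun n => (hle (h n) (hc n) (h0 n) (fun y => min_le_left _ _)
      fun y hy => hG0 n y fun h' => hy (hGU h')).trans ?_
    rw [← lintegral_indicator_one hG.measurableSet]
    refine lintegral_mono fun y => ?_
    by_cases hy : y ∈ G
    · rw [indicator_of_mem hy]
      exact ENNReal.ofReal_le_one.2 (min_le_left _ _)
    · simp [hG0 _ y hy]
  refine le_antisymm (le_of_forall_pos_le_add fun ε hε => ?_) zero_le
  obtain ⟨G, hEG, hG, hlt⟩ := E.exists_isOpen_lt_of_lt (μ := ν₂) ε (by rwa [hE])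
  calc ν₁ E ≤ ν₁ (G ∩ U) := measure_mono (subset_inter hEG hEU)
    _ ≤ ν₂ (G ∩ U) := hopen _ (hG.inter hU) inter_subset_right
    _ ≤ ν₂ G := measure_mono inter_subset_left
    _ ≤ 0 + ε := by rw [zero_add]; exact hlt.le

/-- No jump at the approach time leads from `E` into a ball that the Lévy kernel does not reach from
the points of `E ∩ D`. -/
theorem IsMartingaleSolution.ae_notMem_ball_of_leftLim_mem {d : ℕ} {A : LevyCoeff d}
    {D : Set (Rd d)} (hA : A.Admissible D) {μ : Measure (Rd d)}
    {Q : Measure (CadlagPath d)} (hQ : IsMartingaleSolution A μ Q) {c₁ c₂ : Rd d} {r₁ r₂ : ℝ}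
    (hr₂ : 0 < r₂) (hsep : r₁ + r₂ < dist c₁ c₂) {E : Set (Rd d)}
    (hE : MeasurableSet E) (hEU : E ⊆ Metric.ball c₁ r₁)
    (hEW : ∀ y ∈ E, y ∈ D → A.N y (Metric.ball c₂ r₂ - Metric.ball c₁ r₁) = 0) :
    ∀ᵐ ω ∂Q, 0 < approachTime Dᶜ ω → approachTime Dᶜ ω ≠ ∞ →
      Function.leftLim ω.1 (approachTime Dᶜ ω).toNNReal ∈ E →
      canonical d (approachTime Dᶜ ω).toNNReal ω ∉ Metric.ball c₂ r₂ := by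
  have := hQ.prob
  set U := Metric.ball c₁ r₁ with hU
  set W := Metric.ball c₂ r₂ - U with hW
  have hUo : IsOpen U := Metric.isOpen_ball
  have hWm : MeasurableSet W := (Metric.isOpen_ball.sub_right).measurableSet
  have hdisj : ∀ y ∈ U, y ∉ Metric.ball c₂ r₂ := fun y hy hy' => by
    have := dist_triangle_left c₁ c₂ y
    rw [Metric.mem_ball] at hy hy'
    linarith
  have hc₂ : c₂ ∉ U := fun h => hdisj c₂ h (Metric.mem_ball_self hr₂)
  -- `f` lives on the ball that is not to be reached
  let f : ContDiffBump c₂ := ⟨r₂ / 2, r₂, half_pos hr₂, half_lt_self hr₂⟩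
  have hfU : ∀ y ∈ U, f y = 0 := fun y hy => f.zero_of_le_dist (not_lt.1 (hdisj y hy))
  obtain ⟨C₁, hC₁⟩ := hA.exists_abs_op_le (isCb2_contDiffBump f)
  obtain ⟨C₂, hC₂⟩ := hA.exists_kernel_le (W := W) (sub_pos.2 hsep) (by
    rintro _ ⟨v, hv, u, hu, rfl⟩
    have h1 := dist_triangle4 c₁ u v c₂
    rw [Metric.mem_ball] at hv
    rw [hU, Metric.mem_ball, dist_comm] at hu
    rw [dist_comm u v, dist_eq_norm v u] at h1
    linarith)
  classical
  -- on `U` the function `A f` is at most the mass that the kernel sends to the support of `f`, which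
  -- is zero on `E`; elsewhere only its boundedness matters
  set B : Rd d → ℝ≥0∞ := fun y => if y ∈ U then A.N y W else C₁ with hB
  have hBm : Measurable B :=
    Measurable.ite hUo.measurableSet (Kernel.measurable_coe _ hWm) measurable_const
  have hBC : ∀ y, B y ≤ (max C₁ C₂ : ℝ≥0) := fun y => by
    simp only [hB]
    split_ifs
    · exact (hC₂ y).trans (ENNReal.coe_le_coe.2 (le_max_right _ _))
    · exact ENNReal.coe_le_coe.2 (le_max_left _ _)
  have hBf : ∀ y ∈ D, ENNReal.ofReal (A.op f y) ≤ B y := fun y hy => by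
    simp only [hB]
    split_ifs with hyU
    · refine A.op_le_of_eqOn_zero (fun z => f.nonneg) (fun z => f.le_one) hUo hfU hWm hyU
        (fun z hz => ?_) ((hC₂ y).trans_lt ENNReal.coe_lt_top).ne
      have hz' : y + z ∈ Metric.ball c₂ r₂ := by
        rw [← f.support_eq]; exact hz
      exact ⟨y + z, hz', y, hyU, by simp⟩
    · rw [← ENNReal.ofReal_coe_nnreal]
      exact ENNReal.ofReal_le_ofReal ((le_abs_self _).trans (hC₁ y hy))
  have hSm : Measurable (approachTime (d := d) Dᶜ) := measurable_approachTime _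
  have hSn : Measurable fun ω : CadlagPath d => (approachTime Dᶜ ω).toNNReal := hSm.ennreal_toNNReal
  suffices H : ∀ t : ℕ, ∀ᵐ ω ∂Q, 0 < approachTime Dᶜ ω → approachTime Dᶜ ω ≤ t →
      Function.leftLim ω.1 (approachTime Dᶜ ω).toNNReal ∈ E →
      canonical d (approachTime Dᶜ ω).toNNReal ω ∉ Metric.ball c₂ r₂ by
    filter_upwards [ae_all_iff.2 H] with ω hω h0 htop
    obtain ⟨t, ht⟩ := ENNReal.exists_nat_gt htop
    exact hω t h0 ht.le
  intro t
  set L : CadlagPath d → Rd d := fun ω => Function.leftLim ω.1 (approachTime Dᶜ ω).toNNReal with hL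
  have hLm : Measurable L := measurable_leftLim_comp hSn
  have hset : MeasurableSet {ω : CadlagPath d | 0 < approachTime Dᶜ ω ∧ approachTime Dᶜ ω ≤ t} :=
    (measurableSet_lt measurable_const hSm).inter (measurableSet_le hSm measurable_const)
  set g : CadlagPath d → ℝ≥0∞ :=
    {ω | 0 < approachTime Dᶜ ω ∧ approachTime Dᶜ ω ≤ t}.indicator fun ω =>
      ENNReal.ofReal (f (canonical d (approachTime Dᶜ ω).toNNReal ω)) with hg
  have hgm : Measurable g :=
    ((f.continuous.measurable.comp hSn.canonical_comp).ennreal_ofReal).indicator hset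
  set J : CadlagPath d × ℝ → ℝ≥0∞ := Function.uncurry (jumpIntensity D 1 B id) with hJ
  have hJm : Measurable J := measurable_jumpIntensity D measurable_one hBm measurable_id
  have hJC : ∀ p, J p ≤ (max C₁ C₂ : ℝ≥0) := fun p => jumpIntensity_le D (fun _ => le_rfl) hBC _ _ _
  have hXm : Measurable fun p : CadlagPath d × ℝ => canonical d p.2.toNNReal p.1 :=
    (measurable_uncurry_canonical_toNNReal d).comp measurable_swap
  -- the law of the left limit, weighted by `f` after the jump, and the occupation measure, weighted
  -- by the jump intensity
  set ν₁ : Measure (Rd d) := (Q.withDensity g).map L with hν₁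
  set ν₂ : Measure (Rd d) := ((Q.prod (volume.restrict (Ioc (0 : ℝ) t))).withDensity J).map
    fun p => canonical d p.2.toNNReal p.1 with hν₂
  have hfin₁ : IsFiniteMeasure (Q.withDensity g) := by
    refine isFiniteMeasure_withDensity (ne_of_lt ?_)
    refine (lintegral_mono (g := fun _ => 1) fun ω => ?_).trans_lt (by simp)
    exact indicator_le' (fun ω _ => ENNReal.ofReal_le_one.2 f.le_one) (fun _ _ => zero_le) ω
  have hfin₂ : IsFiniteMeasure ((Q.prod (volume.restrict (Ioc (0 : ℝ) t))).withDensity J) := by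
    refine isFiniteMeasure_withDensity (ne_of_lt ?_)
    refine (lintegral_mono hJC).trans_lt ?_
    rw [lintegral_const]
    exact ENNReal.mul_lt_top ENNReal.coe_lt_top (measure_lt_top _ _)
  have hE₂ : ν₂ E = 0 := by
    rw [hν₂, Measure.map_apply hXm hE, withDensity_apply _ (hXm hE)]
    refine (setLIntegral_congr_fun (hXm hE) fun p hp => ?_).trans lintegral_zero
    simp only [hJ, Function.uncurry, jumpIntensity, indicator]
    split_ifs with hlt
    · have hpE : canonical d p.2.toNNReal p.1 ∈ E := hp
      have hpD : canonical d p.2.toNNReal p.1 ∈ D := not_not.1 (notMem_of_lt_approachTime hlt)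
      simp [hB, hEU hpE, hEW _ hpE hpD]
    · rfl
  have hE₁ : ν₁ E = 0 := by
    refine measure_eq_zero_of_lintegral_le hUo ⟨c₂, hc₂⟩ (fun h hc h0 h1 hU0 => ?_) hEU hE₂
    have hcm : Measurable fun y => ENNReal.ofReal (h y) := hc.measurable.ennreal_ofReal
    have hcL : Measurable fun ω => ENNReal.ofReal (h (L ω)) := hcm.comp hLm
    have hcX : Measurable fun p : CadlagPath d × ℝ =>
      ENNReal.ofReal (h (canonical d p.2.toNNReal p.1)) := hcm.comp hXm
    rw [lintegral_map hcm hLm, lintegral_withDensity_eq_lintegral_mul _ hgm hcL,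
      lintegral_map hcm hXm, lintegral_withDensity_eq_lintegral_mul _ hJm hcX,
      lintegral_prod _ (hJm.mul hcX).aemeasurable]
    refine le_trans (le_of_eq ?_) ((hQ.lintegral_jump_le (isCb2_contDiffBump f)
      (fun _ => f.nonneg) (fun _ => f.le_one) hc h0 h1 (fun y => ?_) hBm hBf hBC t).trans
        (le_of_eq ?_))
    · refine lintegral_congr fun ω => ?_
      simp only [hg, hL, Pi.mul_apply, indicator]
      split_ifs
      · rw [mul_comm]
      · simp
    · by_cases hy : y ∈ U
      · simp [hfU y hy]
      · simp [hU0 y hy]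
    · refine lintegral_congr fun ω => lintegral_congr fun r => ?_
      simp only [hJ, Function.uncurry, Pi.mul_apply, jumpIntensity, indicator]
      split_ifs
      · simp [mul_comm]
      · simp
  rw [hν₁, Measure.map_apply hLm hE, withDensity_apply _ (hLm hE),
    setLIntegral_eq_zero_iff (hLm hE) hgm] at hE₁
  filter_upwards [hE₁] with ω hω h0 ht hLE hV
  have := hω hLE
  rw [hg, indicator_of_mem (by exact ⟨h0, ht⟩), ENNReal.ofReal_eq_zero] at this
  exact absurd (f.pos_of_mem_ball hV) (not_lt.2 this)

/-- Almost surely, at the approach time the path is either continuous, or it jumps out of `D` by an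
amount in the support of the Lévy kernel. -/
theorem IsMartingaleSolution.ae_jump {d : ℕ} {A : LevyCoeff d} {D : Set (Rd d)}
    (hA : A.Admissible D) (hD : MeasurableSet D) {μ : Measure (Rd d)}
    {Q : Measure (CadlagPath d)} (hQ : IsMartingaleSolution A μ Q) :
    ∀ᵐ ω ∂Q, 0 < approachTime Dᶜ ω → ∀ s : ℝ≥0, approachTime Dᶜ ω = s →
      Function.leftLim ω.1 s ≠ canonical d s ω →
      Function.leftLim ω.1 s ∈ D ∧
        canonical d s ω - Function.leftLim ω.1 s ∈ (A.N (Function.leftLim ω.1 s)).support := by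
  -- `E i j n` is the part of the `i`-th ball of radius `r n` from which the kernel does not reach the
  -- `j`-th ball
  set e := TopologicalSpace.denseSeq (Rd d) with he
  set r : ℕ → ℝ := fun n => 1 / ((n : ℝ) + 1) with hr
  set E : ℕ → ℕ → ℕ → Set (Rd d) := fun i j n => Metric.ball (e i) (r n) ∩
    (D ∩ {y | A.N y (Metric.ball (e j) (r n) - Metric.ball (e i) (r n)) ≠ 0})ᶜ with hE
  have hEm : ∀ i j n, MeasurableSet (E i j n) := fun i j n => by
    refine measurableSet_ball.inter (hD.inter ?_).compl
    exact (Kernel.measurable_coe _ (Metric.isOpen_ball.sub_right).measurableSet)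
      (measurableSet_singleton (0 : ℝ≥0∞)).compl
  have key : ∀ i j n, r n + r n < dist (e i) (e j) → ∀ᵐ ω ∂Q, 0 < approachTime Dᶜ ω →
      approachTime Dᶜ ω ≠ ∞ → Function.leftLim ω.1 (approachTime Dᶜ ω).toNNReal ∈ E i j n →
      canonical d (approachTime Dᶜ ω).toNNReal ω ∉ Metric.ball (e j) (r n) := fun i j n hsep =>
    hQ.ae_notMem_ball_of_leftLim_mem hA (by positivity) hsep (hEm i j n) inter_subset_left
      fun y hy hyD => by_contra fun h => hy.2 ⟨hyD, h⟩
  have key' : ∀ᵐ ω ∂Q, ∀ i j n, r n + r n < dist (e i) (e j) → 0 < approachTime Dᶜ ω →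
      approachTime Dᶜ ω ≠ ∞ → Function.leftLim ω.1 (approachTime Dᶜ ω).toNNReal ∈ E i j n →
      canonical d (approachTime Dᶜ ω).toNNReal ω ∉ Metric.ball (e j) (r n) := by
    simp only [ae_all_iff, eventually_imp_distrib_left]
    exact fun i j n hsep => by simpa only [eventually_imp_distrib_left] using key i j n hsep
  filter_upwards [key'] with ω hω h0 s hs hne
  rw [hs, ENNReal.toNNReal_coe] at hω
  rw [hs] at h0
  set l := Function.leftLim ω.1 s
  set y := canonical d s ω
  by_contra hcon
  -- a neighbourhood of the jump which the kernel does not charge, if the jump starts in `D`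
  obtain ⟨ε, hε, hball⟩ : ∃ ε > 0, l ∈ D → A.N l (Metric.ball (y - l) ε) = 0 := by
    by_cases hl : l ∈ D
    · obtain ⟨O, hO, hO0⟩ := Measure.notMem_support_iff_exists.1 fun h => hcon ⟨hl, h⟩
      obtain ⟨ε, hε, hεO⟩ := Metric.mem_nhds_iff.1 hO
      exact ⟨ε, hε, fun _ => measure_mono_null hεO hO0⟩
    · exact ⟨1, one_pos, fun h => absurd h hl⟩
  have hd : 0 < dist l y := dist_pos.2 hne
  obtain ⟨n, hn⟩ := exists_nat_one_div_lt (lt_min (half_pos (half_pos hε)) (half_pos (half_pos hd)))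
  have hn1 : r n < ε / 2 / 2 := hn.trans_le (min_le_left _ _)
  have hn2 : r n < dist l y / 2 / 2 := hn.trans_le (min_le_right _ _)
  have hrn : 0 < r n := by positivity
  obtain ⟨i, hi⟩ := (TopologicalSpace.denseRange_denseSeq (Rd d)).exists_mem_open
    Metric.isOpen_ball ⟨l, Metric.mem_ball_self hrn⟩
  obtain ⟨j, hj⟩ := (TopologicalSpace.denseRange_denseSeq (Rd d)).exists_mem_open
    Metric.isOpen_ball ⟨y, Metric.mem_ball_self hrn⟩
  rw [Metric.mem_ball] at hi hj
  refine hω i j n ?_ h0 ENNReal.coe_ne_top ⟨?_, fun h => h.2 ?_⟩ ?_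
  · have := dist_triangle4 l (e i) (e j) y
    rw [dist_comm l (e i)] at this
    linarith
  · rwa [Metric.mem_ball, dist_comm]
  · refine measure_mono_null ?_ (hball h.1)
    rintro _ ⟨v, hv, u, hu, rfl⟩
    rw [Metric.mem_ball] at hv hu ⊢
    have h1 := dist_triangle v (e j) y
    have h2 := dist_triangle u (e i) l
    have h3 := dist_sub_sub_le v u y l
    exact h3.trans_lt (by linarith)
  · rwa [Metric.mem_ball, dist_comm]

/-! ### The exit time -/

theorem approachTime_le_exitTime {d : ℕ} (D : Set (Rd d)) (ω : CadlagPath d) :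
    approachTime Dᶜ ω ≤ exitTime D ω := by
  refine le_sInf ?_
  rintro _ ⟨t, -, ht, rfl⟩
  by_contra! h
  exact notMem_of_lt_approachTime h ht

theorem exitTime_eq_approachTime {d : ℕ} {A : LevyCoeff d} {D : Set (Rd d)} (hD : IsOpen D)
    (hne : Dᶜ.Nonempty) {ω : CadlagPath d} (h0 : canonical d 0 ω ∈ D)
    (hfin : exitTime D ω < ∞)
    (hjump : 0 < approachTime Dᶜ ω → ∀ s : ℝ≥0, approachTime Dᶜ ω = s →
      Function.leftLim ω.1 s ≠ canonical d s ω → Function.leftLim ω.1 s ∈ D ∧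
        canonical d s ω - Function.leftLim ω.1 s ∈ (A.N (Function.leftLim ω.1 s)).support) :
    exitTime D ω = approachTime Dᶜ ω ∧
      ∃ s : ℝ≥0, 0 < s ∧ approachTime Dᶜ ω = s ∧ canonical d s ω ∈ A.extendedClosure D := by
  obtain ⟨s, hs⟩ : ∃ s : ℝ≥0, approachTime Dᶜ ω = s :=
    ⟨_, (ENNReal.coe_toNNReal ((approachTime_le_exitTime D ω).trans_lt hfin).ne).symm⟩
  obtain ⟨hs0, hs1⟩ := mem_or_leftLim_mem_of_approachTime_eq hD.isClosed_compl hne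
    (not_not.2 h0) hs
  have hlD : Function.leftLim ω.1 s ∈ closure D := by
    have : (𝓝[<] s).NeBot := nhdsLT_neBot_of_exists_lt (Exists.intro 0 hs0)
    refine mem_closure_of_tendsto (ω.tendsto_leftLim s) ?_
    filter_upwards [self_mem_nhdsWithin] with r hr
    refine not_not.1 (notMem_of_lt_approachTime (F := Dᶜ) ?_)
    rw [hs]
    exact ENNReal.coe_lt_coe.2 hr
  have hj := hjump (by rw [hs]; exact_mod_cast hs0) s hs
  have hmain : canonical d s ω ∉ D ∧ canonical d s ω ∈ A.extendedClosure D := by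
    by_cases heq : Function.leftLim ω.1 s = canonical d s ω
    · rw [heq, or_self] at hs1
      rw [heq] at hlD
      refine ⟨hs1, Or.inl (Or.inl ⟨hlD, ?_⟩)⟩
      rwa [hD.interior_eq]
    · obtain ⟨h1, h2⟩ := hj heq
      have hsD : canonical d s ω ∉ D := hs1.resolve_right (not_not.2 h1)
      exact ⟨hsD, Or.inl (Or.inr ⟨mem_iUnion₂.2 ⟨_, h1, _, h2, by simp⟩, hsD⟩)⟩
  refine ⟨le_antisymm ?_ (approachTime_le_exitTime D ω), s, hs0, hs, hmain.2⟩
  rw [hs]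
  exact sInf_le ⟨s, hs0, hmain.1, rfl⟩

/-- Started in `D`, the process almost surely exits from `D` at the approach time of the
complement, into the extended closure of `D`. -/
theorem IsStrongMarkovSolution.ae_exitTime_eq {d : ℕ} {A : LevyCoeff d} {D : Set (Rd d)}
    {P : Kernel (Rd d) (CadlagPath d)} (hP : IsStrongMarkovSolution A P) (hA : A.Admissible D)
    (hD : IsOpen D) (hne : Dᶜ.Nonempty) (hET : ExitFinite P D) {x : Rd d} (hx : x ∈ D) :
    ∀ᵐ ω ∂(P x), canonical d 0 ω = x ∧ exitTime D ω = approachTime Dᶜ ω ∧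
      ∃ s : ℝ≥0, 0 < s ∧ approachTime Dᶜ ω = s ∧ canonical d s ω ∈ A.extendedClosure D := by
  have h0 : ∀ᵐ ω ∂(P x), canonical d 0 ω = x := by
    have : ∀ᵐ y ∂((P x).map (canonical d 0)), y = x := by
      rw [(hP.solution x).initial]
      simp [ae_dirac_eq]
    exact ae_of_ae_map (measurable_canonical d 0).aemeasurable this
  filter_upwards [h0, hET x hx, (hP.solution x).ae_jump hA hD.measurableSet] with ω h1 h2 h3
  exact ⟨h1, exitTime_eq_approachTime hD hne (h1 ▸ hx) h2 h3⟩

theorem exitMin_eq_of_exitTime_eq {d : ℕ} {D : Set (Rd d)} {ω : CadlagPath d}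
    (h : exitTime D ω = approachTime Dᶜ ω) (t : ℝ≥0) :
    exitMin D t ω = (min (approachTime Dᶜ ω) t).toNNReal := by
  rw [exitMin, h]

theorem canonical_exitMin_mem {d : ℕ} {A : LevyCoeff d} {D : Set (Rd d)} {ω : CadlagPath d}
    (h : ∃ s : ℝ≥0, 0 < s ∧ approachTime Dᶜ ω = s ∧ canonical d s ω ∈ A.extendedClosure D)
    (t : ℝ≥0) :
    canonical d (min (approachTime Dᶜ ω) t).toNNReal ω ∈ A.extendedClosure D := by
  obtain ⟨s, -, hs, hsD⟩ := h
  rw [hs, ← ENNReal.coe_min, ENNReal.toNNReal_coe]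
  rcases le_or_gt s t with hst | hst
  · rwa [min_eq_left hst]
  · rw [min_eq_right hst.le]
    refine Or.inr (not_not.1 (notMem_of_lt_approachTime (F := Dᶜ) ?_))
    rw [hs]
    exact ENNReal.coe_lt_coe.2 hst

/-- The integral of a function up to the time `S ∧ t`, where `S` is the approach time. -/
theorem lintegral_Ioc_min_approachTime {d : ℕ} (D : Set (Rd d)) (ω : CadlagPath d) (t : ℝ≥0)
    (F : ℝ → ℝ≥0∞) :
    ∫⁻ r in Ioc (0 : ℝ) t, {r : ℝ | (r.toNNReal : ℝ≥0∞) < approachTime Dᶜ ω}.indicator F r =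
      ∫⁻ r in Ioo (0 : ℝ) (min (approachTime Dᶜ ω) t).toNNReal, F r := by
  have hm : MeasurableSet {r : ℝ | (r.toNNReal : ℝ≥0∞) < approachTime Dᶜ ω} :=
    measurableSet_lt measurable_real_toNNReal.coe_nnreal_ennreal measurable_const
  rw [← restrict_Ioo_eq_restrict_Ioc, lintegral_indicator hm, Measure.restrict_restrict hm]
  congr 2
  ext r
  have hfin : min (approachTime Dᶜ ω) (t : ℝ≥0∞) ≠ ∞ :=
    (min_lt_of_right_lt ENNReal.coe_lt_top).ne
  simp only [mem_inter_iff, mem_ofPred_eq, mem_Ioo]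
  have key : 0 < r → (r < ((min (approachTime Dᶜ ω) t).toNNReal : ℝ) ↔
      (r.toNNReal : ℝ≥0∞) < approachTime Dᶜ ω ∧ r < t) := fun hr => by
    lift r to ℝ≥0 using hr.le
    rw [NNReal.coe_lt_coe, ← ENNReal.coe_lt_coe, ENNReal.coe_toNNReal hfin, lt_min_iff]
    simp
  tauto

/-! ### The killed semigroup through the approach time -/

/-- The killed semigroup with the exit time replaced by the approach time of the complement.  It
has the same values at the points from which these times agree almost surely, and is jointly
measurable. -/
noncomputable def approachSemigroup {d : ℕ} (P : Kernel (Rd d) (CadlagPath d)) (D : Set (Rd d))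
    (t : ℝ≥0) (f : Rd d → ℝ≥0∞) (x : Rd d) : ℝ≥0∞ :=
  ∫⁻ ω, {ω | (t : ℝ≥0∞) < approachTime Dᶜ ω}.indicator (fun ω => f (canonical d t ω)) ω ∂(P x)

theorem killedSemigroup_eq_approachSemigroup {d : ℕ} {P : Kernel (Rd d) (CadlagPath d)}
    {D : Set (Rd d)} {x : Rd d} (h : ∀ᵐ ω ∂(P x), exitTime D ω = approachTime Dᶜ ω) (t : ℝ≥0)
    (f : Rd d → ℝ≥0∞) : killedSemigroup P D t f x = approachSemigroup P D t f x := by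
  refine lintegral_congr_ae ?_
  filter_upwards [h] with ω hω
  simp only [indicator, mem_ofPred_eq, hω]

theorem approachSemigroup_mono {d : ℕ} (P : Kernel (Rd d) (CadlagPath d)) {D : Set (Rd d)}
    (t : ℝ≥0) {f g : Rd d → ℝ≥0∞} (hfg : ∀ y ∈ D, f y ≤ g y) (x : Rd d) :
    approachSemigroup P D t f x ≤ approachSemigroup P D t g x := by
  refine lintegral_mono fun ω => ?_
  simp only [indicator, mem_ofPred_eq]
  split_ifs with h
  · exact hfg _ (not_not.1 (notMem_of_lt_approachTime h))
  · rfl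

theorem measurable_killedPath {d : ℕ} (D : Set (Rd d)) {f : Rd d → ℝ≥0∞} (hf : Measurable f)
    {β : Type*} [MeasurableSpace β] {σ : β → ℝ≥0} (hσ : Measurable σ) {π : β → CadlagPath d}
    (hπ : Measurable π) :
    Measurable fun b => {ω | (σ b : ℝ≥0∞) < approachTime Dᶜ ω}.indicator
        (fun ω => f (canonical d (σ b) ω)) (π b) :=
  Measurable.indicator (s := {b | (σ b : ℝ≥0∞) < approachTime Dᶜ (π b)})
    (f := fun b => f (canonical d (σ b) (π b)))
    (hf.comp ((measurable_uncurry_canonical d).comp (hσ.prodMk hπ)))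
    (measurableSet_lt hσ.coe_nnreal_ennreal ((measurable_approachTime _).comp hπ))

theorem measurable_approachSemigroup {d : ℕ} (P : Kernel (Rd d) (CadlagPath d)) [IsSFiniteKernel P]
    (D : Set (Rd d)) {f : Rd d → ℝ≥0∞} (hf : Measurable f) :
    Measurable fun p : ℝ × Rd d => approachSemigroup P D p.1.toNNReal f p.2 := by
  have h1 : Measurable fun q : (ℝ × Rd d) × CadlagPath d =>
      {ω | (q.1.1.toNNReal : ℝ≥0∞) < approachTime Dᶜ ω}.indicator
        (fun ω => f (canonical d q.1.1.toNNReal ω)) q.2 :=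
    measurable_killedPath D hf (measurable_real_toNNReal.comp
      (measurable_fst.comp measurable_fst)) measurable_snd
  exact Measurable.lintegral_kernel_prod_right' (κ := P.comap Prod.snd measurable_snd) h1

theorem lintegral_approachSemigroup {d : ℕ} (P : Kernel (Rd d) (CadlagPath d)) [IsSFiniteKernel P]
    (D : Set (Rd d)) {f : Rd d → ℝ≥0∞} (hf : Measurable f) (t : ℝ≥0) (x : Rd d) :
    ∫⁻ r in Ioc (0 : ℝ) t, approachSemigroup P D r.toNNReal f x =
      ∫⁻ ω, (∫⁻ r in Ioo (0 : ℝ) (min (approachTime Dᶜ ω) t).toNNReal,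
        f (canonical d r.toNNReal ω)) ∂(P x) := by
  simp only [approachSemigroup]
  rw [lintegral_lintegral_swap (measurable_killedPath D hf
    (measurable_real_toNNReal.comp measurable_fst) measurable_snd).aemeasurable]
  refine lintegral_congr fun ω => ?_
  rw [← lintegral_Ioc_min_approachTime]
  rfl

/-! ### Weak subsolutions -/

theorem measurable_indicator_of_subtype {X : Type*} [MeasurableSpace X] {D : Set X}
    (hD : MeasurableSet D) {f : X → ℝ} (hf : Measurable fun x : D => f x) :
    Measurable (D.indicator f) := by
  refine measurable_of_restrict_of_restrict_compl hD ?_ ?_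
  · convert hf using 1
    ext x
    simp
  · convert measurable_const (a := (0 : ℝ)) using 1
    ext x
    simpa using fun h => absurd h x.2

/-- The discount factor up to the exit, through the values of `c` in `D` only. -/
theorem discount_eq {d : ℕ} {D : Set (Rd d)} (hD : MeasurableSet D) {c : Rd d → ℝ}
    (hcm : Measurable fun x : D => c x) (hc0 : ∀ x ∈ D, 0 ≤ c x) {ω : CadlagPath d} {r : ℝ≥0}
    (hr : (r : ℝ≥0∞) ≤ approachTime Dᶜ ω) :
    discount c r ω = Real.exp (-(∫⁻ s in Ioo (0 : ℝ) r,
      ENNReal.ofReal (D.indicator c (canonical d s.toNNReal ω))).toReal) := by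
  rw [discount, intervalIntegral.integral_of_le r.coe_nonneg, integral_Ioc_eq_integral_Ioo]
  have h1 : ∫ s in Ioo (0 : ℝ) r, c (canonical d s.toNNReal ω) =
      ∫ s in Ioo (0 : ℝ) r, D.indicator c (canonical d s.toNNReal ω) := by
    refine setIntegral_congr_fun measurableSet_Ioo fun s hs => ?_
    have hsD : canonical d s.toNNReal ω ∈ D := by
      refine not_not.1 (notMem_of_lt_approachTime (F := Dᶜ) (lt_of_lt_of_le ?_ hr))
      rw [ENNReal.coe_lt_coe, ← NNReal.coe_lt_coe, Real.coe_toNNReal _ hs.1.le]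
      exact hs.2
    rw [indicator_of_mem hsD]
  rw [h1, integral_eq_lintegral_of_nonneg_ae
    (Eventually.of_forall fun s => indicator_nonneg hc0 _)]
  have h2 : Measurable fun s : ℝ => canonical d s.toNNReal ω :=
    (measurable_uncurry_canonical_toNNReal d).comp measurable_prodMk_right
  exact ((measurable_indicator_of_subtype hD hcm).comp h2).aestronglyMeasurable

theorem lintegral_indicator_canonical_le {d : ℕ} {D : Set (Rd d)} {c : Rd d → ℝ} {K : ℝ≥0}
    (hcK : ∀ x ∈ D, c x ≤ K) (ω : CadlagPath d) (r : ℝ≥0) :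
    ∫⁻ s in Ioo (0 : ℝ) r, ENNReal.ofReal (D.indicator c (canonical d s.toNNReal ω)) ≤ K * r := by
  refine (lintegral_mono (g := fun _ => (K : ℝ≥0∞)) fun s => ?_).trans (by simp)
  rw [← ENNReal.ofReal_coe_nnreal]
  exact ENNReal.ofReal_le_ofReal (indicator_le' hcK (fun _ _ => K.2) _)

/-- The gap between a weak subsolution and its maximum dominates the sum of the discounted gap at
the exit, the loss of mass by the discount, and the source term. -/
theorem IsWeakSubsolution.lintegral_add_le {d : ℕ} {A : LevyCoeff d} {D : Set (Rd d)}
    (hD : MeasurableSet D) {P : Kernel (Rd d) (CadlagPath d)} {c g u : Rd d → ℝ}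
    (hu : IsWeakSubsolution P D c g u) (hcm : Measurable fun x : D => c x)
    (hc0 : ∀ x ∈ D, 0 ≤ c x) {M : ℝ}
    (hM : ∀ y ∈ A.extendedClosure D, u y ≤ M) (hM0 : 0 ≤ M) {x : Rd d} (hx : x ∈ D)
    (hprob : IsProbabilityMeasure (P x))
    (hae : ∀ᵐ ω ∂(P x), canonical d 0 ω = x ∧ exitTime D ω = approachTime Dᶜ ω ∧
      ∃ s : ℝ≥0, 0 < s ∧ approachTime Dᶜ ω = s ∧ canonical d s ω ∈ A.extendedClosure D)
    (t : ℝ≥0) {y : CadlagPath d → ℝ≥0∞} (hy : y = fun ω =>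
      ∫⁻ s in Ioo (0 : ℝ) (min (approachTime Dᶜ ω) t).toNNReal,
        ENNReal.ofReal (D.indicator c (canonical d s.toNNReal ω))) :
    (∫⁻ ω, ENNReal.ofReal (Real.exp (-(y ω).toReal) *
        (M - u (canonical d (min (approachTime Dᶜ ω) t).toNNReal ω))) ∂(P x)) +
      ENNReal.ofReal M * (∫⁻ ω, ENNReal.ofReal (1 - Real.exp (-(y ω).toReal)) ∂(P x)) +
      (∫⁻ ω, (∫⁻ r in Ioc (0 : ℝ) (exitMin D t ω),
          ENNReal.ofReal (discount c r ω * -g (canonical d r.toNNReal ω))) ∂(P x)) ≤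
      ENNReal.ofReal (M - u x) := by
  obtain ⟨C, hC⟩ := hu.bounded
  have hsub := hu.subsol x hx t
  set G := ∫⁻ ω, (∫⁻ r in Ioc (0 : ℝ) (exitMin D t ω),
          ENNReal.ofReal (discount c r ω * -g (canonical d r.toNNReal ω))) ∂(P x) with hG
  set e : CadlagPath d → ℝ≥0 := fun ω => (min (approachTime Dᶜ ω) t).toNNReal with he
  have hem : Measurable e := ((measurable_approachTime _).min measurable_const).ennreal_toNNReal
  have heS : ∀ ω, (e ω : ℝ≥0∞) ≤ approachTime Dᶜ ω := fun ω => by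
    rw [he, ENNReal.coe_toNNReal (min_lt_of_right_lt ENNReal.coe_lt_top).ne]
    exact min_le_left _ _
  have hcm' : Measurable (D.indicator c) := measurable_indicator_of_subtype hD hcm
  have hym : Measurable y := by
    simp only [hy, ← lintegral_Ioc_min_approachTime]
    exact Measurable.lintegral_prod_right' (f := fun p : CadlagPath d × ℝ =>
      {ω | (p.2.toNNReal : ℝ≥0∞) < approachTime Dᶜ ω}.indicator (fun ω => ENNReal.ofReal
        (D.indicator c (canonical d p.2.toNNReal ω))) p.1)
      (measurable_killedPath D hcm'.ennreal_ofReal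
        (measurable_real_toNNReal.comp measurable_snd) measurable_fst)
  set q : CadlagPath d → ℝ := fun ω => Real.exp (-(y ω).toReal) with hq
  have hqm : Measurable q := (hym.ennreal_toReal.neg).exp
  have hq0 : ∀ ω, 0 < q ω := fun ω => Real.exp_pos _
  have hq1 : ∀ ω, q ω ≤ 1 := fun ω =>
    Real.exp_le_one_iff.2 (neg_nonpos.2 ENNReal.toReal_nonneg)
  have hXe : Measurable fun ω => u (canonical d (e ω) ω) := hu.measurable.comp hem.canonical_comp
  have hE : ∫ ω, discount c (exitMin D t ω) ω * u (canonical d (exitMin D t ω) ω) ∂(P x) =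
      ∫ ω, q ω * u (canonical d (e ω) ω) ∂(P x) := by
    refine integral_congr_ae ?_
    filter_upwards [hae] with ω hω
    rw [exitMin_eq_of_exitTime_eq hω.2.1, discount_eq hD hcm hc0 (heS ω), hq, hy]
  have hqi : Integrable q (P x) := Integrable.of_bound hqm.aestronglyMeasurable 1
    (Eventually.of_forall fun ω => by rw [Real.norm_of_nonneg (hq0 ω).le]; exact hq1 ω)
  have hqu : Integrable (fun ω => q ω * u (canonical d (e ω) ω)) (P x) :=
    Integrable.of_bound (hqm.mul hXe).aestronglyMeasurable (1 * C)
      (Eventually.of_forall fun ω => by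
        rw [norm_mul, Real.norm_of_nonneg (hq0 ω).le]
        exact mul_le_mul (hq1 ω) (hC _) (norm_nonneg _) zero_le_one)
  rw [hE] at hsub
  -- an infinite source term would contradict the finite right-hand side
  have hGtop : G ≠ ∞ := fun h => by
    rw [h, EReal.coe_ennreal_top, EReal.coe_add_top, top_le_iff] at hsub
    exact EReal.coe_ne_top _ hsub
  have hreal : u x + G.toReal ≤ ∫ ω, q ω * u (canonical d (e ω) ω) ∂(P x) := by
    rw [← ENNReal.coe_toNNReal hGtop, EReal.coe_nnreal_eq_coe_real, ← EReal.coe_add,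
      EReal.coe_le_coe_iff] at hsub
    exact hsub
  have hZ0 : ∀ᵐ ω ∂(P x), 0 ≤ q ω * (M - u (canonical d (e ω) ω)) := by
    filter_upwards [hae] with ω hω
    exact mul_nonneg (hq0 ω).le (sub_nonneg.2 (hM _ (canonical_exitMin_mem hω.2.2 t)))
  have hZi : Integrable (fun ω => q ω * (M - u (canonical d (e ω) ω))) (P x) := by
    simp only [mul_sub]
    exact (hqi.mul_const M).sub hqu
  have hZ : ∫ ω, q ω * (M - u (canonical d (e ω) ω)) ∂(P x) =
      M * ∫ ω, q ω ∂(P x) - ∫ ω, q ω * u (canonical d (e ω) ω) ∂(P x) := by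
    simp only [mul_sub]
    rw [integral_sub (hqi.mul_const M) hqu, integral_mul_const, mul_comm]
  have h1q : ∫ ω, (1 - q ω) ∂(P x) = 1 - ∫ ω, q ω ∂(P x) := by
    rw [integral_sub (integrable_const _) hqi]
    simp
  have h1qi : Integrable (fun ω => 1 - q ω) (P x) := (integrable_const _).sub hqi
  have h1q0 : 0 ≤ ∫ ω, (1 - q ω) ∂(P x) :=
    integral_nonneg fun ω => sub_nonneg.2 (hq1 ω)
  rw [← ofReal_integral_eq_lintegral_ofReal hZi hZ0, ← ofReal_integral_eq_lintegral_ofReal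
    h1qi (Eventually.of_forall fun ω => sub_nonneg.2 (hq1 ω)),
    ← ENNReal.ofReal_mul hM0, ← ENNReal.ofReal_add (integral_nonneg_of_ae hZ0)
      (mul_nonneg hM0 h1q0), ← ENNReal.ofReal_toReal hGtop, ← ENNReal.ofReal_add
        (add_nonneg (integral_nonneg_of_ae hZ0) (mul_nonneg hM0 h1q0)) ENNReal.toReal_nonneg]
  refine ENNReal.ofReal_le_ofReal ?_
  rw [hZ, h1q]
  linarith

/-- The gap `M - u` between a weak subsolution and its maximum is excessive for the killed
semigroup, discounted at the rate `K` that bounds `c`. -/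
theorem IsWeakSubsolution.approachSemigroup_le {d : ℕ} {A : LevyCoeff d} {D : Set (Rd d)}
    (hD : MeasurableSet D) {P : Kernel (Rd d) (CadlagPath d)} {c g u : Rd d → ℝ}
    (hu : IsWeakSubsolution P D c g u) (hcm : Measurable fun x : D => c x)
    (hc0 : ∀ x ∈ D, 0 ≤ c x) {K : ℝ≥0} (hcK : ∀ x ∈ D, c x ≤ K) {M : ℝ}
    (hM : ∀ y ∈ A.extendedClosure D, u y ≤ M) (hM0 : 0 ≤ M) {x : Rd d} (hx : x ∈ D)
    (hprob : IsProbabilityMeasure (P x))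
    (hae : ∀ᵐ ω ∂(P x), canonical d 0 ω = x ∧ exitTime D ω = approachTime Dᶜ ω ∧
      ∃ s : ℝ≥0, 0 < s ∧ approachTime Dᶜ ω = s ∧ canonical d s ω ∈ A.extendedClosure D)
    (t : ℝ≥0) :
    ENNReal.ofReal (Real.exp (-(K * t))) *
      approachSemigroup P D t (fun y => ENNReal.ofReal (M - u y)) x ≤ ENNReal.ofReal (M - u x) := by
  refine le_trans ?_ ((le_self_add.trans le_self_add).trans
    (hu.lintegral_add_le hD hcm hc0 hM hM0 hx hprob hae t rfl))
  rw [approachSemigroup, ← lintegral_const_mul' _ _ ENNReal.ofReal_ne_top]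
  refine lintegral_mono fun ω => ?_
  by_cases h : (t : ℝ≥0∞) < approachTime Dᶜ ω
  swap
  · simp [h]
  rw [indicator_of_mem (by exact h), min_eq_right h.le, ENNReal.toNNReal_coe,
    ENNReal.ofReal_mul (Real.exp_pos _).le]
  gcongr
  refine ENNReal.toReal_le_of_le_ofReal (by positivity) ?_
  refine (lintegral_indicator_canonical_le hcK ω t).trans (le_of_eq ?_)
  rw [ENNReal.ofReal_mul K.coe_nonneg]
  simp

theorem IsWeakSubsolution.mul_lintegral_le {d : ℕ} {A : LevyCoeff d} {D : Set (Rd d)}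
    (hD : MeasurableSet D) {P : Kernel (Rd d) (CadlagPath d)} [IsSFiniteKernel P]
    {c g u : Rd d → ℝ}
    (hu : IsWeakSubsolution P D c g u) (hcm : Measurable fun x : D => c x)
    (hc0 : ∀ x ∈ D, 0 ≤ c x) {K : ℝ≥0} (hcK : ∀ x ∈ D, c x ≤ K) {M : ℝ}
    (hM : ∀ y ∈ A.extendedClosure D, u y ≤ M) (hM0 : 0 ≤ M) {x : Rd d} (hx : x ∈ D)
    (hprob : IsProbabilityMeasure (P x))
    (hae : ∀ᵐ ω ∂(P x), canonical d 0 ω = x ∧ exitTime D ω = approachTime Dᶜ ω ∧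
      ∃ s : ℝ≥0, 0 < s ∧ approachTime Dᶜ ω = s ∧ canonical d s ω ∈ A.extendedClosure D)
    (t : ℝ≥0) :
    ENNReal.ofReal M * (ENNReal.ofReal (Real.exp (-(K * t))) * ∫⁻ r in Ioc (0 : ℝ) t,
      approachSemigroup P D r.toNNReal (fun y => ENNReal.ofReal (D.indicator c y)) x) ≤
        ENNReal.ofReal (M - u x) := by
  refine le_trans ?_ ((le_add_self.trans le_self_add).trans
    (hu.lintegral_add_le hD hcm hc0 hM hM0 hx hprob hae t rfl))
  rw [lintegral_approachSemigroup P D (measurable_indicator_of_subtype hD hcm).ennreal_ofReal,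
    ← lintegral_const_mul' _ _ ENNReal.ofReal_ne_top]
  gcongr with ω
  have hle := lintegral_indicator_canonical_le hcK ω (min (approachTime Dᶜ ω) t).toNNReal
  set y := ∫⁻ s in Ioo (0 : ℝ) (min (approachTime Dᶜ ω) t).toNNReal,
        ENNReal.ofReal (D.indicator c (canonical d s.toNNReal ω))
  have hle' : y ≤ ENNReal.ofReal (K * t) := by
    rw [ENNReal.ofReal_mul K.coe_nonneg, ENNReal.ofReal_coe_nnreal, ENNReal.ofReal_coe_nnreal]
    refine hle.trans ?_
    gcongr
    rw [← ENNReal.coe_le_coe, ENNReal.coe_toNNReal (min_lt_of_right_lt ENNReal.coe_lt_top).ne]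
    exact min_le_right _ _
  have hfin : y ≠ ∞ := (hle'.trans_lt ENNReal.ofReal_lt_top).ne
  have hyt : y.toReal ≤ K * t := ENNReal.toReal_le_of_le_ofReal (by positivity) hle'
  rw [← ENNReal.ofReal_toReal hfin, ← ENNReal.ofReal_mul (Real.exp_pos _).le,
    ENNReal.toReal_ofReal ENNReal.toReal_nonneg]
  refine ENNReal.ofReal_le_ofReal ?_
  -- `y exp (-y) ≤ 1 - exp (-y)`
  have h1 : Real.exp (-(K * t)) ≤ Real.exp (-y.toReal) := Real.exp_le_exp.2 (neg_le_neg hyt)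
  have h2 := Real.add_one_le_exp y.toReal
  have h3 : Real.exp (-y.toReal) * Real.exp y.toReal = 1 := by
    rw [← Real.exp_add]; simp
  have h4 := Real.exp_pos (-y.toReal)
  have h5 : 0 ≤ y.toReal := ENNReal.toReal_nonneg
  nlinarith

theorem IsWeakSubsolution.lintegral_source_le {d : ℕ} {A : LevyCoeff d} {D : Set (Rd d)}
    (hD : MeasurableSet D) {P : Kernel (Rd d) (CadlagPath d)} [IsSFiniteKernel P]
    {c g u : Rd d → ℝ}
    (hu : IsWeakSubsolution P D c g u) (hcm : Measurable fun x : D => c x)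
    (hgm : Measurable fun x : D => g x)
    (hc0 : ∀ x ∈ D, 0 ≤ c x) {K : ℝ≥0} (hcK : ∀ x ∈ D, c x ≤ K) {M : ℝ}
    (hM : ∀ y ∈ A.extendedClosure D, u y ≤ M) (hM0 : 0 ≤ M) {x : Rd d} (hx : x ∈ D)
    (hprob : IsProbabilityMeasure (P x))
    (hae : ∀ᵐ ω ∂(P x), canonical d 0 ω = x ∧ exitTime D ω = approachTime Dᶜ ω ∧
      ∃ s : ℝ≥0, 0 < s ∧ approachTime Dᶜ ω = s ∧ canonical d s ω ∈ A.extendedClosure D)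
    (t : ℝ≥0) :
    ENNReal.ofReal (Real.exp (-(K * t))) * ∫⁻ r in Ioc (0 : ℝ) t,
      approachSemigroup P D r.toNNReal (fun y => ENNReal.ofReal (-D.indicator g y)) x ≤
        ENNReal.ofReal (M - u x) := by
  refine le_trans ?_ (le_add_self.trans
    (hu.lintegral_add_le hD hcm hc0 hM hM0 hx hprob hae t rfl))
  have hgm' : Measurable fun y => ENNReal.ofReal (-D.indicator g y) :=
    (measurable_indicator_of_subtype hD hgm).neg.ennreal_ofReal
  rw [lintegral_approachSemigroup P D hgm',
    ← lintegral_const_mul' _ _ ENNReal.ofReal_ne_top]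
  refine lintegral_mono_ae ?_
  filter_upwards [hae] with ω hω
  rw [exitMin_eq_of_exitTime_eq hω.2.1, ← restrict_Ioo_eq_restrict_Ioc,
    ← lintegral_const_mul' _ _ ENNReal.ofReal_ne_top]
  have hfin : min (approachTime Dᶜ ω) (t : ℝ≥0∞) ≠ ∞ :=
    (min_lt_of_right_lt ENNReal.coe_lt_top).ne
  refine setLIntegral_mono' measurableSet_Ioo fun r hr => ?_
  lift r to ℝ≥0 using hr.1.le
  have hr' : (r : ℝ≥0∞) < min (approachTime Dᶜ ω) t := by
    rw [← ENNReal.coe_toNNReal hfin]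
    exact_mod_cast hr.2
  have hrD : canonical d r ω ∈ D := not_not.1
    (notMem_of_lt_approachTime (F := Dᶜ) (hr'.trans_le (min_le_left _ _)))
  rw [Real.toNNReal_coe, indicator_of_mem hrD,
    discount_eq hD hcm hc0 (hr'.trans_le (min_le_left _ _)).le, ENNReal.ofReal_mul (Real.exp_pos _).le]
  gcongr
  refine ENNReal.toReal_le_of_le_ofReal (by positivity) ?_
  refine (lintegral_indicator_canonical_le hcK ω r).trans ?_
  rw [ENNReal.ofReal_mul K.coe_nonneg, ENNReal.ofReal_coe_nnreal, ENNReal.ofReal_coe_nnreal]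
  gcongr
  exact (ENNReal.coe_lt_coe.1 (hr'.trans_le (min_le_right _ _))).le

/-! ### Lower bounds by the eigenfunction: minorized resolvent -/

/-- If the path shifted by `t` approaches `F` at time `s`, the path itself approaches `F` by time
`t + s`. -/
theorem approachTime_le_add_pathShift {d : ℕ} (F : Set (Rd d)) (t : ℝ≥0) (ω : CadlagPath d) :
    approachTime F ω ≤ t + approachTime F (pathShift t ω) := by
  by_contra! h
  obtain ⟨v, hv1, hv2⟩ := ENNReal.lt_iff_exists_nnreal_btwn.1 h
  obtain ⟨u, rfl⟩ : ∃ u, v = t + u := exists_add_of_le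
    (ENNReal.coe_le_coe.1 (le_self_add.trans hv1.le))
  obtain ⟨ε, hε, hle⟩ := exists_le_infDist_of_lt_approachTime hv2
  have := le_approachTime_of_le_infDist (F := F) (ω := pathShift t ω) (t := u) hε
    fun r hr => hle (t + r) (by gcongr)
  rw [ENNReal.coe_add] at hv1
  exact absurd this (not_le.2 ((ENNReal.add_lt_add_iff_left ENNReal.coe_ne_top).1 hv1))

/-- The expected time that the process spends within `n` time units before the approach time is at
most `n`. -/
theorem lintegral_approachSemigroup_le {d : ℕ} {A : LevyCoeff d} {D : Set (Rd d)}
    {P : Kernel (Rd d) (CadlagPath d)} (hP : IsStrongMarkovSolution A P) (n : ℕ) (x : Rd d) :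
    ∫⁻ t in Ioi (0 : ℝ), approachSemigroup P D t.toNNReal
      (fun y => P y {ω | approachTime Dᶜ ω ≤ n}) x ≤ n := by
  have := (hP.solution x).prob
  have hSm : Measurable (approachTime (d := d) Dᶜ) := measurable_approachTime _
  -- the Markov property at time `t`
  have h1 : ∀ t : ℝ≥0, approachSemigroup P D t (fun y => P y {ω | approachTime Dᶜ ω ≤ n}) x ≤
      P x {ω | (t : ℝ≥0∞) ≤ approachTime Dᶜ ω ∧ approachTime Dᶜ ω ≤ t + n} := by
    intro t
    have hB : MeasurableSet[canonicalFiltration d t]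
        {ω : CadlagPath d | (t : ℝ≥0∞) ≤ approachTime Dᶜ ω} := by
      convert (measurableSet_approachTime_lt (d := d) Dᶜ t).compl using 1
      ext ω
      simp
    have hM := hP.strongMarkov x (fun _ => (t : WithTop ℝ≥0)) (isStoppingTime_const _ t)
      {ω | (t : ℝ≥0∞) ≤ approachTime Dᶜ ω} {ω | approachTime Dᶜ ω ≤ n}
      (by rwa [IsStoppingTime.measurableSpace_const]) (measurableSet_le hSm measurable_const)
    simp only [ne_eq, WithTop.coe_ne_top, not_false_eq_true, true_and, WithTop.untopD_coe,
      ofPred_true, inter_univ] at hM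
    have hBm := (canonicalFiltration d).le t _ hB
    calc _ ≤ ∫⁻ ω, {ω : CadlagPath d | (t : ℝ≥0∞) ≤ approachTime Dᶜ ω}.indicator
          (fun ω => P (canonical d t ω) {ω | approachTime Dᶜ ω ≤ n}) ω ∂(P x) :=
          lintegral_mono fun ω => indicator_le_indicator_of_subset
            (s := {ω : CadlagPath d | (t : ℝ≥0∞) < approachTime Dᶜ ω})
            (fun ω (hω : (t : ℝ≥0∞) < approachTime Dᶜ ω) => hω.le) (fun _ => zero_le) ω
      _ = _ := by rw [lintegral_indicator hBm, ← hM]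
      _ ≤ _ := by
          refine measure_mono fun ω hω => ⟨hω.1, ?_⟩
          refine (approachTime_le_add_pathShift Dᶜ t ω).trans ?_
          gcongr
          exact hω.2
  have hset : MeasurableSet {p : ℝ × CadlagPath d |
      (p.1.toNNReal : ℝ≥0∞) ≤ approachTime Dᶜ p.2 ∧
        approachTime Dᶜ p.2 ≤ p.1.toNNReal + n} := by
    have h2 : Measurable fun p : ℝ × CadlagPath d => (p.1.toNNReal : ℝ≥0∞) :=
      (measurable_real_toNNReal.comp measurable_fst).coe_nnreal_ennreal
    have h3 : Measurable fun p : ℝ × CadlagPath d => approachTime Dᶜ p.2 :=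
      hSm.comp measurable_snd
    exact (measurableSet_le h2 h3).inter (measurableSet_le h3 (h2.add measurable_const))
  calc _ ≤ ∫⁻ t in Ioi (0 : ℝ), P x (Prod.mk t ⁻¹' {p : ℝ × CadlagPath d |
        (p.1.toNNReal : ℝ≥0∞) ≤ approachTime Dᶜ p.2 ∧
          approachTime Dᶜ p.2 ≤ p.1.toNNReal + n}) :=
        lintegral_mono fun t => h1 t.toNNReal
    _ = ∫⁻ ω, (volume.restrict (Ioi (0 : ℝ))) ((fun t => (t, ω)) ⁻¹' {p : ℝ × CadlagPath d |
        (p.1.toNNReal : ℝ≥0∞) ≤ approachTime Dᶜ p.2 ∧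
          approachTime Dᶜ p.2 ≤ p.1.toNNReal + n}) ∂(P x) := by
        rw [← Measure.prod_apply hset, ← Measure.prod_apply_symm hset]
    _ ≤ ∫⁻ ω, (n : ℝ≥0∞) ∂(P x) := by
        refine lintegral_mono fun ω => ?_
        rw [Measure.restrict_apply (hset.preimage measurable_prodMk_right)]
        by_cases htop : approachTime Dᶜ ω = ∞
        · refine le_of_eq_of_le (measure_mono_null (t := ∅) ?_ (by simp)) zero_le
          rintro t ⟨⟨-, h⟩, -⟩
          simp only [htop, top_le_iff] at h
          exact absurd h (by simp)
        · obtain ⟨s, hs⟩ : ∃ s : ℝ≥0, approachTime Dᶜ ω = s :=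
            ⟨_, (ENNReal.coe_toNNReal htop).symm⟩
          refine (measure_mono (t := Icc ((s : ℝ) - n) s) ?_).trans (by simp)
          rintro t ⟨⟨h, h'⟩, ht⟩
          lift t to ℝ≥0 using (mem_Ioi.1 ht).le
          simp only [Real.toNNReal_coe, hs] at h h'
          have h2 : t ≤ s := by exact_mod_cast h
          have h3 : s ≤ t + n := by exact_mod_cast h'
          rw [← NNReal.coe_le_coe] at h2 h3
          push_cast at h3
          exact ⟨by linarith, h2⟩
    _ = n := by simp

theorem tendsto_measure_lt_approachTime {d : ℕ} {D : Set (Rd d)} {Q : Measure (CadlagPath d)}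
    [IsProbabilityMeasure Q] (h : ∀ᵐ ω ∂Q, approachTime Dᶜ ω ≠ ∞) :
    Tendsto (fun n : ℕ => Q {ω | (n : ℝ≥0∞) < approachTime Dᶜ ω}) atTop (𝓝 0) := by
  have hSm : Measurable (approachTime (d := d) Dᶜ) := measurable_approachTime _
  have := tendsto_measure_iInter_atTop (μ := Q)
    (s := fun n : ℕ => {ω | (n : ℝ≥0∞) < approachTime Dᶜ ω})
    (fun n => (measurableSet_lt measurable_const hSm).nullMeasurableSet)
    (fun i j hij ω hω => lt_of_le_of_lt (by exact_mod_cast hij) (mem_ofPred.1 hω))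
    ⟨0, measure_ne_top _ _⟩
  have h0 : Q (⋂ n : ℕ, {ω | (n : ℝ≥0∞) < approachTime Dᶜ ω}) = 0 := by
    refine measure_mono_null (fun ω hω => ?_) (ae_iff.1 h)
    simp only [mem_iInter, mem_ofPred_eq] at hω
    intro htop
    obtain ⟨n, hn⟩ := ENNReal.exists_nat_gt htop
    exact absurd (hω n) (not_lt.2 hn.le)
  rwa [h0] at this

/-- Under the minorization condition without discount the eigenvalue is positive: otherwise the
eigenfunction would be bounded, and its mean over the surviving paths would tend to zero. -/
theorem EigenMinorization.eigenvalue_ne_zero {d : ℕ} {A : LevyCoeff d} {D : Set (Rd d)}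
    {P : Kernel (Rd d) (CadlagPath d)} (hP : IsStrongMarkovSolution A P)
    {m ν : Measure (Rd d)} {φD : Rd d → ℝ} (hmin : EigenMinorization P D m φD 0 ν)
    (hmν : m.restrict D ≪ ν.restrict D) (hmD : m.restrict D ≠ 0) (hφ : ∀ x ∈ D, 0 < φD x)
    (hD : MeasurableSet D)
    (hS : ∀ x ∈ D, ∀ᵐ ω ∂(P x), exitTime D ω = approachTime Dᶜ ω)
    (hfin : ∀ x ∈ D, ∀ᵐ ω ∂(P x), approachTime Dᶜ ω ≠ ∞) {lam : ℝ}
    (hlam : IsEigenpair P D m φD lam) : lam ≠ 0 := by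
  rintro rfl
  have hSm : Measurable (approachTime (d := d) Dᶜ) := measurable_approachTime _
  set f : ℕ → Rd d → ℝ≥0∞ := fun n y => P y {ω | approachTime Dᶜ ω ≤ n} with hf
  have hfm : ∀ n, Measurable (f n) := fun n =>
    Kernel.measurable_coe _ (measurableSet_le hSm measurable_const)
  have hbound : ∀ n, ∀ x ∈ D, ENNReal.ofReal (φD x) * ∫⁻ y in D, f n y ∂ν ≤ n := by
    intro n x hx
    refine (hmin.2 (f n) (hfm n) ⟨1, fun y => ?_⟩ x hx).trans ?_
    · have := (hP.solution y).prob
      exact prob_le_one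
    · refine le_trans (le_of_eq ?_) (lintegral_approachSemigroup_le (D := D) hP n x)
      refine lintegral_congr fun t => ?_
      rw [killedSemigroup_eq_approachSemigroup (hS x hx)]
      simp [hf]
  obtain ⟨n, hn⟩ : ∃ n, ∫⁻ y in D, f n y ∂ν ≠ 0 := by
    by_contra! hcon
    have h0 : ∀ᵐ y ∂(m.restrict D), ∀ n, f n y = 0 :=
      hmν.ae_le (ae_all_iff.2 fun n => (lintegral_eq_zero_iff (hfm n)).1 (hcon n))
    have : (ae (m.restrict D)).NeBot := ae_neBot.2 hmD
    obtain ⟨y, hy, hyD⟩ := (h0.and (ae_restrict_mem hD)).exists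
    have := (hP.solution y).prob
    have hun : P y (⋃ n : ℕ, {ω | approachTime Dᶜ ω ≤ n}) = 0 := measure_iUnion_null hy
    have hone : ∀ᵐ ω ∂(P y), ω ∉ ⋃ n : ℕ, {ω | approachTime Dᶜ ω ≤ n} := measure_eq_zero_iff_ae_notMem.1 hun
    obtain ⟨ω, h1, h2⟩ := (hone.and (hfin y hyD)).exists
    obtain ⟨k, hk⟩ := ENNReal.exists_nat_gt h2
    exact h1 (mem_iUnion.2 ⟨k, hk.le⟩)
  set C : ℝ≥0∞ := n / ∫⁻ y in D, f n y ∂ν with hC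
  have hCtop : C ≠ ∞ := (ENNReal.div_lt_top (ENNReal.natCast_ne_top n) hn).ne
  have hφC : ∀ x ∈ D, ENNReal.ofReal (φD x) ≤ C := fun x hx =>
    (ENNReal.le_div_iff_mul_le (Or.inl hn) (Or.inr (ENNReal.natCast_ne_top n))).2 (hbound n x hx)
  obtain ⟨x, hx⟩ : D.Nonempty := by
    by_contra h
    rw [not_nonempty_iff_eq_empty] at h
    exact hmD (by simp [h])
  have := (hP.solution x).prob
  have hle : ∀ k : ℕ, ENNReal.ofReal (φD x) ≤ C * P x {ω | (k : ℝ≥0∞) < approachTime Dᶜ ω} := by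
    intro k
    have h1 := hlam.eigen k x hx
    rw [killedSemigroup_eq_approachSemigroup (hS x hx)] at h1
    simp only [neg_zero, zero_mul, Real.exp_zero, one_mul] at h1
    rw [h1]
    refine (approachSemigroup_mono P _ hφC x).trans ?_
    rw [approachSemigroup, ← lintegral_indicator_const (measurableSet_lt measurable_const hSm)]
    exact le_rfl
  have hlim := ENNReal.Tendsto.const_mul (tendsto_measure_lt_approachTime (hfin x hx))
    (Or.inr hCtop)
  rw [mul_zero] at hlim
  have := ge_of_tendsto' hlim hle
  rw [nonpos_iff_eq_zero, ENNReal.ofReal_eq_zero] at this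
  exact absurd (hφ x hx) (not_lt.2 this)

/-- Under the minorization condition, the expected value of the integral of `f` over a long enough
time interval dominates the eigenfunction.  To bound the contribution of late times, `f` is replaced
by its minimum with the eigenfunction. -/
theorem EigenMinorization.exists_le_lintegral {d : ℕ} {A : LevyCoeff d} {D : Set (Rd d)}
    {P : Kernel (Rd d) (CadlagPath d)} (hP : IsStrongMarkovSolution A P)
    {m ν : Measure (Rd d)} {φD : Rd d → ℝ} {K : ℝ≥0} (hmin : EigenMinorization P D m φD K ν)
    (hmν : m.restrict D ≪ ν.restrict D) (hmD : m.restrict D ≠ 0) (hφ : ∀ x ∈ D, 0 < φD x)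
    (hD : MeasurableSet D)
    (hS : ∀ x ∈ D, ∀ᵐ ω ∂(P x), exitTime D ω = approachTime Dᶜ ω)
    (hfin : ∀ x ∈ D, ∀ᵐ ω ∂(P x), approachTime Dᶜ ω ≠ ∞)
    {f : Rd d → ℝ≥0∞} (hf : Measurable f) (hfb : ∃ C : ℝ≥0, ∀ y, f y ≤ C)
    (hpos : ∫⁻ y in D, f y ∂m ≠ 0) :
    ∃ (T : ℝ≥0) (κ : ℝ≥0∞), κ ≠ 0 ∧ ∀ x ∈ D, κ * ENNReal.ofReal (φD x) ≤
      ∫⁻ r in Ioc (0 : ℝ) T, approachSemigroup P D r.toNNReal f x := by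
  obtain ⟨lam, hlam⟩ := hmin.1
  have hβ : 0 < (K : ℝ) + lam := by
    rcases eq_or_ne K 0 with rfl | hK
    · have := EigenMinorization.eigenvalue_ne_zero hP (by simpa using hmin) hmν hmD hφ hD hS hfin hlam
      simpa using lt_of_le_of_ne hlam.eigenvalue_nonneg this.symm
    · have : (0 : ℝ) < K := NNReal.coe_pos.2 (pos_iff_ne_zero.2 hK)
      linarith [hlam.eigenvalue_nonneg]
  set β : ℝ := K + lam with hβdef
  set φe : Rd d → ℝ≥0∞ := fun y => ENNReal.ofReal (D.indicator φD y) with hφe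
  have hφem : Measurable φe := (measurable_indicator_of_subtype hD hlam.measurable).ennreal_ofReal
  set f' : Rd d → ℝ≥0∞ := fun y => min (f y) (φe y) with hf'
  have hf'm : Measurable f' := hf.min hφem
  -- the minorizing constant, cut off at `1` to be finite
  set I := ∫⁻ y in D, f' y ∂ν with hI
  have hI0 : I ≠ 0 := by
    intro h
    have h1 : ∀ᵐ y ∂(m.restrict D), f' y = 0 := hmν.ae_le ((lintegral_eq_zero_iff hf'm).1 h)
    refine hpos ((lintegral_eq_zero_iff hf).2 ?_)
    filter_upwards [h1, ae_restrict_mem hD] with y hy hyD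
    rcases min_eq_bot.1 hy with h2 | h2
    · exact h2
    · rw [hφe] at h2
      simp only [indicator_of_mem hyD] at h2
      exact absurd (ENNReal.ofReal_eq_zero.1 h2) (not_le.2 (hφ y hyD))
  set J := min I 1 with hJ
  have hJ0 : J ≠ 0 := by
    rw [hJ]; exact (lt_min (pos_iff_ne_zero.2 hI0) one_pos).ne'
  have hJtop : J ≠ ∞ := (min_lt_of_right_lt ENNReal.one_lt_top).ne
  have hlimT : Tendsto (fun n : ℕ => ENNReal.ofReal (Real.exp (-β * n) / β)) atTop (𝓝 0) := by
    have h1 : Tendsto (fun n : ℕ => Real.exp (-β * n) / β) atTop (𝓝 (0 / β)) := by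
      refine (Real.tendsto_exp_atBot.comp ?_).div_const β
      exact tendsto_natCast_atTop_atTop.const_mul_atTop_of_neg (neg_lt_zero.2 hβ)
    simpa using ENNReal.tendsto_ofReal h1
  obtain ⟨n, hn⟩ := (hlimT.eventually (gt_mem_nhds (ENNReal.half_pos hJ0))).exists
  refine ⟨n, J / 2, (ENNReal.half_pos hJ0).ne', fun x hx => ?_⟩
  have hφx : ENNReal.ofReal (φD x) ≠ ∞ := ENNReal.ofReal_ne_top
  have hS' := killedSemigroup_eq_approachSemigroup (hS x hx)
  have hlow : ENNReal.ofReal (φD x) * J ≤ killedResolvent P D K f' x := by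
    refine le_trans ?_ (hmin.2 f' hf'm ?_ x hx)
    · gcongr
      exact min_le_left _ _
    · obtain ⟨C, hC⟩ := hfb
      exact ⟨C, fun y => (min_le_left _ _).trans (hC y)⟩
  have hsplit : Ioi (0 : ℝ) = Ioc 0 ((n : ℝ≥0) : ℝ) ∪ Ioi ((n : ℝ≥0) : ℝ) :=
    (Ioc_union_Ioi_eq_Ioi (NNReal.coe_nonneg _)).symm
  have h1 : ∫⁻ t in Ioc (0 : ℝ) (n : ℝ≥0), ENNReal.ofReal (Real.exp (-K * t)) *
      killedSemigroup P D t.toNNReal f' x ≤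
      ∫⁻ r in Ioc (0 : ℝ) (n : ℝ≥0), approachSemigroup P D r.toNNReal f x := by
    refine setLIntegral_mono' measurableSet_Ioc fun t ht => ?_
    rw [hS']
    refine (mul_le_of_le_one_left zero_le (ENNReal.ofReal_le_one.2 (Real.exp_le_one_iff.2 ?_))).trans
      (approachSemigroup_mono P _ (fun y _ => min_le_left _ _) x)
    have := K.coe_nonneg
    nlinarith [ht.1]
  -- after time `n` the eigenvalue equation bounds the integrand by `exp (-β t) φD`
  have h2 : ∫⁻ t in Ioi ((n : ℝ≥0) : ℝ), ENNReal.ofReal (Real.exp (-K * t)) *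
      killedSemigroup P D t.toNNReal f' x ≤ J / 2 * ENNReal.ofReal (φD x) := by
    calc _ ≤ ∫⁻ t in Ioi ((n : ℝ≥0) : ℝ), ENNReal.ofReal (Real.exp (-β * t)) *
          ENNReal.ofReal (φD x) := by
          refine setLIntegral_mono' measurableSet_Ioi fun t ht => ?_
          have ht0 : 0 ≤ t := (NNReal.coe_nonneg _).trans (mem_Ioi.1 ht).le
          have h3 : killedSemigroup P D t.toNNReal f' x ≤
              ENNReal.ofReal (Real.exp (-lam * t) * φD x) := by
            have := hlam.eigen t.toNNReal x hx
            rw [Real.coe_toNNReal _ ht0] at this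
            rw [this, hS', hS']
            refine approachSemigroup_mono P _ (fun y hy => ?_) x
            refine (min_le_right _ _).trans (le_of_eq ?_)
            simp [hφe, hy]
          calc _ ≤ _ := mul_le_mul_right h3 _
            _ = _ := by
              rw [← ENNReal.ofReal_mul (Real.exp_pos _).le, ← ENNReal.ofReal_mul (Real.exp_pos _).le,
                ← mul_assoc, ← Real.exp_add]
              congr 3
              rw [hβdef]; ring
      _ = ENNReal.ofReal (Real.exp (-β * n) / β) * ENNReal.ofReal (φD x) := by
          rw [lintegral_mul_const' _ _ hφx, ← ofReal_integral_eq_lintegral_ofReal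
            (integrableOn_exp_mul_Ioi (neg_lt_zero.2 hβ) _)
            (Eventually.of_forall fun t => (Real.exp_pos _).le),
            integral_exp_mul_Ioi (neg_lt_zero.2 hβ)]
          congr 2
          rw [neg_div_neg_eq]
          simp
      _ ≤ _ := by gcongr
  have h3 : J / 2 * ENNReal.ofReal (φD x) + J / 2 * ENNReal.ofReal (φD x) ≤
      (∫⁻ r in Ioc (0 : ℝ) (n : ℝ≥0), approachSemigroup P D r.toNNReal f x) +
        J / 2 * ENNReal.ofReal (φD x) := by
    rw [← add_mul, ENNReal.add_halves, mul_comm]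
    refine hlow.trans ?_
    rw [killedResolvent, hsplit]
    refine (lintegral_union_le _ _ _).trans (add_le_add h1 h2)
  exact (ENNReal.add_le_add_iff_right
    (ENNReal.mul_ne_top (ENNReal.div_ne_top hJtop two_ne_zero) hφx)).1 h3

/-! ### Lower bounds by the eigenfunction: intrinsic ultracontractivity -/

theorem exists_isCompact_subset_measure_pos {d : ℕ} {m : Measure (Rd d)} {D : Set (Rd d)}
    (hD : MeasurableSet D) (hfin : m D < ∞) (h0 : m.restrict D ≠ 0) :
    ∃ K ⊆ D, IsCompact K ∧ m K ≠ 0 := by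
  have : IsFiniteMeasure (m.restrict D) := ⟨by simpa using hfin⟩
  have hpos : 0 < (m.restrict D) D := by
    rw [Measure.restrict_apply_self]
    exact pos_iff_ne_zero.2 fun h => h0 (Measure.restrict_eq_zero.2 h)
  obtain ⟨K, hKD, hK, hlt⟩ := hD.exists_lt_isCompact_of_ne_top (measure_ne_top _ _) hpos
  exact ⟨K, hKD, hK, (hlt.trans_le (Measure.restrict_apply_le _ _)).ne'⟩

/-- Under intrinsic ultracontractivity, a function that is excessive for the discounted killed
semigroup dominates a multiple of the eigenfunction as soon as it dominates the accumulated mean of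
a nonzero function.  The mass of the eigenfunction is concentrated on a compact set, up to a
fraction that is uniform in the starting point, and the density is bounded below on compact sets;
two steps of the semigroup combine these facts. -/
theorem IntrinsicallyUltracontractive.exists_mul_le {d : ℕ} {D : Set (Rd d)} (hD : IsOpen D)
    {P : Kernel (Rd d) (CadlagPath d)} [IsSFiniteKernel P] {m : Measure (Rd d)} {φD : Rd d → ℝ}
    (hiu : IntrinsicallyUltracontractive P D m φD) (hmD : m.restrict D ≠ 0)
    (hS : ∀ x ∈ D, ∀ᵐ ω ∂(P x), exitTime D ω = approachTime Dᶜ ω) (K : ℝ≥0)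
    {f : Rd d → ℝ≥0∞} (hf : Measurable f) (hfb : ∃ C : ℝ≥0, ∀ y, f y ≤ C)
    (hpos : ∫⁻ y in D, f y ∂m ≠ 0) :
    ∃ κ : ℝ≥0∞, κ ≠ 0 ∧ ∀ w : Rd d → ℝ≥0∞, Measurable w → (∃ C : ℝ≥0, ∀ y, w y ≤ C) →
      (∀ (t : ℝ≥0), ∀ x ∈ D,
        ENNReal.ofReal (Real.exp (-(K * t))) * approachSemigroup P D t w x ≤ w x) →
      ∀ s : ℝ≥0∞, (∀ x ∈ D, s * (∫⁻ r in Ioc (0 : ℝ) (1 : ℝ≥0),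
        approachSemigroup P D r.toNNReal f x) ≤ w x) →
      ∀ x ∈ D, s * (κ * ENNReal.ofReal (φD x)) ≤ w x := by
  obtain ⟨hmfin, p, φdual, lam, hp, -, ⟨hφc, hφ0, Cφ, hCφ⟩, ⟨hψc, hψ0, Cψ, hCψ⟩, heig, hub⟩ := hiu
  have hDm := hD.measurableSet
  have hfinm : IsFiniteMeasure (m.restrict D) := ⟨by simpa using hmfin⟩
  -- the semigroup through its density
  have hsem : ∀ t : ℝ≥0, 0 < t → ∀ w : Rd d → ℝ≥0∞, Measurable w → (∃ C : ℝ≥0, ∀ y, w y ≤ C) →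
      ∀ x ∈ D, approachSemigroup P D t w x = ∫⁻ y in D, ENNReal.ofReal (p t x y) * w y ∂m :=
    fun t ht w hw hwb x hx => by
      rw [← (hp t ht).2.2.2 w hw hwb x hx, killedSemigroup_eq_approachSemigroup (hS x hx)]
  have hpc : ∀ t : ℝ≥0, 0 < t → ∀ x ∈ D, ContinuousOn (p t x) D := fun t ht x hx =>
    (hp t ht).1.comp (f := fun y => (x, y)) (by fun_prop) fun y hy => ⟨hx, hy⟩
  set h : Rd d → ℝ≥0∞ := fun y =>
    ∫⁻ r in Ioc (0 : ℝ) (1 : ℝ≥0), approachSemigroup P D r.toNNReal f y with hh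
  have hmeas := measurable_approachSemigroup P D hf
  have hhm : Measurable h := (hmeas.comp measurable_swap).lintegral_prod_right'
  have hhpos : ∀ y ∈ D, h y ≠ 0 := by
    intro y hy h0
    have hm' : Measurable fun r : ℝ => approachSemigroup P D r.toNNReal f y :=
      hmeas.comp measurable_prodMk_right
    replace h0 : ∫⁻ r in Ioc (0 : ℝ) (1 : ℝ≥0), approachSemigroup P D r.toNNReal f y = 0 := h0
    rw [lintegral_eq_zero_iff hm'] at h0
    have hne : (ae (volume.restrict (Ioc (0 : ℝ) (1 : ℝ≥0)))).NeBot :=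
      ae_neBot.2 (by simp)
    obtain ⟨r, hr, hr0⟩ := (h0.and (ae_restrict_mem measurableSet_Ioc)).exists
    have hr0' : 0 < r.toNNReal := Real.toNNReal_pos.2 hr0.1
    have hr' : approachSemigroup P D r.toNNReal f y = 0 := hr
    have hpm : AEMeasurable (fun z => ENNReal.ofReal (p r.toNNReal y z) * f z) (m.restrict D) :=
      ((hpc _ hr0' y hy).aemeasurable hDm).ennreal_ofReal.mul hf.aemeasurable
    rw [hsem _ hr0' f hf hfb y hy, lintegral_eq_zero_iff' hpm] at hr'
    refine hpos ((lintegral_eq_zero_iff hf).2 ?_)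
    filter_upwards [hr', ae_restrict_mem hDm] with z hz hzD
    rcases mul_eq_zero.1 hz with h1 | h1
    · exact absurd (ENNReal.ofReal_eq_zero.1 h1) (not_le.2 ((hp _ hr0').2.2.1 y hy z hzD))
    · exact h1
  -- a compact set that carries most of the mass of the eigenfunction
  obtain ⟨c, hc0, hc⟩ := hub 1 one_pos
  set ρ : Measure (Rd d) := (m.restrict D).withDensity
    fun y => ENNReal.ofReal (φdual y * φD y) with hρ
  have hρfin : IsFiniteMeasure ρ := by
    refine isFiniteMeasure_withDensity (ne_of_lt ?_)
    refine (setLIntegral_mono' hDm (g := fun _ => ENNReal.ofReal (Cψ * Cφ)) fun y hy => ?_).trans_lt ?_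
    · refine ENNReal.ofReal_le_ofReal (mul_le_mul (hCψ y hy) (hCφ y hy) (hφ0 y hy).le
        ((hψ0 y hy).le.trans (hCψ y hy)))
    · rw [lintegral_const]
      exact ENNReal.mul_lt_top ENNReal.ofReal_lt_top (measure_lt_top _ _)
  have hexp := Real.exp_pos (-lam)
  obtain ⟨K₁, hK₁D, hK₁, hρK₁⟩ := hDm.exists_isCompact_sdiff_lt (μ := ρ) (measure_ne_top _ _)
    (ε := ENNReal.ofReal (Real.exp (-lam) / 2 / c)) (by simp; positivity)
  have hmass : ∀ x ∈ D, ENNReal.ofReal (Real.exp (-lam) / 2 * φD x) ≤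
      ∫⁻ y in K₁, ENNReal.ofReal (p 1 x y * φD y) ∂m := by
    intro x hx
    have h1 : ENNReal.ofReal (Real.exp (-lam) * φD x) ≤
        ∫⁻ y in D, ENNReal.ofReal (p 1 x y * φD y) ∂m := by
      have := (heig 1 one_pos x hx).1
      rw [NNReal.coe_one, mul_one] at this
      rw [this]
      exact ofReal_integral_le_lintegral_ofReal _ _
    have h2 : ∫⁻ y in D \ K₁, ENNReal.ofReal (p 1 x y * φD y) ∂m ≤
        ENNReal.ofReal (Real.exp (-lam) / 2 * φD x) := by
      calc _ ≤ ∫⁻ y in D \ K₁, ENNReal.ofReal (c * φD x) * ENNReal.ofReal (φdual y * φD y) ∂m := by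
            refine setLIntegral_mono' (hDm.diff hK₁.measurableSet) fun y hy => ?_
            rw [← ENNReal.ofReal_mul (mul_pos hc0 (hφ0 x hx)).le]
            refine ENNReal.ofReal_le_ofReal ?_
            rw [← mul_assoc]
            exact mul_le_mul_of_nonneg_right (hc x hx y hy.1) (hφ0 y hy.1).le
        _ = ENNReal.ofReal (c * φD x) * ρ (D \ K₁) := by
            rw [lintegral_const_mul' _ _ ENNReal.ofReal_ne_top, hρ,
              withDensity_apply _ (hDm.diff hK₁.measurableSet),
              Measure.restrict_restrict (hDm.diff hK₁.measurableSet),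
              inter_eq_self_of_subset_left sdiff_subset]
        _ ≤ ENNReal.ofReal (c * φD x) * ENNReal.ofReal (Real.exp (-lam) / 2 / c) := by gcongr
        _ = _ := by
            rw [← ENNReal.ofReal_mul (mul_pos hc0 (hφ0 x hx)).le]
            congr 1
            field_simp
    have h3 : ENNReal.ofReal (Real.exp (-lam) / 2 * φD x) +
        ENNReal.ofReal (Real.exp (-lam) / 2 * φD x) ≤
        (∫⁻ y in K₁, ENNReal.ofReal (p 1 x y * φD y) ∂m) +
          ENNReal.ofReal (Real.exp (-lam) / 2 * φD x) := by
      have hnn : 0 ≤ Real.exp (-lam) / 2 * φD x := mul_nonneg (by positivity) (hφ0 x hx).le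
      rw [← ENNReal.ofReal_add hnn hnn,
        show Real.exp (-lam) / 2 * φD x + Real.exp (-lam) / 2 * φD x = Real.exp (-lam) * φD x by ring]
      refine h1.trans (le_trans ?_ (add_le_add le_rfl h2))
      refine le_trans (le_of_eq ?_) (lintegral_union_le _ K₁ (D \ K₁))
      rw [union_sdiff_cancel hK₁D]
    exact (ENNReal.add_le_add_iff_right ENNReal.ofReal_ne_top).1 h3
  -- a compact set of positive measure, and a lower bound for the density
  obtain ⟨K₂, hK₂D, hK₂, hmK₂⟩ := exists_isCompact_subset_measure_pos hDm hmfin hmD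
  obtain ⟨δ, hδ0, hδ⟩ := (hK₁.prod hK₂).exists_forall_le' (f := Function.uncurry (p 1))
    ((hp 1 one_pos).1.mono (prod_mono hK₁D hK₂D)) (a := 0)
    fun z hz => (hp 1 one_pos).2.2.1 _ (hK₁D hz.1) _ (hK₂D hz.2)
  set H := ∫⁻ y in K₂, h y ∂m with hH
  have hH0 : H ≠ 0 := by
    intro h0
    rw [hH, lintegral_eq_zero_iff hhm] at h0
    have hne : (ae (m.restrict K₂)).NeBot := ae_neBot.2 fun h => hmK₂ (Measure.restrict_eq_zero.1 h)
    obtain ⟨y, hy, hyK⟩ := (h0.and (ae_restrict_mem hK₂.measurableSet)).exists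
    exact hhpos y (hK₂D hyK) hy
  have hCφ0 : 0 < max Cφ 1 := by positivity
  set E := ENNReal.ofReal (Real.exp (-(K * (1 : ℝ≥0)))) with hE
  have hE0 : E ≠ 0 := by simp [hE, Real.exp_pos]
  set κ : ℝ≥0∞ := E * (E * ENNReal.ofReal δ * H * ENNReal.ofReal (1 / max Cφ 1) *
    ENNReal.ofReal (Real.exp (-lam) / 2)) with hκ
  refine ⟨κ, ?_, fun w hw hwb hexc s hs x hx => ?_⟩
  · simp only [hκ, ne_eq, mul_eq_zero, not_or, ENNReal.ofReal_eq_zero, not_le]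
    exact ⟨hE0, ⟨⟨⟨hE0, hδ0⟩, hH0⟩, by positivity⟩, by positivity⟩
  -- the first step: `w` is bounded below on the compact set `K₁`
  have hstep1 : ∀ z ∈ K₁, s * (E * ENNReal.ofReal δ * H) ≤ w z := by
    intro z hz
    refine le_trans ?_ (hexc 1 z (hK₁D hz))
    rw [hsem 1 one_pos w hw hwb z (hK₁D hz)]
    calc s * (E * ENNReal.ofReal δ * H) = E * (ENNReal.ofReal δ * s * H) := by ring
      _ = E * ∫⁻ y in K₂, ENNReal.ofReal δ * s * h y ∂m := by
          rw [lintegral_const_mul _ hhm]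
      _ ≤ E * ∫⁻ y in K₂, ENNReal.ofReal (p 1 z y) * w y ∂m := by
          refine mul_le_mul' le_rfl ?_
          refine setLIntegral_mono' hK₂.measurableSet fun y hy => ?_
          rw [mul_assoc]
          exact mul_le_mul' (ENNReal.ofReal_le_ofReal (hδ (z, y) ⟨hz, hy⟩)) (hs y (hK₂D hy))
      _ ≤ _ := by
          refine mul_le_mul' le_rfl ?_
          exact lintegral_mono_set hK₂D
  refine le_trans ?_ (hexc 1 x hx)
  rw [hsem 1 one_pos w hw hwb x hx]
  set a := s * (E * ENNReal.ofReal δ * H) with ha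
  calc s * (κ * ENNReal.ofReal (φD x))
      = E * (a * ENNReal.ofReal (1 / max Cφ 1) * ENNReal.ofReal (Real.exp (-lam) / 2 * φD x)) := by
        rw [hκ, ha, ENNReal.ofReal_mul (p := Real.exp (-lam) / 2) (by positivity)]
        ring
    _ ≤ E * (a * ENNReal.ofReal (1 / max Cφ 1) *
        ∫⁻ y in K₁, ENNReal.ofReal (p 1 x y * φD y) ∂m) := by
        gcongr
        exact hmass x hx
    _ ≤ E * ∫⁻ y in K₁, a * ENNReal.ofReal (1 / max Cφ 1) * ENNReal.ofReal (p 1 x y * φD y) ∂m := by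
        gcongr
        exact lintegral_const_mul_le _ _
    _ ≤ E * ∫⁻ y in K₁, ENNReal.ofReal (p 1 x y) * w y ∂m := by
        refine mul_le_mul' le_rfl ?_
        refine setLIntegral_mono' hK₁.measurableSet fun y hy => ?_
        have h1 : ENNReal.ofReal (1 / max Cφ 1) * ENNReal.ofReal (φD y) ≤ 1 := by
          rw [← ENNReal.ofReal_mul (by positivity)]
          refine ENNReal.ofReal_le_one.2 ?_
          rw [one_div, inv_mul_le_one₀ hCφ0]
          exact (hCφ y (hK₁D hy)).trans (le_max_left _ _)
        rw [ENNReal.ofReal_mul ((hp 1 one_pos).2.2.1 x hx y (hK₁D hy)).le]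
        calc _ = ENNReal.ofReal (p 1 x y) *
              (a * (ENNReal.ofReal (1 / max Cφ 1) * ENNReal.ofReal (φD y))) := by ring
          _ ≤ ENNReal.ofReal (p 1 x y) * (a * 1) := by gcongr
          _ ≤ _ := by
            rw [mul_one]
            gcongr
            exact hstep1 y hy
    _ ≤ _ := by
        refine mul_le_mul' le_rfl ?_
        exact lintegral_mono_set hK₁D

/-! ### The boundary estimate -/

/-- For a bounded nonzero `f ≥ 0` on `D`, the gap `M - u` dominates a multiple of the
eigenfunction once it dominates the expected value of the integral of `f` up to some time `T`.  Both
`T` and the constant depend on `f` only, and not on `u` or `M`. -/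
theorem exists_mul_le_gap {d : ℕ} {A : LevyCoeff d} {D : Set (Rd d)} (hD : IsOpen D)
    {P : Kernel (Rd d) (CadlagPath d)} [IsSFiniteKernel P] (hP : IsStrongMarkovSolution A P)
    {c g : Rd d → ℝ} (hcm : Measurable fun x : D => c x) (hc0 : ∀ x ∈ D, 0 ≤ c x)
    {K : ℝ≥0} (hcK : ∀ x ∈ D, c x ≤ K) {m : Measure (Rd d)} (hmD : m.restrict D ≠ 0)
    {φD : Rd d → ℝ} (hφ : ∀ x ∈ D, 0 < φD x)
    (hφD : IntrinsicallyUltracontractive P D m φD ∨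
      ∃ ν : Measure (Rd d), m.restrict D ≪ ν.restrict D ∧ EigenMinorization P D m φD K ν)
    (hae : ∀ x ∈ D, ∀ᵐ ω ∂(P x), canonical d 0 ω = x ∧ exitTime D ω = approachTime Dᶜ ω ∧
      ∃ s : ℝ≥0, 0 < s ∧ approachTime Dᶜ ω = s ∧ canonical d s ω ∈ A.extendedClosure D)
    {f : Rd d → ℝ≥0∞} (hf : Measurable f) (hfb : ∃ C : ℝ≥0, ∀ y, f y ≤ C)
    (hpos : ∫⁻ y in D, f y ∂m ≠ 0) :
    ∃ (T : ℝ≥0) (κ : ℝ), 0 < κ ∧ ∀ (u : Rd d → ℝ) (M : ℝ), IsWeakSubsolution P D c g u →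
      (∀ y ∈ A.extendedClosure D, u y ≤ M) → 0 ≤ M → ∀ s : ℝ, 0 ≤ s →
      (∀ x ∈ D, ENNReal.ofReal s * (∫⁻ r in Ioc (0 : ℝ) T, approachSemigroup P D r.toNNReal f x) ≤
        ENNReal.ofReal (M - u x)) → ∀ x ∈ D, s * κ * φD x ≤ M - u x := by
  have hS : ∀ x ∈ D, ∀ᵐ ω ∂(P x), exitTime D ω = approachTime Dᶜ ω := fun x hx =>
    (hae x hx).mono fun ω h => h.2.1
  have hfin : ∀ x ∈ D, ∀ᵐ ω ∂(P x), approachTime Dᶜ ω ≠ ∞ := fun x hx =>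
    (hae x hx).mono fun ω ⟨_, _, s, _, hs, _⟩ => by simp [hs]
  obtain ⟨T, κ, hκ, h⟩ : ∃ (T : ℝ≥0) (κ : ℝ≥0∞), κ ≠ 0 ∧
      ∀ w : Rd d → ℝ≥0∞, Measurable w → (∃ C : ℝ≥0, ∀ y, w y ≤ C) →
      (∀ (t : ℝ≥0), ∀ x ∈ D,
        ENNReal.ofReal (Real.exp (-(K * t))) * approachSemigroup P D t w x ≤ w x) →
      ∀ s : ℝ≥0∞, (∀ x ∈ D, s * (∫⁻ r in Ioc (0 : ℝ) T,
        approachSemigroup P D r.toNNReal f x) ≤ w x) →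
      ∀ x ∈ D, s * (κ * ENNReal.ofReal (φD x)) ≤ w x := by
    rcases hφD with hiu | ⟨ν, hν, hmin⟩
    · exact ⟨1, hiu.exists_mul_le hD hmD hS K hf hfb hpos⟩
    · obtain ⟨T, κ, hκ, h⟩ := hmin.exists_le_lintegral hP hν hmD hφ hD.measurableSet hS hfin
        hf hfb hpos
      exact ⟨T, κ, hκ, fun w _ _ _ s hs x hx => (mul_le_mul_right (h x hx) s).trans (hs x hx)⟩
  have hmin0 : min κ 1 ≠ 0 := (lt_min (pos_iff_ne_zero.2 hκ) one_pos).ne'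
  have hmintop : min κ 1 ≠ ∞ := (min_lt_of_right_lt ENNReal.one_lt_top).ne
  refine ⟨T, (min κ 1).toReal, ENNReal.toReal_pos hmin0 hmintop, fun u M hu hM hM0 s hs hle x hx => ?_⟩
  obtain ⟨C, hC⟩ := hu.bounded
  have h1 := h (fun y => ENNReal.ofReal (M - u y)) (measurable_const.sub hu.measurable).ennreal_ofReal
    ⟨(M + C).toNNReal, fun y => ENNReal.ofReal_le_ofReal (by linarith [neg_le_of_abs_le (hC y)])⟩
    (fun t x hx => hu.approachSemigroup_le hD.measurableSet hcm hc0 hcK hM hM0 hx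
      (hP.solution x).prob (hae x hx) t) _ hle x hx
  have h2 : 0 ≤ M - u x := sub_nonneg.2 (hM x (Or.inr hx))
  rw [← ENNReal.ofReal_le_ofReal_iff h2]
  refine le_trans ?_ h1
  rw [mul_assoc, ENNReal.ofReal_mul hs, ENNReal.ofReal_mul ENNReal.toReal_nonneg,
    ENNReal.ofReal_toReal hmintop]
  gcongr
  exact min_le_left _ _

/-- Quantitative strong maximum principle: a nonconstant weak subsolution lies below its maximum by
a multiple of the eigenfunction.  Excessivity makes the gap dominate its own accumulated mean. -/
theorem IsWeakSubsolution.exists_mul_le_gap {d : ℕ} {A : LevyCoeff d} {D : Set (Rd d)}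
    (hD : IsOpen D)
    {P : Kernel (Rd d) (CadlagPath d)} [IsSFiniteKernel P] (hP : IsStrongMarkovSolution A P)
    {c g : Rd d → ℝ} (hcm : Measurable fun x : D => c x) (hc0 : ∀ x ∈ D, 0 ≤ c x)
    {K : ℝ≥0} (hcK : ∀ x ∈ D, c x ≤ K) {m : Measure (Rd d)}
    (hm : volume.restrict D ≪ m.restrict D) (hmD : m.restrict D ≠ 0)
    {φD : Rd d → ℝ} (hφ : ∀ x ∈ D, 0 < φD x)
    (hφD : IntrinsicallyUltracontractive P D m φD ∨
      ∃ ν : Measure (Rd d), m.restrict D ≪ ν.restrict D ∧ EigenMinorization P D m φD K ν)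
    (hae : ∀ x ∈ D, ∀ᵐ ω ∂(P x), canonical d 0 ω = x ∧ exitTime D ω = approachTime Dᶜ ω ∧
      ∃ s : ℝ≥0, 0 < s ∧ approachTime Dᶜ ω = s ∧ canonical d s ω ∈ A.extendedClosure D)
    {u : Rd d → ℝ} (hu : IsWeakSubsolution P D c g u) (hnc : NonconstantAE D u) {M : ℝ}
    (hM : ∀ y ∈ A.extendedClosure D, u y ≤ M) (hM0 : 0 ≤ M) :
    ∃ κ : ℝ, 0 < κ ∧ ∀ x ∈ D, κ * φD x ≤ M - u x := by
  obtain ⟨C, hC⟩ := hu.bounded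
  have hwm : Measurable fun y => ENNReal.ofReal (M - u y) :=
    (measurable_const.sub hu.measurable).ennreal_ofReal
  have hpos : ∫⁻ y in D, ENNReal.ofReal (M - u y) ∂m ≠ 0 := by
    intro h0
    refine hnc ⟨M, ?_⟩
    filter_upwards [hm.ae_le ((lintegral_eq_zero_iff hwm).1 h0),
      ae_restrict_mem hD.measurableSet] with y hy hyD
    exact le_antisymm (hM y (Or.inr hyD)) (sub_nonpos.1 (ENNReal.ofReal_eq_zero.1 hy))
  obtain ⟨T, κ, hκ, h⟩ := _root_.exists_mul_le_gap (g := g) hD hP hcm hc0 hcK hmD hφ hφD hae hwm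
    ⟨(M + C).toNNReal, fun y => ENNReal.ofReal_le_ofReal (by linarith [neg_le_of_abs_le (hC y)])⟩ hpos
  have hE : 0 < ((T : ℝ) + 1) * Real.exp (K * T) := by positivity
  refine ⟨(((T : ℝ) + 1) * Real.exp (K * T))⁻¹ * κ, by positivity,
    h u M hu hM hM0 _ (inv_pos.2 hE).le fun x hx => ?_⟩
  have hstep : ∀ r ∈ Ioc (0 : ℝ) T, approachSemigroup P D r.toNNReal
      (fun y => ENNReal.ofReal (M - u y)) x ≤
      ENNReal.ofReal (Real.exp (K * T)) * ENNReal.ofReal (M - u x) := by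
    intro r hr
    have h1 := hu.approachSemigroup_le hD.measurableSet hcm hc0 hcK hM hM0 hx
      (hP.solution x).prob (hae x hx) r.toNNReal
    have h2 := mul_le_mul_right h1 (ENNReal.ofReal (Real.exp (K * r.toNNReal)))
    rw [← mul_assoc, ← ENNReal.ofReal_mul (Real.exp_pos _).le, ← Real.exp_add, add_neg_cancel,
      Real.exp_zero, ENNReal.ofReal_one, one_mul] at h2
    refine h2.trans ?_
    rw [Real.coe_toNNReal _ hr.1.le]
    gcongr
    exact hr.2
  calc _ ≤ ENNReal.ofReal (((T : ℝ) + 1) * Real.exp (K * T))⁻¹ * ∫⁻ _ in Ioc (0 : ℝ) T,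
        ENNReal.ofReal (Real.exp (K * T)) * ENNReal.ofReal (M - u x) :=
        mul_le_mul_right (setLIntegral_mono' measurableSet_Ioc hstep) _
    _ = ENNReal.ofReal ((((T : ℝ) + 1) * Real.exp (K * T))⁻¹ * (T * Real.exp (K * T))) *
        ENNReal.ofReal (M - u x) := by
        rw [lintegral_const, Measure.restrict_apply_univ, Real.volume_Ioc, sub_zero,
          ENNReal.ofReal_mul (inv_pos.2 hE).le, ENNReal.ofReal_mul T.coe_nonneg]
        ring
    _ ≤ 1 * ENNReal.ofReal (M - u x) := by
        gcongr
        rw [ENNReal.ofReal_le_one, inv_mul_le_one₀ hE]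
        gcongr
        linarith
    _ = _ := one_mul _

/-- The discount contributes a multiple, uniform in `u`, of `M` times the eigenfunction to the gap
between a weak subsolution and its maximum. -/
theorem exists_mul_mul_le_gap_of_discount {d : ℕ} {A : LevyCoeff d} {D : Set (Rd d)}
    (hD : IsOpen D)
    {P : Kernel (Rd d) (CadlagPath d)} [IsSFiniteKernel P] (hP : IsStrongMarkovSolution A P)
    {c g : Rd d → ℝ} (hcm : Measurable fun x : D => c x) (hc0 : ∀ x ∈ D, 0 ≤ c x)
    {K : ℝ≥0} (hcK : ∀ x ∈ D, c x ≤ K) {m : Measure (Rd d)} (hmD : m.restrict D ≠ 0)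
    {φD : Rd d → ℝ} (hφ : ∀ x ∈ D, 0 < φD x)
    (hφD : IntrinsicallyUltracontractive P D m φD ∨
      ∃ ν : Measure (Rd d), m.restrict D ≪ ν.restrict D ∧ EigenMinorization P D m φD K ν)
    (hae : ∀ x ∈ D, ∀ᵐ ω ∂(P x), canonical d 0 ω = x ∧ exitTime D ω = approachTime Dᶜ ω ∧
      ∃ s : ℝ≥0, 0 < s ∧ approachTime Dᶜ ω = s ∧ canonical d s ω ∈ A.extendedClosure D)
    (hcpos : 0 < ∫⁻ x in D, ENNReal.ofReal (c x) ∂m) :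
    ∃ κ : ℝ, 0 < κ ∧ ∀ (u : Rd d → ℝ) (M : ℝ), IsWeakSubsolution P D c g u →
      (∀ y ∈ A.extendedClosure D, u y ≤ M) → 0 ≤ M → ∀ x ∈ D, κ * M * φD x ≤ M - u x := by
  have hDm := hD.measurableSet
  have hpos : ∫⁻ y in D, ENNReal.ofReal (D.indicator c y) ∂m ≠ 0 := by
    rw [setLIntegral_congr_fun hDm fun y hy => by rw [indicator_of_mem hy]]
    exact hcpos.ne'
  obtain ⟨T, κ, hκ, h⟩ := exists_mul_le_gap (g := g) hD hP hcm hc0 hcK hmD hφ hφD hae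
    (measurable_indicator_of_subtype hDm hcm).ennreal_ofReal
    ⟨K, fun y => by
      rw [← ENNReal.ofReal_coe_nnreal]
      exact ENNReal.ofReal_le_ofReal (indicator_le' hcK (fun _ _ => K.2) _)⟩ hpos
  refine ⟨Real.exp (-(K * T)) * κ, by positivity, fun u M hu hM hM0 x hx => ?_⟩
  have h1 := h u M hu hM hM0 (M * Real.exp (-(K * T))) (by positivity) (fun x hx => by
    rw [ENNReal.ofReal_mul hM0, mul_assoc]
    exact hu.mul_lintegral_le hDm hcm hc0 hcK hM hM0 hx (hP.solution x).prob (hae x hx) T) x hx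
  linarith

/-- The source contributes a multiple, uniform in `u`, of its integral times the eigenfunction to
the gap between a weak subsolution and its maximum. -/
theorem exists_mul_mul_le_gap_of_source {d : ℕ} {A : LevyCoeff d} {D : Set (Rd d)}
    (hD : IsOpen D)
    {P : Kernel (Rd d) (CadlagPath d)} [IsSFiniteKernel P] (hP : IsStrongMarkovSolution A P)
    {c g : Rd d → ℝ} (hcm : Measurable fun x : D => c x) (hc0 : ∀ x ∈ D, 0 ≤ c x)
    {K : ℝ≥0} (hcK : ∀ x ∈ D, c x ≤ K) (hgm : Measurable fun x : D => g x) {m : Measure (Rd d)}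
    (hm : volume.restrict D ≪ m.restrict D) (hmD : m.restrict D ≠ 0)
    {φD : Rd d → ℝ} (hφ : ∀ x ∈ D, 0 < φD x)
    (hφD : IntrinsicallyUltracontractive P D m φD ∨
      ∃ ν : Measure (Rd d), m.restrict D ≪ ν.restrict D ∧ EigenMinorization P D m φD K ν)
    (hae : ∀ x ∈ D, ∀ᵐ ω ∂(P x), canonical d 0 ω = x ∧ exitTime D ω = approachTime Dᶜ ω ∧
      ∃ s : ℝ≥0, 0 < s ∧ approachTime Dᶜ ω = s ∧ canonical d s ω ∈ A.extendedClosure D) :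
    ∃ κ : ℝ, 0 < κ ∧ ∀ (u : Rd d → ℝ) (M : ℝ), IsWeakSubsolution P D c g u →
      (∀ y ∈ A.extendedClosure D, u y ≤ M) → 0 ≤ M → ∀ x ∈ D,
        κ * (∫ y in D, max (-g y) 0) * φD x ≤ M - u x := by
  have hDm := hD.measurableSet
  have hG : 0 ≤ ∫ y in D, max (-g y) 0 := integral_nonneg fun y => le_max_right _ _
  rcases hG.eq_or_lt with hG0 | hG0
  · refine ⟨1, one_pos, fun u M hu hM hM0 x hx => ?_⟩
    rw [← hG0]
    simpa using hM x (Or.inr hx)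
  -- the source may be unbounded, and is therefore cut off
  set f : Rd d → ℝ≥0∞ := fun y => min (ENNReal.ofReal (-D.indicator g y)) 1 with hf
  have hfm : Measurable f :=
    (measurable_indicator_of_subtype hDm hgm).neg.ennreal_ofReal.min measurable_const
  have hpos : ∫⁻ y in D, f y ∂m ≠ 0 := by
    intro h0
    refine hG0.ne' (integral_eq_zero_of_ae ?_)
    filter_upwards [hm.ae_le ((lintegral_eq_zero_iff hfm).1 h0),
      ae_restrict_mem hDm] with y hy hyD
    rcases min_eq_bot.1 hy with h1 | h1
    · rw [indicator_of_mem hyD] at h1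
      exact max_eq_right (ENNReal.ofReal_eq_zero.1 h1)
    · exact absurd h1 one_ne_zero
  obtain ⟨T, κ, hκ, h⟩ := exists_mul_le_gap (g := g) hD hP hcm hc0 hcK hmD hφ hφD hae hfm
    ⟨1, fun y => min_le_right _ _⟩ hpos
  refine ⟨Real.exp (-(K * T)) * κ / ∫ y in D, max (-g y) 0, by positivity,
    fun u M hu hM hM0 x hx => ?_⟩
  rw [div_mul_cancel₀ _ hG0.ne']
  refine h u M hu hM hM0 _ (Real.exp_pos _).le (fun x hx => ?_) x hx
  refine le_trans ?_ (hu.lintegral_source_le hDm hcm hgm hc0 hcK hM hM0 hx (hP.solution x).prob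
    (hae x hx) T)
  gcongr with r
  exact approachSemigroup_mono P _ (fun y _ => min_le_left _ _) x

theorem le_boundaryLiminf {d : ℕ} {D : Set (Rd d)} {φ : ℝ → ℝ} {u φD : Rd d → ℝ} {xh : Rd d}
    {C κ : ℝ} (hC : 0 < C) (hφ : ∀ x ∈ D, 0 < φ (distBoundary D x))
    (hsim : ∀ x ∈ D, φ (distBoundary D x) ≤ C * φD x) (hκ : 0 ≤ κ)
    (h : ∀ x ∈ D, κ * φD x ≤ u xh - u x) :
    ((κ / C : ℝ) : EReal) ≤ boundaryLiminf D φ u xh := by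
  refine le_liminf_of_le (by isBoundedDefault) ?_
  filter_upwards [self_mem_nhdsWithin] with x hx
  rw [EReal.coe_le_coe_iff, div_le_div_iff₀ hC (hφ x hx)]
  calc κ * φ (distBoundary D x) ≤ κ * (C * φD x) := by gcongr; exact hsim x hx
    _ = κ * φD x * C := by ring
    _ ≤ _ := by gcongr; exact h x hx

theorem distBoundary_pos {d : ℕ} {D : Set (Rd d)} (hD : IsOpen D) (hne : (frontier D).Nonempty)
    {x : Rd d} (hx : x ∈ D) : 0 < distBoundary D x := by
  refine (isClosed_frontier.notMem_iff_infDist_pos hne).1 fun h => ?_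
  rw [hD.frontier_eq] at h
  exact h.2 hx

theorem corollary5p3 {d : ℕ} (D : Set (Rd d)) (hDo : IsOpen D) (hDc : IsConnected D)
    (A : LevyCoeff d) (hA : A.Admissible D)
    (P : Kernel (Rd d) (CadlagPath d)) (hP : IsStrongMarkovSolution A P)
    (hET : ExitFinite P D)
    (c : Rd d → ℝ) (hcm : Measurable fun x : D => c x) (hc0 : ∀ x ∈ D, 0 ≤ c x)
    (hcb : ∃ C : ℝ, ∀ x ∈ D, c x ≤ C)
    (g : Rd d → ℝ) (hgm : Measurable fun x : D => g x) (hg : ∀ x ∈ D, g x ≤ 0)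
    (m : Measure (Rd d)) [SigmaFinite m] (hm : volume.restrict D ≪ m.restrict D)
    (φD : Rd d → ℝ)
    (hφD : IntrinsicallyUltracontractive P D m φD ∨
      ∃ ν : Measure (Rd d), m.restrict D ≪ ν.restrict D ∧
        EigenMinorization P D m φD (sSup (c '' D)) ν)
    (φ : ℝ → ℝ) (hφ : ∀ s, 0 < s → 0 < φ s)
    (hsim : ComparableOn D φD (fun x => φ (distBoundary D x))) :
    (∀ u : Rd d → ℝ, IsWeakSubsolution P D c g u → NonconstantAE D u →
      ∃ a : ℝ, 0 < a ∧ ∀ xh, IsBoundaryMax A D u xh →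
        ((a : ℝ) : EReal) ≤ boundaryLiminf D φ u xh) ∧
    (0 < ∫⁻ x in D, ENNReal.ofReal (c x) ∂m → IntegrableOn g D →
      ∃ a : ℝ, 0 < a ∧ ∀ u : Rd d → ℝ, IsWeakSubsolution P D c g u → NonconstantAE D u →
        ∀ xh, IsBoundaryMax A D u xh →
          ((a * (u xh + ∫ y in D, max (-g y) 0) : ℝ) : EReal) ≤ boundaryLiminf D φ u xh) := by

  rcases (frontier D).eq_empty_or_nonempty with hfr | hfr
  · have hno : ∀ u xh, ¬ IsBoundaryMax A D u xh := fun u xh h => by simpa [hfr] using h.1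
    exact ⟨fun u _ _ => ⟨1, one_pos, fun xh h => absurd h (hno u xh)⟩,
      fun _ _ => ⟨1, one_pos, fun u _ _ xh h => absurd h (hno u xh)⟩⟩
  have hne : Dᶜ.Nonempty := hfr.mono (by rw [hDo.frontier_eq]; exact fun x hx => hx.2)
  have hφδ : ∀ x ∈ D, 0 < φ (distBoundary D x) := fun x hx => hφ _ (distBoundary_pos hDo hfr hx)
  obtain ⟨-, C, hC, hsim⟩ := hsim
  have hφ0 : ∀ x ∈ D, 0 < φD x := fun x hx =>
    pos_of_mul_pos_right ((hφδ x hx).trans_le (hsim x hx)) hC.le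
  have : IsMarkovKernel P := ⟨fun x => (hP.solution x).prob⟩
  have hae := fun x (hx : x ∈ D) => hP.ae_exitTime_eq hA hDo hne hET hx
  have hmD : m.restrict D ≠ 0 := by
    intro h0
    rw [h0, Measure.absolutelyContinuous_zero_iff, Measure.restrict_eq_zero] at hm
    exact (hDo.measure_pos volume hDc.nonempty).ne' hm
  have hbdd : BddAbove (c '' D) := by
    obtain ⟨B, hB⟩ := hcb
    exact ⟨B, forall_mem_image.2 hB⟩
  have hK : (((sSup (c '' D)).toNNReal : ℝ≥0) : ℝ) = sSup (c '' D) :=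
    Real.coe_toNNReal _ (Real.sSup_nonneg (forall_mem_image.2 hc0))
  rw [← hK] at hφD
  have hcK : ∀ x ∈ D, c x ≤ ((sSup (c '' D)).toNNReal : ℝ≥0) := fun x hx =>
    (le_csSup hbdd (mem_image_of_mem c hx)).trans_eq hK.symm
  have hmax : ∀ {u : Rd d → ℝ} {xh : Rd d}, IsBoundaryMax A D u xh →
      ∀ y ∈ A.extendedClosure D, u y ≤ u xh := fun h y hy => h.2.1.1 (mem_image_of_mem _ hy)
  refine ⟨fun u hu hnc => ?_, fun hcpos _ => ?_⟩
  · by_cases hex : ∃ x₀, IsBoundaryMax A D u x₀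
    swap
    · exact ⟨1, one_pos, fun xh h => absurd ⟨xh, h⟩ hex⟩
    obtain ⟨x₀, hx₀⟩ := hex
    obtain ⟨κ, hκ, h⟩ := hu.exists_mul_le_gap hDo hP hcm hc0 hcK hm hmD hφ0 hφD hae hnc
      (hmax hx₀) hx₀.2.2
    refine ⟨κ / C, div_pos hκ hC, fun xh hxh => le_boundaryLiminf hC hφδ hsim hκ.le ?_⟩
    rwa [hxh.2.1.unique hx₀.2.1]
  · obtain ⟨κ₁, hκ₁, h₁⟩ := exists_mul_mul_le_gap_of_discount (g := g) hDo hP hcm hc0 hcK hmD hφ0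
      hφD hae hcpos
    obtain ⟨κ₂, hκ₂, h₂⟩ := exists_mul_mul_le_gap_of_source (g := g) hDo hP hcm hc0 hcK hgm hm hmD
      hφ0 hφD hae
    refine ⟨min κ₁ κ₂ / 2 / C, by positivity, fun u hu _ xh hxh => ?_⟩
    have hG : 0 ≤ ∫ y in D, max (-g y) 0 := integral_nonneg fun y => le_max_right _ _
    have hM0 := hxh.2.2
    rw [div_mul_eq_mul_div]
    refine le_boundaryLiminf hC hφδ hsim (by positivity) fun x hx => ?_
    have hφx := (hφ0 x hx).le
    have h3 := h₁ u _ hu (hmax hxh) hM0 x hx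
    have h4 := h₂ u _ hu (hmax hxh) hM0 x hx
    have h5 : min κ₁ κ₂ * u xh * φD x ≤ κ₁ * u xh * φD x := by
      gcongr
      exact min_le_left _ _
    have h6 : min κ₁ κ₂ * (∫ y in D, max (-g y) 0) * φD x ≤
        κ₂ * (∫ y in D, max (-g y) 0) * φD x := by
      gcongr
      exact min_le_right _ _
    linarith
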